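/- Let $d\ge 3$ be an integer, $0<\lambda<1$ and $s=(d-3)+2\lambda$. Let $\mathbb{D}_R=\{x\in\mathbb{R}^d: x_1=0,\ |x|\le R\}$, $\mathbb{D}=\mathbb{D}_1$, and, for $0\le a\le b$, let $\mathscr{R}(a,b)=\{x\in\mathbb{R}^d: x_1=0,\ a\le |x|\le b\}$. Let $Q:\mathbb{D}\to[0,\infty]$ be an external field, that is, a lower semicontinuous function that is finite on a subset of $\mathbb{D}$ of positive surface area (($d-1$)-dimensional) measure. Let $\mathcal{M}(\mathbb{D})$ be the class of Borel probability measures supported on $\mathbb{D}$, and for $\mu\in\mathcal{M}(\mathbb{D})$ let $$I_Q(\mu)=\iint\frac{d\mu(x)\,d\mu(y)}{|x-y|^s}+2\int Q\,d\mu,\qquad V_Q=\inf\{I_Q(\mu):\mu\in\mathcal{M}(\mathbb{D})\}.$$ Assume that $Q$ is invariant under rotations about the polar axis, $Q(x)=Q(r)$ with $r=|x|$ for $x\in\mathbb{D}$, and that $Q(r)$ is a convex $[0,\infty]$-valued function of $r\in[0,1]$. Then there is a unique measure $\mu_Q\in\mathcal{M}(\mathbb{D})$ with $I_Q(\mu_Q)=V_Q$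 (the $s$-extremal measure associated with $Q$), and there are real numbers $0\le a<b\le 1$ such that $\operatorname{supp}\mu_Q=\mathscr{R}(a,b)$. If, in addition, $Q(r)$ is increasing on $[0,1]$ (in the weak sense), then $a=0$, so that $\operatorname{supp}\mu_Q=\mathbb{D}_b$ is a disk of radius $b\le 1$ centered at the origin. If $Q(r)$ is decreasing on $[0,1]$ (in the weak sense), then $b=1$, so that the support is a ring with outer radius $1$. -/

import Mathlib

open MeasureTheory
open scoped ENNReal NNReal

/-- The closed disk of radius `R` centred at the origin in the hyperplane `x₁ = 0` of `ℝᵈ`.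
The first coordinate `x₁` is the one with index `0`. On this hyperplane
`x₂² + ⋯ + x_d² = ‖x‖²`. -/
def hyperdisk (d : ℕ) (R : ℝ) : Set (EuclideanSpace ℝ (Fin d)) :=
  {x | (∀ i : Fin d, (i : ℕ) = 0 → x i = 0) ∧ ‖x‖ ≤ R}

/-- The ring of the points `(0, r x̄)` of `ℝᵈ` with `a ≤ r ≤ b` and `x̄` a unit vector
of `ℝᵈ⁻¹`. -/
def hyperring (d : ℕ) (a b : ℝ) : Set (EuclideanSpace ℝ (Fin d)) :=
  {x | (∀ i : Fin d, (i : ℕ) = 0 → x i = 0) ∧ a ≤ ‖x‖ ∧ ‖x‖ ≤ b}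

/-- The class of unit positive Borel measures supported on the (compact) set `E`. -/
def unitMeasures {d : ℕ} (E : Set (EuclideanSpace ℝ (Fin d))) :
    Set (Measure (EuclideanSpace ℝ (Fin d))) :=
  {μ | IsProbabilityMeasure μ ∧ μ Eᶜ = 0}

/-- The Riesz `s`-potential `x ↦ ∫ |x - y|⁻ˢ dμ(y)`; for `s > 0` the kernel is `∞` at `x = y`. -/
noncomputable def rieszPotential {d : ℕ} (s : ℝ) (μ : Measure (EuclideanSpace ℝ (Fin d)))
    (x : EuclideanSpace ℝ (Fin d)) : ℝ≥0∞ :=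
  ∫⁻ y, edist x y ^ (-s) ∂μ

/-- The Riesz `s`-energy `∬ |x - y|⁻ˢ dμ(x) dμ(y)`. -/
noncomputable def rieszEnergy {d : ℕ} (s : ℝ) (μ : Measure (EuclideanSpace ℝ (Fin d))) : ℝ≥0∞ :=
  ∫⁻ x, rieszPotential s μ x ∂μ

/-- The weighted energy `I_Q(μ) = I_s(μ) + 2 ∫ Q dμ`. -/
noncomputable def weightedEnergy {d : ℕ} (s : ℝ) (Q : EuclideanSpace ℝ (Fin d) → ℝ≥0∞)
    (μ : Measure (EuclideanSpace ℝ (Fin d))) : ℝ≥0∞ :=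
  rieszEnergy s μ + 2 * ∫⁻ x, Q x ∂μ

/-- The minimal weighted energy `V_Q` over the unit measures on `E`. -/
noncomputable def minWeightedEnergy {d : ℕ} (s : ℝ) (E : Set (EuclideanSpace ℝ (Fin d)))
    (Q : EuclideanSpace ℝ (Fin d) → ℝ≥0∞) : ℝ≥0∞ :=
  ⨅ μ ∈ unitMeasures E, weightedEnergy s Q μ

/-- `μ` is an `s`-extremal measure on `E` associated with `Q`. -/
def IsExtremalMeasure {d : ℕ} (s : ℝ) (E : Set (EuclideanSpace ℝ (Fin d)))
    (Q : EuclideanSpace ℝ (Fin d) → ℝ≥0∞) (μ : Measure (EuclideanSpace ℝ (Fin d))) : Prop :=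
  μ ∈ unitMeasures E ∧ weightedEnergy s Q μ = minWeightedEnergy s E Q

/-- `Q`, of which only the values on `E` matter, is an external field on the set `E`, which lies
in the hyperplane `x₁ = 0`: lower semicontinuous with values in `[0, ∞]`, and finite on a set of
positive surface area, that is, of positive `(d - 1)`-dimensional Hausdorff measure. -/
structure IsExternalField {d : ℕ} (E : Set (EuclideanSpace ℝ (Fin d)))
    (Q : EuclideanSpace ℝ (Fin d) → ℝ≥0∞) : Prop where
  lowerSemicontinuousOn : LowerSemicontinuousOn Q E
  finite_pos : 0 < Measure.hausdorffMeasure ((d : ℝ) - 1) {x ∈ E | Q x < ∞}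

/-! ### Strict positive definiteness of the Riesz kernel -/

section PositiveDefinite

open ProbabilityTheory Set

variable {n : ℕ}

/-! The disk is an isometric copy of the closed unit ball of ℝⁿ with n = d - 1, and there n - 2 < s
< n. The proof takes place in that ball, and both bounds on s matter.

Existence is weak compactness plus lower semicontinuity (`exists_isExtremalMeasure`). Uniqueness is
strict positive definiteness (`eq_of_add_rieszEnergy_le`): the kernel is a positive mixture of
Gaussians, and the Gaussian energy of μ - ν is an average of the squared modulus of its Fourier
transform. Uniqueness makes the extremal measure μ rotation invariant, so its potential U depends on
the radius alone.

Put F = I(μ) + ∫ Q dμ, with I the Riesz energy. The first variation gives U + Q ≤ F on the support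
(`IsExtremalMeasure.potential_le_of_mem_support`). Since s < n, Lebesgue measure on a shell has
finite energy, so U + Q < F cannot hold throughout a shell
(`IsExtremalMeasure.not_forall_shell_lt`). Each claim about the support is proved by exhibiting such
a forbidden shell.

Gaps: since s > n - 2, the kernel is subharmonic off the diagonal. The radial Laplacian
(`axisPotential_laplacian`), integrated from the origin for the mass outside the gap and combined
with the sign of U' for the mass inside, makes U strictly convex in the radius across a gap
(`strictConvexOn_axisPotential`). With Q convex and U + Q ≤ F at both ends, U + Q < F within the
gap. Hence the radii of the support form an interval [a, b].

Monotone fields: if Q increases and a > 0, then U is smaller at radii in (0, a) than at a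
(`rieszPotential_lt_of_outer`); if Q decreases and b < 1, then U is smaller beyond b
(`rieszPotential_lt_of_inner`).

Degeneracy a = b: an atom at the origin has infinite energy. On a sphere of radius a > 0, U has a
cusp: at distance δ it drops by at least a multiple of δ^(n-1-s), up to a linear error, and n - 1 -
s < 1. This beats the at most linear growth of Q towards another radius where Q is finite
(`eventually_axisPotential_lt`). Such a radius exists because one sphere has zero area
(`IsExternalField.exists_radii`). -/

lemma isOpenPosMeasure_stdGaussian :
    (stdGaussian (EuclideanSpace ℝ (Fin n))).IsOpenPosMeasure := by
  have h1 : (gaussianReal 0 1).IsOpenPosMeasure :=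
    (gaussianReal_absolutelyContinuous' 0 one_ne_zero).isOpenPosMeasure
  have h2 : (Measure.pi (fun _ : Fin n ↦ gaussianReal 0 1)).IsOpenPosMeasure :=
    Measure.pi.isOpenPosMeasure _
  rw [← map_pi_eq_stdGaussian]
  exact (PiLp.continuous_toLp 2 (fun _ : Fin n ↦ ℝ)).isOpenPosMeasure_map
    (WithLp.toLp_surjective 2)

/-- The mutual energy of two measures with respect to the kernel `exp (-t |x - y|²)`. -/
noncomputable def gaussianEnergy (t : ℝ) (μ ν : Measure (EuclideanSpace ℝ (Fin n))) : ℝ :=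
  ∫ p, Real.exp (-(t * ‖p.1 - p.2‖ ^ 2)) ∂(μ.prod ν)

/-- A Gaussian is the characteristic function of a Gaussian: that of the standard one at v is
exp(-|v|²/2), which forces the scale √(2t). Fubini then gives a Parseval formula. -/
lemma gaussianEnergy_eq_integral_charFun {t : ℝ} (ht : 0 ≤ t)
    (μ ν : Measure (EuclideanSpace ℝ (Fin n))) [IsFiniteMeasure μ] [IsFiniteMeasure ν] :
    (gaussianEnergy t μ ν : ℂ) = ∫ ξ, charFun μ (√(2 * t) • ξ) *
      (starRingEnd ℂ) (charFun ν (√(2 * t) • ξ)) ∂(stdGaussian (EuclideanSpace ℝ (Fin n))) := by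
  set a := √(2 * t) with ha
  have h1 : ∀ ξ : EuclideanSpace ℝ (Fin n), charFun μ (a • ξ) *
      (starRingEnd ℂ) (charFun ν (a • ξ)) =
      ∫ p, Complex.exp ((inner ℝ (p.1 - p.2) (a • ξ) : ℝ) * Complex.I) ∂(μ.prod ν) := by
    intro ξ
    rw [← charFun_neg, charFun_apply, charFun_apply, ← integral_prod_mul]
    congr 1 with p
    rw [← Complex.exp_add]
    congr 1
    rw [inner_sub_left, inner_neg_right]
    push_cast
    ring
  simp_rw [h1]
  rw [integral_integral_swap]
  · rw [gaussianEnergy, ← integral_complex_ofReal]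
    congr 1 with p
    have : ∫ ξ, Complex.exp ((inner ℝ (p.1 - p.2) (a • ξ) : ℝ) * Complex.I)
        ∂(stdGaussian (EuclideanSpace ℝ (Fin n))) =
        charFun (stdGaussian (EuclideanSpace ℝ (Fin n))) (a • (p.1 - p.2)) := by
      rw [charFun_apply]
      congr 1 with ξ
      rw [inner_smul_right, inner_smul_right, real_inner_comm]
    have hsq : ‖a • (p.1 - p.2)‖ ^ 2 = 2 * t * ‖p.1 - p.2‖ ^ 2 := by
      rw [norm_smul, Real.norm_eq_abs, mul_pow, sq_abs, ha, Real.sq_sqrt (by positivity)]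
    rw [this, charFun_stdGaussian, ← Complex.ofReal_pow, hsq]
    push_cast
    congr 1
    ring
  · apply Integrable.of_bound (C := 1)
    · apply Continuous.aestronglyMeasurable
      unfold Function.uncurry
      fun_prop
    · filter_upwards with z
      simp only [Function.uncurry]
      rw [Complex.norm_exp_ofReal_mul_I]

/-- The energy of the signed measure μ - ν, expanded so that only positive measures occur. -/
lemma gaussianEnergy_sub {t : ℝ} (ht : 0 ≤ t)
    (μ ν : Measure (EuclideanSpace ℝ (Fin n))) [IsFiniteMeasure μ] [IsFiniteMeasure ν] :
    gaussianEnergy t μ μ + gaussianEnergy t ν ν - (gaussianEnergy t μ ν + gaussianEnergy t ν μ) =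
      ∫ ξ, ‖charFun μ (√(2 * t) • ξ) - charFun ν (√(2 * t) • ξ)‖ ^ 2
        ∂(stdGaussian (EuclideanSpace ℝ (Fin n))) := by
  have hint : ∀ (μ ν : Measure (EuclideanSpace ℝ (Fin n))) [IsFiniteMeasure μ] [IsFiniteMeasure ν],
      Integrable (fun ξ ↦ charFun μ (√(2 * t) • ξ) *
      (starRingEnd ℂ) (charFun ν (√(2 * t) • ξ))) (stdGaussian (EuclideanSpace ℝ (Fin n))) := by
    intro μ ν _ _
    have hμ : Continuous (charFun μ) := continuous_charFun
    have hν : Continuous (charFun ν) := continuous_charFun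
    apply Integrable.of_bound (C := μ.real univ * ν.real univ)
    · apply Continuous.aestronglyMeasurable
      fun_prop
    · filter_upwards with z
      rw [norm_mul, RCLike.norm_conj]
      gcongr <;> exact norm_charFun_le _
  apply Complex.ofReal_injective
  push_cast
  rw [← integral_complex_ofReal]
  simp_rw [gaussianEnergy_eq_integral_charFun ht]
  rw [← integral_add (hint _ _) (hint _ _), ← integral_add (hint _ _) (hint _ _),
    ← integral_sub (by exact (hint _ _).add (hint _ _)) (by exact (hint _ _).add (hint _ _))]
  congr 1 with ξ
  push_cast
  rw [← Complex.mul_conj']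
  simp only [map_sub]
  ring

lemma gaussianEnergy_comm (t : ℝ) (μ ν : Measure (EuclideanSpace ℝ (Fin n)))
    [IsFiniteMeasure μ] [IsFiniteMeasure ν] :
    gaussianEnergy t μ ν = gaussianEnergy t ν μ := by
  rw [gaussianEnergy, ← integral_prod_swap, gaussianEnergy]
  simp only [Prod.fst_swap, Prod.snd_swap, norm_sub_rev]

lemma two_mul_gaussianEnergy_le {t : ℝ} (ht : 0 ≤ t)
    (μ ν : Measure (EuclideanSpace ℝ (Fin n))) [IsFiniteMeasure μ] [IsFiniteMeasure ν] :
    2 * gaussianEnergy t μ ν ≤ gaussianEnergy t μ μ + gaussianEnergy t ν ν := by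
  have h := gaussianEnergy_sub ht μ ν
  have h2 : 0 ≤ ∫ ξ, ‖charFun μ (√(2 * t) • ξ) - charFun ν (√(2 * t) • ξ)‖ ^ 2
        ∂(stdGaussian (EuclideanSpace ℝ (Fin n))) := by positivity
  rw [gaussianEnergy_comm t ν μ] at h
  linarith

/-- The averaged square vanishes; being continuous, it vanishes everywhere because the Gaussian
charges every open set. Characteristic functions determine finite measures. -/
lemma eq_of_two_mul_gaussianEnergy_eq {t : ℝ} (ht : 0 < t)
    {μ ν : Measure (EuclideanSpace ℝ (Fin n))} [IsFiniteMeasure μ] [IsFiniteMeasure ν]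
    (h : 2 * gaussianEnergy t μ ν = gaussianEnergy t μ μ + gaussianEnergy t ν ν) : μ = ν := by
  have h1 := gaussianEnergy_sub ht.le μ ν
  rw [gaussianEnergy_comm t ν μ, ← h] at h1
  have := isOpenPosMeasure_stdGaussian (n := n)
  have hμ : Continuous (charFun μ) := continuous_charFun
  have hν : Continuous (charFun ν) := continuous_charFun
  have hc : Continuous fun ξ ↦ ‖charFun μ (√(2 * t) • ξ) - charFun ν (√(2 * t) • ξ)‖ ^ 2 := by
    fun_prop
  have h2 : (fun ξ ↦ ‖charFun μ (√(2 * t) • ξ) - charFun ν (√(2 * t) • ξ)‖ ^ 2) = fun _ ↦ 0 := by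
    rw [← Continuous.ae_eq_iff_eq (stdGaussian (EuclideanSpace ℝ (Fin n))) hc continuous_const]
    refine (integral_eq_zero_iff_of_nonneg (fun _ ↦ by positivity) ?_).1 (by linarith)
    apply Integrable.of_bound hc.aestronglyMeasurable (C := (μ.real univ + ν.real univ) ^ 2)
    filter_upwards with ξ
    rw [Real.norm_of_nonneg (by positivity)]
    gcongr
    exact (norm_sub_le _ _).trans (add_le_add (norm_charFun_le _) (norm_charFun_le _))
  apply Measure.ext_of_charFun
  ext ξ
  have h3 := congrFun h2 ((√(2 * t))⁻¹ • ξ)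
  have ht' : √(2 * t) ≠ 0 := by positivity
  simp only [smul_smul, mul_inv_cancel₀ ht', one_smul, ne_eq, OfNat.ofNat_ne_zero,
    not_false_eq_true, pow_eq_zero_iff, norm_eq_zero] at h3
  exact sub_eq_zero.1 h3

/-- This is the Gamma integral after rescaling t. On the diagonal the Gaussian factor is 1 and a
power of t is never integrable on (0, ∞), which matches the value ∞ of the kernel. -/
lemma gamma_mul_edist_rpow {s : ℝ} (hs : 0 < s) (x y : EuclideanSpace ℝ (Fin n)) :
    ENNReal.ofReal (Real.Gamma (s / 2)) * edist x y ^ (-s) =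
      ∫⁻ t in Ioi (0 : ℝ), ENNReal.ofReal (t ^ (s / 2 - 1)) *
        ENNReal.ofReal (Real.exp (-(t * ‖x - y‖ ^ 2))) := by
  have hmul : ∀ t ∈ Ioi (0 : ℝ), ENNReal.ofReal (t ^ (s / 2 - 1)) *
        ENNReal.ofReal (Real.exp (-(t * ‖x - y‖ ^ 2))) =
        ENNReal.ofReal (t ^ (s / 2 - 1) * Real.exp (-(‖x - y‖ ^ 2 * t))) := by
    intro t ht
    rw [← ENNReal.ofReal_mul (Real.rpow_nonneg (le_of_lt ht) _), mul_comm t]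
  rw [setLIntegral_congr_fun measurableSet_Ioi hmul]
  have hG : 0 < Real.Gamma (s / 2) := Real.Gamma_pos_of_pos (by positivity)
  rcases eq_or_ne x y with rfl | hxy
  · have h1 : ENNReal.ofReal (Real.Gamma (s / 2)) ≠ 0 := by simpa using hG
    rw [edist_self, ENNReal.zero_rpow_of_neg (by linarith), ENNReal.mul_top h1]
    symm
    by_contra hne
    apply not_integrableOn_Ioi_rpow (s / 2 - 1)
    refine ⟨by fun_prop, ?_⟩
    rw [hasFiniteIntegral_iff_ofReal]
    · simpa using lt_top_iff_ne_top.2 hne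
    · exact (ae_restrict_mem measurableSet_Ioi).mono fun t ht ↦ Real.rpow_nonneg (le_of_lt ht) _
  · have hr : 0 < ‖x - y‖ := norm_pos_iff.2 (sub_ne_zero.2 hxy)
    have hI := Real.integral_rpow_mul_exp_neg_mul_Ioi (a := s / 2) (r := ‖x - y‖ ^ 2)
      (by positivity) (by positivity)
    rw [← ofReal_integral_eq_lintegral_ofReal, hI, edist_dist, dist_eq_norm,
      ENNReal.ofReal_rpow_of_pos hr, ← ENNReal.ofReal_mul hG.le, mul_comm]
    · congr 2
      rw [one_div, Real.inv_rpow (by positivity), ← Real.rpow_natCast, ← Real.rpow_mul hr.le,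
        Real.rpow_neg hr.le]
      congr 2
      push_cast
      ring
    · apply not_imp_comm.1 integral_undef
      rw [hI]
      positivity
    · exact (ae_restrict_mem measurableSet_Ioi).mono fun t ht ↦
        mul_nonneg (Real.rpow_nonneg (le_of_lt ht) _) (Real.exp_pos _).le

lemma lintegral_gaussian_eq (t : ℝ) (ht : 0 ≤ t) (μ ν : Measure (EuclideanSpace ℝ (Fin n)))
    [IsFiniteMeasure μ] [IsFiniteMeasure ν] :
    ∫⁻ p, ENNReal.ofReal (Real.exp (-(t * ‖p.1 - p.2‖ ^ 2))) ∂(μ.prod ν) =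
      ENNReal.ofReal (gaussianEnergy t μ ν) := by
  rw [gaussianEnergy, ofReal_integral_eq_lintegral_ofReal]
  · apply Integrable.of_bound (C := 1)
    · apply Continuous.aestronglyMeasurable
      fun_prop
    · filter_upwards with p
      rw [Real.norm_of_nonneg (Real.exp_pos _).le, Real.exp_le_one_iff]
      have := mul_nonneg ht (sq_nonneg ‖p.1 - p.2‖)
      linarith
  · filter_upwards with p
    exact (Real.exp_pos _).le

/-- The mutual Riesz energy of two measures. -/
noncomputable def mutualEnergy (s : ℝ) (μ ν : Measure (EuclideanSpace ℝ (Fin n))) : ℝ≥0∞ :=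
  ∫⁻ x, rieszPotential s ν x ∂μ

lemma mutualEnergy_self (s : ℝ) (μ : Measure (EuclideanSpace ℝ (Fin n))) :
    mutualEnergy s μ μ = rieszEnergy s μ := rfl

lemma measurable_rieszKernel (s : ℝ) :
    Measurable fun p : EuclideanSpace ℝ (Fin n) × EuclideanSpace ℝ (Fin n) ↦
      edist p.1 p.2 ^ (-s) := by
  fun_prop

lemma measurable_rieszPotential (s : ℝ) (μ : Measure (EuclideanSpace ℝ (Fin n))) [SFinite μ] :
    Measurable (rieszPotential s μ) :=
  (measurable_rieszKernel s).lintegral_prod_right'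

lemma mutualEnergy_eq_lintegral_prod (s : ℝ) (μ ν : Measure (EuclideanSpace ℝ (Fin n)))
    [SFinite ν] : mutualEnergy s μ ν = ∫⁻ p, edist p.1 p.2 ^ (-s) ∂(μ.prod ν) := by
  rw [lintegral_prod _ (measurable_rieszKernel s).aemeasurable]
  rfl

lemma mutualEnergy_comm (s : ℝ) (μ ν : Measure (EuclideanSpace ℝ (Fin n)))
    [SFinite μ] [SFinite ν] : mutualEnergy s μ ν = mutualEnergy s ν μ := by
  unfold mutualEnergy rieszPotential
  rw [lintegral_lintegral_swap (measurable_rieszKernel s).aemeasurable]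
  simp_rw [edist_comm]

lemma gamma_mul_mutualEnergy {s : ℝ} (hs : 0 < s) (μ ν : Measure (EuclideanSpace ℝ (Fin n)))
    [IsFiniteMeasure μ] [IsFiniteMeasure ν] :
    ENNReal.ofReal (Real.Gamma (s / 2)) * mutualEnergy s μ ν =
      ∫⁻ t in Ioi (0 : ℝ), ENNReal.ofReal (t ^ (s / 2 - 1)) *
        ENNReal.ofReal (gaussianEnergy t μ ν) := by
  rw [mutualEnergy_eq_lintegral_prod, ← lintegral_const_mul _ (measurable_rieszKernel s)]
  simp_rw [gamma_mul_edist_rpow hs]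
  rw [lintegral_lintegral_swap]
  · refine setLIntegral_congr_fun measurableSet_Ioi fun t ht ↦ ?_
    rw [lintegral_const_mul _ (by fun_prop), lintegral_gaussian_eq t (le_of_lt ht)]
  · unfold Function.uncurry
    fun_prop

lemma measurable_gaussianEnergy (μ ν : Measure (EuclideanSpace ℝ (Fin n)))
    [IsFiniteMeasure μ] [IsFiniteMeasure ν] : Measurable fun t ↦ gaussianEnergy t μ ν := by
  refine StronglyMeasurable.measurable (StronglyMeasurable.integral_prod_right' (ν := μ.prod ν)
    (f := fun q : ℝ × (EuclideanSpace ℝ (Fin n) × EuclideanSpace ℝ (Fin n)) ↦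
    Real.exp (-(q.1 * ‖q.2.1 - q.2.2‖ ^ 2))) ?_)
  apply Continuous.stronglyMeasurable
  fun_prop

lemma gaussianEnergy_nonneg (t : ℝ) (μ ν : Measure (EuclideanSpace ℝ (Fin n))) :
    0 ≤ gaussianEnergy t μ ν :=
  integral_nonneg fun _ ↦ (Real.exp_pos _).le

lemma gamma_mul_add_mutualEnergy {s : ℝ} (hs : 0 < s) (μ ν : Measure (EuclideanSpace ℝ (Fin n)))
    [IsFiniteMeasure μ] [IsFiniteMeasure ν] :
    ENNReal.ofReal (Real.Gamma (s / 2)) * (rieszEnergy s μ + rieszEnergy s ν) =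
      ∫⁻ t in Ioi (0 : ℝ), ENNReal.ofReal (t ^ (s / 2 - 1)) *
        ENNReal.ofReal (gaussianEnergy t μ μ + gaussianEnergy t ν ν) := by
  have := measurable_gaussianEnergy μ μ
  rw [mul_add, ← mutualEnergy_self, ← mutualEnergy_self, gamma_mul_mutualEnergy hs,
    gamma_mul_mutualEnergy hs, ← lintegral_add_left (by fun_prop)]
  simp_rw [ENNReal.ofReal_add (gaussianEnergy_nonneg _ μ μ) (gaussianEnergy_nonneg _ ν ν), mul_add]

lemma gamma_mul_two_mul_mutualEnergy {s : ℝ} (hs : 0 < s)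
    (μ ν : Measure (EuclideanSpace ℝ (Fin n))) [IsFiniteMeasure μ] [IsFiniteMeasure ν] :
    ENNReal.ofReal (Real.Gamma (s / 2)) * (2 * mutualEnergy s μ ν) =
      ∫⁻ t in Ioi (0 : ℝ), ENNReal.ofReal (t ^ (s / 2 - 1)) *
        ENNReal.ofReal (2 * gaussianEnergy t μ ν) := by
  have := measurable_gaussianEnergy μ ν
  rw [mul_left_comm, gamma_mul_mutualEnergy hs, ← lintegral_const_mul _ (by fun_prop)]
  simp_rw [ENNReal.ofReal_mul zero_le_two, ENNReal.ofReal_ofNat, mul_left_comm]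

lemma gamma_half_ne_zero {s : ℝ} (hs : 0 < s) : ENNReal.ofReal (Real.Gamma (s / 2)) ≠ 0 := by
  simpa using Real.Gamma_pos_of_pos (half_pos hs)

theorem two_mul_mutualEnergy_le {s : ℝ} (hs : 0 < s)
    (μ ν : Measure (EuclideanSpace ℝ (Fin n))) [IsFiniteMeasure μ] [IsFiniteMeasure ν] :
    2 * mutualEnergy s μ ν ≤ rieszEnergy s μ + rieszEnergy s ν := by
  rw [← ENNReal.mul_le_mul_iff_right (gamma_half_ne_zero hs) ENNReal.ofReal_ne_top,
    gamma_mul_add_mutualEnergy hs, gamma_mul_two_mul_mutualEnergy hs]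
  refine setLIntegral_mono' measurableSet_Ioi fun t ht ↦ ?_
  gcongr
  exact two_mul_gaussianEnergy_le (le_of_lt ht) μ ν

/-- The Riesz energy is strictly positive definite. -/
theorem eq_of_add_rieszEnergy_le {s : ℝ} (hs : 0 < s)
    {μ ν : Measure (EuclideanSpace ℝ (Fin n))} [IsFiniteMeasure μ] [IsFiniteMeasure ν]
    (hfin : mutualEnergy s μ ν ≠ ∞)
    (h : rieszEnergy s μ + rieszEnergy s ν ≤ 2 * mutualEnergy s μ ν) : μ = ν := by
  have hμν := measurable_gaussianEnergy μ ν
  have hμ := measurable_gaussianEnergy μ μ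
  have hν := measurable_gaussianEnergy ν ν
  rw [← ENNReal.mul_le_mul_iff_right (gamma_half_ne_zero hs) ENNReal.ofReal_ne_top,
    gamma_mul_add_mutualEnergy hs, gamma_mul_two_mul_mutualEnergy hs] at h
  -- The Gaussian inequality holds for every t > 0, so equality of the finite integrals forces
  -- equality for almost every t. A single such t is enough.
  have hae := ae_eq_of_ae_le_of_lintegral_le ((ae_restrict_mem measurableSet_Ioi).mono
    fun t (ht : 0 < t) ↦ ?_) ?_ (by fun_prop) h
  · have : (ae (volume.restrict (Ioi (0 : ℝ)))).NeBot := by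
      rw [ae_neBot, ne_eq, Measure.restrict_eq_zero]
      simp
    obtain ⟨t, ht, ht0⟩ := (hae.and (ae_restrict_mem measurableSet_Ioi)).exists
    have ht0' : 0 < t := ht0
    refine eq_of_two_mul_gaussianEnergy_eq ht0' ?_
    have h0 : ENNReal.ofReal (t ^ (s / 2 - 1)) ≠ 0 := by
      simpa using Real.rpow_pos_of_pos ht0' _
    rw [ENNReal.mul_right_inj h0 ENNReal.ofReal_ne_top, ENNReal.ofReal_eq_ofReal_iff] at ht
    · exact ht
    · exact mul_nonneg zero_le_two (gaussianEnergy_nonneg _ _ _)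
    · exact add_nonneg (gaussianEnergy_nonneg _ _ _) (gaussianEnergy_nonneg _ _ _)
  · gcongr
    exact two_mul_gaussianEnergy_le ht.le μ ν
  · rw [← gamma_mul_two_mul_mutualEnergy hs]
    exact ENNReal.mul_ne_top ENNReal.ofReal_ne_top (ENNReal.mul_ne_top (by simp) hfin)

end PositiveDefinite

/-! ### Existence of an extremal measure -/

section Existence

open Set Filter Topology

lemma volume_Ioi_inter_ofReal_lt (c : ℝ≥0∞) :
    volume.restrict (Ioi (0 : ℝ)) {t | ENNReal.ofReal t < c} = c := by
  rw [Measure.restrict_apply' measurableSet_Ioi]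
  rcases eq_or_ne c ∞ with rfl | hc
  · simp
  · have : {t | ENNReal.ofReal t < c} ∩ Ioi 0 = Ioo 0 c.toReal := by
      ext t
      simp only [mem_inter_iff, mem_ofPred_eq, mem_Ioi, mem_Ioo]
      constructor
      · rintro ⟨h1, h2⟩
        exact ⟨h2, (ENNReal.ofReal_lt_iff_lt_toReal h2.le hc).1 h1⟩
      · rintro ⟨h1, h2⟩
        exact ⟨(ENNReal.ofReal_lt_iff_lt_toReal h1.le hc).2 h2, h1⟩
    rw [this, Real.volume_Ioo, sub_zero, ENNReal.ofReal_toReal hc]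

/-- Layer cake for functions that may take the value ∞. The strict inequality makes the superlevel
sets of a lower semicontinuous function open. -/
lemma lintegral_eq_lintegral_meas_ofReal_lt {X : Type*} [MeasurableSpace X] (μ : Measure X)
    [SFinite μ] {f : X → ℝ≥0∞} (hf : Measurable f) :
    ∫⁻ x, f x ∂μ = ∫⁻ t in Ioi (0 : ℝ), μ {x | ENNReal.ofReal t < f x} := by
  have hm : MeasurableSet {p : X × ℝ | ENNReal.ofReal p.2 < f p.1} :=
    measurableSet_lt (by fun_prop) (by fun_prop)
  calc ∫⁻ x, f x ∂μ
      = ∫⁻ x, volume.restrict (Ioi (0 : ℝ)) (Prod.mk x ⁻¹' {p : X × ℝ |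
          ENNReal.ofReal p.2 < f p.1}) ∂μ :=
        lintegral_congr fun x ↦ (volume_Ioi_inter_ofReal_lt (f x)).symm
    _ = ∫⁻ t in Ioi (0 : ℝ), μ {x | ENNReal.ofReal t < f x} := by
      rw [← Measure.prod_apply hm, Measure.prod_apply_symm hm]
      rfl

/-- The portmanteau inequality for the open superlevel sets, integrated over the level by Fatou's
lemma. -/
lemma LowerSemicontinuous.lintegral_le_liminf {X : Type*} [TopologicalSpace X]
    [MeasurableSpace X] [OpensMeasurableSpace X] [HasOuterApproxClosed X] {f : X → ℝ≥0∞}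
    (hf : LowerSemicontinuous f) {P : ProbabilityMeasure X} {Ps : ℕ → ProbabilityMeasure X}
    (h : Tendsto Ps atTop (𝓝 P)) :
    ∫⁻ x, f x ∂(P : Measure X) ≤ atTop.liminf fun k ↦ ∫⁻ x, f x ∂(Ps k : Measure X) := by
  simp_rw [lintegral_eq_lintegral_meas_ofReal_lt _ hf.measurable]
  refine (lintegral_mono fun t ↦ ?_).trans (lintegral_liminf_le fun k ↦ Antitone.measurable ?_)
  · exact ProbabilityMeasure.le_liminf_measure_open_of_tendsto h (hf.isOpen_preimage _)
  · exact fun a b hab ↦ measure_mono fun x hx ↦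
      (ENNReal.ofReal_le_ofReal hab).trans_lt hx

lemma ENNReal.liminf_add_le_liminf (u v : ℕ → ℝ≥0∞) :
    atTop.liminf u + atTop.liminf v ≤ atTop.liminf fun k ↦ u k + v k := by
  simp only [liminf_eq_iSup_iInf_of_nat]
  rw [ENNReal.iSup_add_iSup_of_monotone]
  · exact iSup_mono fun k ↦ le_iInf₂ fun i hi ↦ add_le_add (iInf₂_le i hi) (iInf₂_le i hi)
  · exact fun a b hab ↦ le_iInf₂ fun i hi ↦ iInf₂_le i (hab.trans hi)
  · exact fun a b hab ↦ le_iInf₂ fun i hi ↦ iInf₂_le i (hab.trans hi)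

variable {n : ℕ}

lemma rieszEnergy_map_val (s : ℝ) (E : Set (EuclideanSpace ℝ (Fin n))) (P : Measure E) [SFinite P] :
    rieszEnergy s (P.map Subtype.val) = ∫⁻ p, edist p.1 p.2 ^ (-s) ∂(P.prod P) := by
  rw [← mutualEnergy_self, mutualEnergy_eq_lintegral_prod, Measure.map_prod_map _ _
    measurable_subtype_coe measurable_subtype_coe, lintegral_map (measurable_rieszKernel s)
    (by fun_prop)]
  rfl

lemma map_val_mem_unitMeasures {E : Set (EuclideanSpace ℝ (Fin n))} (hE : MeasurableSet E)
    (P : ProbabilityMeasure E) : (P : Measure E).map Subtype.val ∈ unitMeasures E := by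
  refine ⟨Measure.isProbabilityMeasure_map (by fun_prop), ?_⟩
  rw [Measure.map_apply measurable_subtype_coe hE.compl]
  simp

lemma exists_map_val_eq {E : Set (EuclideanSpace ℝ (Fin n))} (hE : MeasurableSet E)
    {μ : Measure (EuclideanSpace ℝ (Fin n))} (hμ : μ ∈ unitMeasures E) :
    ∃ P : ProbabilityMeasure E, (P : Measure E).map Subtype.val = μ := by
  have h1 : (μ.comap (Subtype.val : E → _)).map Subtype.val = μ := by
    rw [map_comap_subtype_coe hE, Measure.restrict_eq_self_of_ae_mem]
    exact hμ.2
  have := hμ.1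
  refine ⟨⟨μ.comap Subtype.val, ⟨?_⟩⟩, h1⟩
  rw [comap_subtype_coe_apply hE]
  simpa using (prob_compl_eq_zero_iff hE).1 hμ.2

/-- Direct method on the weakly compact space of probability measures on `E`. The double integral
passes to the limit because P ↦ P × P is weakly continuous and the kernel is continuous into [0, ∞].
-/
lemma exists_isExtremalMeasure (s : ℝ) {E : Set (EuclideanSpace ℝ (Fin n))} (hE : IsCompact E)
    (hne : E.Nonempty) {Q : EuclideanSpace ℝ (Fin n) → ℝ≥0∞} (hQ : LowerSemicontinuous Q) :
    ∃ μ, IsExtremalMeasure s E Q μ := by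
  have hEm := hE.measurableSet
  have : CompactSpace E := isCompact_iff_compactSpace.1 hE
  have : Nonempty (ProbabilityMeasure E) := ⟨diracProba ⟨hne.some, hne.some_mem⟩⟩
  let Φ : ProbabilityMeasure E → ℝ≥0∞ := fun P ↦
    ∫⁻ p, edist p.1 p.2 ^ (-s) ∂((P.prod P : ProbabilityMeasure (E × E)) : Measure (E × E)) +
      2 * ∫⁻ x, Q x ∂(P : Measure E)
  have hΦ : ∀ P : ProbabilityMeasure E, weightedEnergy s Q ((P : Measure E).map Subtype.val) = Φ P := by
    intro P
    rw [weightedEnergy, rieszEnergy_map_val, lintegral_map hQ.measurable measurable_subtype_coe]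
    rfl
  have hinf : minWeightedEnergy s E Q = ⨅ P, Φ P := by
    apply le_antisymm
    · refine le_iInf fun P ↦ ?_
      rw [← hΦ]
      exact iInf₂_le _ (map_val_mem_unitMeasures hEm P)
    · refine le_iInf₂ fun μ hμ ↦ ?_
      obtain ⟨P, rfl⟩ := exists_map_val_eq hEm hμ
      rw [hΦ]
      exact iInf_le _ P
  obtain ⟨u, -, hu, hmem⟩ := exists_seq_tendsto_sInf (range_nonempty Φ) (OrderBot.bddBelow _)
  choose Ps hPs using hmem
  obtain ⟨P, -, φ, hφ, hlim⟩ := isCompact_univ.tendsto_subseq (x := Ps) fun _ ↦ mem_univ _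
  refine ⟨(P : Measure E).map Subtype.val, map_val_mem_unitMeasures hEm P, ?_⟩
  rw [hΦ, hinf]
  refine le_antisymm ?_ (iInf_le _ P)
  have hker : LowerSemicontinuous fun p : E × E ↦ edist p.1 p.2 ^ (-s) := by
    apply Continuous.lowerSemicontinuous
    exact ENNReal.continuous_rpow_const.comp continuous_edist
  have h1 := hker.lintegral_le_liminf
    ((ProbabilityMeasure.continuous_prod.tendsto (P, P)).comp (hlim.prodMk_nhds hlim))
  have h2 := (LowerSemicontinuous.comp hQ continuous_subtype_val (f := Q)).lintegral_le_liminf hlim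
  have h3 : Tendsto (fun k ↦ Φ (Ps (φ k))) atTop (𝓝 (⨅ P, Φ P)) := by
    simp only [hPs]
    exact hu.comp hφ.tendsto_atTop
  rw [← h3.liminf_eq]
  have h2' : 2 * ∫⁻ x, Q x ∂(P : Measure E) ≤
      atTop.liminf fun k ↦ 2 * ∫⁻ x, Q x ∂(Ps (φ k) : Measure E) := by
    rw [ENNReal.liminf_const_mul_of_ne_top (by simp)]
    gcongr
    exact h2
  exact (add_le_add h1 h2').trans (ENNReal.liminf_add_le_liminf _ _)

end Existence

/-! ### Uniqueness and the first variation -/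

section Variational

variable {n : ℕ}

lemma mutualEnergy_add_right (s : ℝ) (μ ν ρ : Measure (EuclideanSpace ℝ (Fin n)))
    [SFinite ν] : mutualEnergy s μ (ν + ρ) = mutualEnergy s μ ν + mutualEnergy s μ ρ := by
  simp only [mutualEnergy, rieszPotential, lintegral_add_measure]
  exact lintegral_add_left (measurable_rieszPotential s ν) _

lemma mutualEnergy_add_left (s : ℝ) (μ ν ρ : Measure (EuclideanSpace ℝ (Fin n))) :
    mutualEnergy s (μ + ν) ρ = mutualEnergy s μ ρ + mutualEnergy s ν ρ :=
  lintegral_add_measure _ _ _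

lemma mutualEnergy_smul_left (s : ℝ) (c : ℝ≥0∞) (μ ν : Measure (EuclideanSpace ℝ (Fin n))) :
    mutualEnergy s (c • μ) ν = c * mutualEnergy s μ ν :=
  lintegral_smul_measure _ _

lemma mutualEnergy_smul_right (s : ℝ) (c : ℝ≥0∞) (μ ν : Measure (EuclideanSpace ℝ (Fin n)))
    [SFinite ν] : mutualEnergy s μ (c • ν) = c * mutualEnergy s μ ν := by
  simp only [mutualEnergy, rieszPotential, lintegral_smul_measure, smul_eq_mul]
  exact lintegral_const_mul _ (measurable_rieszPotential s ν)

lemma weightedEnergy_combo (s : ℝ) (Q : EuclideanSpace ℝ (Fin n) → ℝ≥0∞) (a b : ℝ≥0∞)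
    (μ ν : Measure (EuclideanSpace ℝ (Fin n))) [SFinite μ] [SFinite ν] :
    weightedEnergy s Q (a • μ + b • ν) = a ^ 2 * rieszEnergy s μ +
      2 * a * b * mutualEnergy s μ ν + b ^ 2 * rieszEnergy s ν +
      2 * (a * ∫⁻ x, Q x ∂μ + b * ∫⁻ x, Q x ∂ν) := by
  rw [weightedEnergy, ← mutualEnergy_self, mutualEnergy_add_right, mutualEnergy_smul_right,
    mutualEnergy_smul_right, mutualEnergy_add_left, mutualEnergy_add_left, mutualEnergy_smul_left,
    mutualEnergy_smul_left, mutualEnergy_smul_left, mutualEnergy_smul_left,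
    lintegral_add_measure, lintegral_smul_measure, lintegral_smul_measure,
    mutualEnergy_comm s ν μ, mutualEnergy_self, mutualEnergy_self]
  simp only [smul_eq_mul]
  ring

lemma combo_mem_unitMeasures {E : Set (EuclideanSpace ℝ (Fin n))}
    {μ ν : Measure (EuclideanSpace ℝ (Fin n))} (hμ : μ ∈ unitMeasures E) (hν : ν ∈ unitMeasures E)
    {a b : ℝ≥0∞} (hab : a + b = 1) : a • μ + b • ν ∈ unitMeasures E := by
  have := hμ.1
  have := hν.1
  refine ⟨⟨by simp [hab]⟩, by simp [hμ.2, hν.2]⟩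

lemma IsExtremalMeasure.weightedEnergy_le {s : ℝ} {E : Set (EuclideanSpace ℝ (Fin n))}
    {Q : EuclideanSpace ℝ (Fin n) → ℝ≥0∞} {μ ν : Measure (EuclideanSpace ℝ (Fin n))}
    (hμ : IsExtremalMeasure s E Q μ) (hν : ν ∈ unitMeasures E) :
    weightedEnergy s Q μ ≤ weightedEnergy s Q ν := by
  rw [hμ.2]
  exact iInf₂_le _ hν

lemma IsExtremalMeasure.energies_ne_top {s : ℝ} {E : Set (EuclideanSpace ℝ (Fin n))}
    {Q : EuclideanSpace ℝ (Fin n) → ℝ≥0∞} {μ : Measure (EuclideanSpace ℝ (Fin n))}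
    (hμ : IsExtremalMeasure s E Q μ) (hfin : minWeightedEnergy s E Q ≠ ∞) :
    rieszEnergy s μ ≠ ∞ ∧ ∫⁻ x, Q x ∂μ ≠ ∞ := by
  rw [← hμ.2, weightedEnergy, ENNReal.add_ne_top] at hfin
  exact ⟨hfin.1, fun h ↦ hfin.2 (by simp [h])⟩

lemma mutualEnergy_ne_top {s : ℝ} (hs : 0 < s) {μ ν : Measure (EuclideanSpace ℝ (Fin n))}
    [IsFiniteMeasure μ] [IsFiniteMeasure ν] (hμ : rieszEnergy s μ ≠ ∞)
    (hν : rieszEnergy s ν ≠ ∞) : mutualEnergy s μ ν ≠ ∞ := by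
  intro h
  have := two_mul_mutualEnergy_le hs μ ν
  rw [h, ENNReal.mul_top (by simp), top_le_iff, ENNReal.add_eq_top] at this
  tauto

/-- Testing minimality against the midpoint (μ + ν)/2 cancels the field terms and leaves I(μ) + I(ν)
≤ 2 I(μ, ν), the reverse of positive definiteness. -/
theorem IsExtremalMeasure.unique {s : ℝ} (hs : 0 < s) {E : Set (EuclideanSpace ℝ (Fin n))}
    {Q : EuclideanSpace ℝ (Fin n) → ℝ≥0∞} {μ ν : Measure (EuclideanSpace ℝ (Fin n))}
    (hfin : minWeightedEnergy s E Q ≠ ∞) (hμ : IsExtremalMeasure s E Q μ)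
    (hν : IsExtremalMeasure s E Q ν) : μ = ν := by
  have := hμ.1.1
  have := hν.1.1
  obtain ⟨hμ1, hμ2⟩ := hμ.energies_ne_top hfin
  obtain ⟨hν1, hν2⟩ := hν.energies_ne_top hfin
  have hc := mutualEnergy_ne_top hs hμ1 hν1
  refine eq_of_add_rieszEnergy_le hs hc ?_
  have h1 := hμ.weightedEnergy_le (combo_mem_unitMeasures hμ.1 hν.1 ENNReal.inv_two_add_inv_two)
  have h2 := hν.weightedEnergy_le hμ.1
  rw [weightedEnergy_combo] at h1
  have h3 := hμ.weightedEnergy_le hν.1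
  unfold weightedEnergy at h1 h2 h3
  lift rieszEnergy s μ to ℝ≥0 using hμ1 with a
  lift rieszEnergy s ν to ℝ≥0 using hν1 with b
  lift mutualEnergy s μ ν to ℝ≥0 using hc with c
  lift ∫⁻ x, Q x ∂μ to ℝ≥0 using hμ2 with A
  lift ∫⁻ x, Q x ∂ν to ℝ≥0 using hν2 with B
  have h2inv : (2 : ℝ≥0∞)⁻¹ = ((2⁻¹ : ℝ≥0) : ℝ≥0∞) := by simp
  rw [h2inv] at h1
  norm_cast at h1 h2 h3 ⊢
  rw [← NNReal.coe_le_coe] at h1 h2 h3 ⊢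
  push_cast at h1 h2 h3 ⊢
  linarith

/-- The derivative at ε = 0 of the energy of (1 - ε)μ + εν is nonnegative. -/
lemma IsExtremalMeasure.le_mutualEnergy_add {s : ℝ} (hs : 0 < s)
    {E : Set (EuclideanSpace ℝ (Fin n))} {Q : EuclideanSpace ℝ (Fin n) → ℝ≥0∞}
    {μ ν : Measure (EuclideanSpace ℝ (Fin n))} (hfin : minWeightedEnergy s E Q ≠ ∞)
    (hμ : IsExtremalMeasure s E Q μ) (hν : ν ∈ unitMeasures E) (hν1 : rieszEnergy s ν ≠ ∞) :
    rieszEnergy s μ + ∫⁻ x, Q x ∂μ ≤ mutualEnergy s μ ν + ∫⁻ x, Q x ∂ν := by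
  by_cases hν2 : ∫⁻ x, Q x ∂ν = ∞
  · simp [hν2]
  have := hμ.1.1
  have := hν.1
  obtain ⟨hμ1, hμ2⟩ := hμ.energies_ne_top hfin
  have hc := mutualEnergy_ne_top hs hμ1 hν1
  have h1 : ∀ ε : ℝ≥0, ε ≤ 1 → _ := fun ε hε ↦
    hμ.weightedEnergy_le (combo_mem_unitMeasures hμ.1 hν
      (a := ((1 - ε : ℝ≥0) : ℝ≥0∞)) (b := ((ε : ℝ≥0) : ℝ≥0∞))
      (by norm_cast; exact tsub_add_cancel_of_le hε))
  simp only [weightedEnergy_combo] at h1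
  unfold weightedEnergy at h1
  lift rieszEnergy s μ to ℝ≥0 using hμ1 with a
  lift rieszEnergy s ν to ℝ≥0 using hν1 with b
  lift mutualEnergy s μ ν to ℝ≥0 using hc with c
  lift ∫⁻ x, Q x ∂μ to ℝ≥0 using hμ2 with A
  lift ∫⁻ x, Q x ∂ν to ℝ≥0 using hν2 with B
  norm_cast at h1 ⊢
  rw [← NNReal.coe_le_coe]
  by_contra! hlt
  push_cast at hlt
  -- Minimality along the segment reads 2D ≤ εM, with `D` the supposed first-order gain and `M` the
  -- second-order coefficient. The chosen ε ≤ 1 is small enough that εM ≤ D, which is absurd for D >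
  -- 0.
  set D : ℝ := a + A - (c + B) with hD
  have hD0 : 0 < D := by simp only [hD]; linarith
  set M : ℝ := a + b - 2 * c with hM
  have hden : 0 < D + |M| + 1 := by positivity
  have hε1 : D / (D + |M| + 1) ≤ 1 := by
    rw [div_le_one hden]
    linarith [abs_nonneg M]
  obtain ⟨ε, hε⟩ : ∃ ε : ℝ≥0, (ε : ℝ) = D / (D + |M| + 1) := ⟨⟨_, by positivity⟩, rfl⟩
  have hε1' : ε ≤ 1 := by
    rw [← NNReal.coe_le_coe, hε]
    exact hε1
  have h2 := h1 ε hε1'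
  rw [← NNReal.coe_le_coe] at h2
  push_cast [NNReal.coe_sub hε1'] at h2
  have hε0 : (0 : ℝ) < ε := by rw [hε]; positivity
  have h3 : (ε : ℝ) * (2 * D) ≤ ε * (ε * M) := by
    simp only [hD, hM]
    linarith
  have h4 := le_of_mul_le_mul_left h3 hε0
  have h5 : ε * M ≤ D := by
    rw [hε, div_mul_eq_mul_div, div_le_iff₀ hden]
    gcongr
    linarith [le_abs_self M]
  linarith

end Variational

/-! ### Potentials, equilibrium conditions and rotation invariance -/

section Potential

open Set Filter Topology Metric

variable {n : ℕ}

/-- Fatou's lemma along sequences, the kernel being continuous into [0, ∞]. -/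
lemma lowerSemicontinuous_rieszPotential (s : ℝ) (μ : Measure (EuclideanSpace ℝ (Fin n))) :
    LowerSemicontinuous (rieszPotential s μ) := by
  rw [lowerSemicontinuous_iff_isClosed_preimage]
  intro c
  apply IsSeqClosed.isClosed
  intro u x hu hx
  have h1 : ∀ y, edist x y ^ (-s) = atTop.liminf fun k ↦ edist (u k) y ^ (-s) := by
    intro y
    exact ((ENNReal.continuous_rpow_const.tendsto _).comp
      (hx.edist tendsto_const_nhds)).liminf_eq.symm
  have h2 : rieszPotential s μ x ≤ atTop.liminf fun k ↦ rieszPotential s μ (u k) := by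
    unfold rieszPotential
    simp_rw [h1]
    exact lintegral_liminf_le fun k ↦ by fun_prop
  refine h2.trans ?_
  refine (liminf_le_liminf (Eventually.of_forall hu)).trans ?_
  simp

lemma rieszPotential_mono {s : ℝ} {μ ν : Measure (EuclideanSpace ℝ (Fin n))} (h : μ ≤ ν)
    (x : EuclideanSpace ℝ (Fin n)) : rieszPotential s μ x ≤ rieszPotential s ν x :=
  lintegral_mono' h le_rfl

lemma rieszEnergy_mono {s : ℝ} {μ ν : Measure (EuclideanSpace ℝ (Fin n))} (h : μ ≤ ν) :
    rieszEnergy s μ ≤ rieszEnergy s ν :=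
  lintegral_mono' h fun x ↦ rieszPotential_mono h x

lemma rieszEnergy_smul (s : ℝ) (c : ℝ≥0∞) (μ : Measure (EuclideanSpace ℝ (Fin n)))
    [SFinite μ] : rieszEnergy s (c • μ) = c * (c * rieszEnergy s μ) := by
  rw [← mutualEnergy_self, mutualEnergy_smul_left, mutualEnergy_smul_right, mutualEnergy_self]

/-- Otherwise ν, normalised, would be a competitor of finite energy whose average of U + Q lies
strictly below F, contrary to the first variation. -/
lemma IsExtremalMeasure.measure_eq_zero_of_lt {s : ℝ} (hs : 0 < s)
    {E : Set (EuclideanSpace ℝ (Fin n))} {Q : EuclideanSpace ℝ (Fin n) → ℝ≥0∞}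
    {μ ν : Measure (EuclideanSpace ℝ (Fin n))} [IsFiniteMeasure ν]
    (hfin : minWeightedEnergy s E Q ≠ ∞) (hμ : IsExtremalMeasure s E Q μ)
    (hνE : ν Eᶜ = 0) (hν1 : rieszEnergy s ν ≠ ∞)
    (hlt : ∀ᵐ x ∂ν, rieszPotential s μ x + Q x < rieszEnergy s μ + ∫⁻ x, Q x ∂μ) : ν = 0 := by
  by_contra h0
  have := hμ.1.1
  have huniv : ν univ ≠ 0 := by simpa using h0
  have hinv : (ν univ)⁻¹ ≠ ∞ := by simpa using h0
  set ρ := (ν univ)⁻¹ • ν with hρ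
  have hρm : ρ ∈ unitMeasures E :=
    ⟨⟨by simp [hρ, ENNReal.inv_mul_cancel huniv (measure_ne_top ν univ)]⟩, by simp [hρ, hνE]⟩
  have := hρm.1
  have hρ1 : rieszEnergy s ρ ≠ ∞ := by
    rw [hρ, rieszEnergy_smul]
    exact ENNReal.mul_ne_top hinv (ENNReal.mul_ne_top hinv hν1)
  have h1 := hμ.le_mutualEnergy_add hs hfin hρm hρ1
  rw [mutualEnergy_comm, mutualEnergy,
    ← lintegral_add_left (measurable_rieszPotential s μ)] at h1
  have hlt' : ∀ᵐ x ∂ρ, rieszPotential s μ x + Q x < rieszEnergy s μ + ∫⁻ x, Q x ∂μ :=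
    (Measure.smul_absolutelyContinuous (c := (ν univ)⁻¹)).ae_le hlt
  obtain ⟨hμ1, hμ2⟩ := hμ.energies_ne_top hfin
  have h2 : ∫⁻ x, rieszPotential s μ x + Q x ∂ρ ≤ rieszEnergy s μ + ∫⁻ x, Q x ∂μ := by
    refine (lintegral_mono_ae (hlt'.mono fun x hx ↦ hx.le)).trans ?_
    simp
  have h3 := lintegral_strict_mono (IsProbabilityMeasure.ne_zero ρ) aemeasurable_const
    (ne_top_of_le_ne_top (ENNReal.add_ne_top.2 ⟨hμ1, hμ2⟩) h2) hlt'
  simp only [lintegral_const, measure_univ, mul_one] at h3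
  exact absurd h3 (not_lt.2 h1)

/-- The part of μ on {U + Q < F} has finite energy, being dominated by μ, so it vanishes. Then U + Q
≥ F almost everywhere, while the mean of U + Q is exactly F. -/
lemma IsExtremalMeasure.ae_potential_eq {s : ℝ} (hs : 0 < s)
    {E : Set (EuclideanSpace ℝ (Fin n))} {Q : EuclideanSpace ℝ (Fin n) → ℝ≥0∞}
    (hQ : Measurable Q) {μ : Measure (EuclideanSpace ℝ (Fin n))}
    (hfin : minWeightedEnergy s E Q ≠ ∞) (hμ : IsExtremalMeasure s E Q μ) :
    ∀ᵐ x ∂μ, rieszPotential s μ x + Q x = rieszEnergy s μ + ∫⁻ x, Q x ∂μ := by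
  have := hμ.1.1
  obtain ⟨hμ1, hμ2⟩ := hμ.energies_ne_top hfin
  have hU := measurable_rieszPotential s μ
  set F := rieszEnergy s μ + ∫⁻ x, Q x ∂μ with hF
  have hm : MeasurableSet {x | rieszPotential s μ x + Q x < F} :=
    measurableSet_lt (hU.add hQ) measurable_const
  have h0 : μ.restrict {x | rieszPotential s μ x + Q x < F} = 0 := by
    refine hμ.measure_eq_zero_of_lt hs hfin ?_ ?_ (ae_restrict_mem hm)
    · exact le_antisymm ((Measure.restrict_apply_le _ _).trans hμ.1.2.le) zero_le
    · exact ne_top_of_le_ne_top hμ1 (rieszEnergy_mono Measure.restrict_le_self)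
  rw [Measure.restrict_eq_zero] at h0
  have hle : (fun _ ↦ F) ≤ᵐ[μ] fun x ↦ rieszPotential s μ x + Q x := by
    rw [EventuallyLE, ae_iff]
    simpa using h0
  have h2 := ae_eq_of_ae_le_of_lintegral_le hle ?_ (hU.add hQ).aemeasurable ?_
  · exact h2.mono fun x hx ↦ hx.symm
  · simp [hF, hμ1, hμ2]
  · rw [lintegral_add_left hU]
    simp [hF, rieszEnergy]

/-- Lower semicontinuity makes {U + Q > F} open, and it is μ-null, so it misses the support. -/
lemma IsExtremalMeasure.potential_le_of_mem_support {s : ℝ} (hs : 0 < s)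
    {E : Set (EuclideanSpace ℝ (Fin n))} {Q : EuclideanSpace ℝ (Fin n) → ℝ≥0∞}
    (hQ : LowerSemicontinuous Q) {μ : Measure (EuclideanSpace ℝ (Fin n))}
    (hfin : minWeightedEnergy s E Q ≠ ∞) (hμ : IsExtremalMeasure s E Q μ)
    {x : EuclideanSpace ℝ (Fin n)} (hx : x ∈ μ.support) :
    rieszPotential s μ x + Q x ≤ rieszEnergy s μ + ∫⁻ x, Q x ∂μ := by
  by_contra! hlt
  have hopen := ((lowerSemicontinuous_rieszPotential s μ).add hQ).isOpen_preimage
    (rieszEnergy s μ + ∫⁻ x, Q x ∂μ)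
  have hpos := (Measure.mem_support_iff_forall x).1 hx _ (hopen.mem_nhds hlt)
  have hzero : μ ((fun x ↦ rieszPotential s μ x + Q x) ⁻¹'
      Ioi (rieszEnergy s μ + ∫⁻ x, Q x ∂μ)) = 0 := by
    have h := hμ.ae_potential_eq hs hQ.measurable hfin
    rw [ae_iff] at h
    exact measure_mono_null (fun y hy ↦ (ne_of_gt hy)) h
  exact hpos.ne' hzero

/-- In polar coordinates the integrand is t^(n-1-s), integrable at 0 exactly when s < n. -/
lemma lintegral_ball_edist_rpow_lt_top {s : ℝ} (hn : 0 < n) (hsn : s < n) (r : ℝ) :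
    ∫⁻ y in ball (0 : EuclideanSpace ℝ (Fin n)) r, edist 0 y ^ (-s) < ∞ := by
  have : Nonempty (Fin n) := ⟨⟨0, hn⟩⟩
  have h1 : IntegrableOn (fun y : EuclideanSpace ℝ (Fin n) ↦ ‖y‖ ^ (-s)) (ball 0 r) := by
    rw [integrableOn_fun_norm_addHaar volume (f := fun t ↦ t ^ (-s))]
    rcases le_or_gt r 0 with hr | hr
    · simp [Ioo_eq_empty_of_le hr]
    · rw [integrableOn_congr_fun (g := fun t ↦ t ^ ((n : ℝ) - 1 - s)) _ measurableSet_Ioo]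
      · rw [intervalIntegral.integrableOn_Ioo_rpow_iff hr]
        linarith
      · intro t ht
        simp only [smul_eq_mul, finrank_euclideanSpace, Fintype.card_fin]
        rw [← Real.rpow_natCast, ← Real.rpow_add ht.1, Nat.cast_sub hn]
        congr 1
        push_cast
        ring
  have h2 := h1.2
  rw [hasFiniteIntegral_iff_ofReal (ae_of_all _ fun y ↦ by positivity)] at h2
  refine lt_of_eq_of_lt (lintegral_congr_ae (ae_restrict_of_ae ?_)) h2
  filter_upwards [Measure.ae_ne volume (0 : EuclideanSpace ℝ (Fin n))] with y hy
  rw [edist_comm, edist_zero_right, ← ofReal_norm,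
    ENNReal.ofReal_rpow_of_pos (norm_pos_iff.2 hy)]

lemma rieszEnergy_restrict_volume_ne_top {s : ℝ} (hn : 0 < n) (hsn : s < n)
    {A : Set (EuclideanSpace ℝ (Fin n))} (hA : A ⊆ closedBall 0 1) :
    rieszEnergy s (volume.restrict A) ≠ ∞ := by
  -- Translating by a point x of the unit ball moves that ball to within distance 2 of the origin.
  -- So radius 3 gives a bound on the potential that is uniform in x.
  set C := ∫⁻ y in ball (0 : EuclideanSpace ℝ (Fin n)) 3, edist 0 y ^ (-s) with hC
  have hCt : C < ∞ := lintegral_ball_edist_rpow_lt_top hn hsn 3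
  have h1 : ∀ x ∈ closedBall (0 : EuclideanSpace ℝ (Fin n)) 1,
      rieszPotential s (volume.restrict (closedBall 0 1)) x ≤ C := by
    intro x hx
    rw [hC, rieszPotential, ← lintegral_indicator measurableSet_ball,
      ← lintegral_indicator measurableSet_closedBall, ← lintegral_add_right_eq_self _ x]
    refine lintegral_mono fun y ↦ ?_
    by_cases hy : y + x ∈ closedBall (0 : EuclideanSpace ℝ (Fin n)) 1
    · have hyx : y ∈ ball (0 : EuclideanSpace ℝ (Fin n)) 3 := by
        rw [mem_closedBall_zero_iff] at hx hy
        rw [mem_ball_zero_iff]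
        have := norm_sub_le (y + x) x
        rw [add_sub_cancel_right] at this
        linarith
      rw [indicator_of_mem hy, indicator_of_mem hyx, edist_comm x, edist_comm 0,
        edist_zero_right, edist_eq_enorm_sub, add_sub_cancel_right]
    · rw [indicator_of_notMem hy]
      exact zero_le
  refine ne_top_of_le_ne_top ?_
    (rieszEnergy_mono (Measure.restrict_mono hA (le_refl (volume : Measure _))))
  refine ((setLIntegral_mono' measurableSet_closedBall h1).trans_lt ?_).ne
  rw [setLIntegral_const]
  exact ENNReal.mul_lt_top hCt measure_closedBall_lt_top

lemma rieszPotential_map_isometry {m : ℕ} (s : ℝ)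
    {f : EuclideanSpace ℝ (Fin m) → EuclideanSpace ℝ (Fin n)} (hf : Isometry f)
    (μ : Measure (EuclideanSpace ℝ (Fin m))) (x : EuclideanSpace ℝ (Fin m)) :
    rieszPotential s (μ.map f) (f x) = rieszPotential s μ x := by
  rw [rieszPotential, lintegral_map (by fun_prop) hf.continuous.measurable]
  simp only [hf.edist_eq]
  rfl

lemma rieszEnergy_map_isometry {m : ℕ} (s : ℝ)
    {f : EuclideanSpace ℝ (Fin m) → EuclideanSpace ℝ (Fin n)} (hf : Isometry f)
    (μ : Measure (EuclideanSpace ℝ (Fin m))) [SFinite μ] :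
    rieszEnergy s (μ.map f) = rieszEnergy s μ := by
  rw [rieszEnergy, lintegral_map (measurable_rieszPotential s _) hf.continuous.measurable]
  simp only [rieszPotential_map_isometry s hf]
  rfl

/-- A measure that is invariant under all linear isometries. -/
def IsRotationInvariant (μ : Measure (EuclideanSpace ℝ (Fin n))) : Prop :=
  ∀ R : EuclideanSpace ℝ (Fin n) ≃ₗᵢ[ℝ] EuclideanSpace ℝ (Fin n), μ.map R = μ

/-- A rotated extremal measure is again extremal, so uniqueness applies. -/
lemma IsExtremalMeasure.isRotationInvariant {s : ℝ} (hs : 0 < s)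
    {Q : EuclideanSpace ℝ (Fin n) → ℝ≥0∞} (hQ : Measurable Q)
    (hrot : ∀ (R : EuclideanSpace ℝ (Fin n) ≃ₗᵢ[ℝ] EuclideanSpace ℝ (Fin n)) x, Q (R x) = Q x)
    {μ : Measure (EuclideanSpace ℝ (Fin n))} {r : ℝ}
    (hfin : minWeightedEnergy s (closedBall 0 r) Q ≠ ∞)
    (hμ : IsExtremalMeasure s (closedBall 0 r) Q μ) : IsRotationInvariant μ := by
  intro R
  have := hμ.1.1
  have hR : Measurable R := R.continuous.measurable
  refine IsExtremalMeasure.unique hs hfin ⟨⟨Measure.isProbabilityMeasure_map hR.aemeasurable, ?_⟩,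
    ?_⟩ hμ
  · rw [Measure.map_apply hR measurableSet_closedBall.compl]
    convert hμ.1.2 using 2
    ext x
    simp
  · rw [← hμ.2, weightedEnergy, rieszEnergy_map_isometry s R.isometry, lintegral_map hQ hR]
    simp only [hrot]
    rfl

lemma exists_linearIsometryEquiv_eq {x y : EuclideanSpace ℝ (Fin n)} (h : ‖x‖ = ‖y‖) :
    ∃ R : EuclideanSpace ℝ (Fin n) ≃ₗᵢ[ℝ] EuclideanSpace ℝ (Fin n), R x = y :=
  ⟨_, Submodule.reflection_sub h⟩

lemma IsRotationInvariant.map_eq_restrict {μ : Measure (EuclideanSpace ℝ (Fin n))}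
    (hμ : IsRotationInvariant μ) {S : Set ℝ} (hS : MeasurableSet S) :
    IsRotationInvariant (μ.restrict {x | ‖x‖ ∈ S}) := by
  intro R
  have hm : MeasurableSet {x : EuclideanSpace ℝ (Fin n) | ‖x‖ ∈ S} := measurable_norm hS
  conv_rhs => rw [← hμ R]
  rw [Measure.restrict_map R.continuous.measurable hm]
  congr 2
  ext x
  simp

lemma IsRotationInvariant.rieszPotential_eq {μ : Measure (EuclideanSpace ℝ (Fin n))}
    (hμ : IsRotationInvariant μ) (s : ℝ) {x y : EuclideanSpace ℝ (Fin n)} (h : ‖x‖ = ‖y‖) :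
    rieszPotential s μ x = rieszPotential s μ y := by
  obtain ⟨R, rfl⟩ := exists_linearIsometryEquiv_eq h
  conv_rhs => rw [← hμ R]
  exact (rieszPotential_map_isometry s R.isometry μ x).symm

lemma IsRotationInvariant.mem_support_of_norm_eq {μ : Measure (EuclideanSpace ℝ (Fin n))}
    (hμ : IsRotationInvariant μ) {x y : EuclideanSpace ℝ (Fin n)} (h : ‖x‖ = ‖y‖)
    (hx : x ∈ μ.support) : y ∈ μ.support := by
  obtain ⟨R, rfl⟩ := exists_linearIsometryEquiv_eq h
  rw [Measure.mem_support_iff_forall] at hx ⊢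
  intro U hU
  obtain ⟨V, hVU, hVo, hxV⟩ := _root_.mem_nhds_iff.1 hU
  refine lt_of_lt_of_le ?_ (measure_mono hVU)
  rw [← hμ R, Measure.map_apply R.continuous.measurable hVo.measurableSet]
  exact hx _ ((hVo.preimage R.continuous).mem_nhds hxV)

end Potential

/-! ### Differentiating potentials along an axis and along a circle -/

section RadialPotential

open Set Filter Topology Metric

/-- Joint continuity on the compact set (closed interval) × `A` supplies the constant that dominates
the derivative. -/
lemma hasDerivAt_integral_of_continuousOn {X : Type*} [TopologicalSpace X] [MeasurableSpace X]
    [T2Space X] [OpensMeasurableSpace X] [SecondCountableTopology X]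
    {μ : Measure X} [IsFiniteMeasure μ] {A : Set X} (hA : IsCompact A) (hμ : μ Aᶜ = 0)
    {I : Set ℝ} (hI : IsOpen I) {F F' : ℝ → X → ℝ}
    (hF : ContinuousOn (Function.uncurry F) (I ×ˢ A))
    (hF' : ContinuousOn (Function.uncurry F') (I ×ˢ A))
    (hd : ∀ t ∈ I, ∀ y ∈ A, HasDerivAt (fun t ↦ F t y) (F' t y) t) {t : ℝ} (ht : t ∈ I) :
    HasDerivAt (fun t ↦ ∫ y, F t y ∂μ) (∫ y, F' t y ∂μ) t := by
  have hμA : μ.restrict A = μ := Measure.restrict_eq_self_of_ae_mem hμ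
  have hAe : ∀ᵐ y ∂μ, y ∈ A := hμ
  have hsec : ∀ {G : ℝ → X → ℝ}, ContinuousOn (Function.uncurry G) (I ×ˢ A) → ∀ t ∈ I,
      ContinuousOn (G t) A := fun hG t ht ↦
    hG.comp (f := fun y ↦ (t, y)) (by fun_prop) fun y hy ↦ ⟨ht, hy⟩
  have hmeas : ∀ {G : ℝ → X → ℝ}, ContinuousOn (Function.uncurry G) (I ×ˢ A) → ∀ t ∈ I,
      AEStronglyMeasurable (G t) μ := fun hG t ht ↦ by
    rw [← hμA]
    exact (hsec hG t ht).aestronglyMeasurable hA.measurableSet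
  obtain ⟨ε, hε, hball⟩ := Metric.isOpen_iff.1 hI t ht
  have hcb : closedBall t (ε / 2) ⊆ I := (closedBall_subset_ball (half_lt_self hε)).trans hball
  obtain ⟨C, hC⟩ := ((isCompact_closedBall t (ε / 2)).prod hA).exists_bound_of_continuousOn
    (hF'.mono (prod_mono hcb Subset.rfl))
  obtain ⟨D, hD⟩ := hA.exists_bound_of_continuousOn (hsec hF t ht)
  refine (hasDerivAt_integral_of_dominated_loc_of_deriv_le (bound := fun _ ↦ C)
    (s := closedBall t (ε / 2)) (closedBall_mem_nhds t (half_pos hε)) ?_ ?_ (hmeas hF' t ht) ?_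
    (integrable_const C) ?_).2
  · filter_upwards [hI.mem_nhds ht] with t' ht'
    exact hmeas hF t' ht'
  · exact Integrable.of_bound (hmeas hF t ht) D (hAe.mono fun y hy ↦ hD y hy)
  · exact hAe.mono fun y hy t' ht' ↦ hC (t', y) ⟨ht', hy⟩
  · exact hAe.mono fun y hy t' ht' ↦ hd t' (hcb ht') y hy

variable {m : ℕ}

/-- The squared distance of `y` to the point at position `t` on the first coordinate axis. -/
noncomputable def axisSqDist (t : ℝ) (y : EuclideanSpace ℝ (Fin (m + 2))) : ℝ := t ^ 2 - 2 * t * y 0 + ‖y‖ ^ 2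

lemma axisSqDist_eq (t : ℝ) (y : EuclideanSpace ℝ (Fin (m + 2))) :
    axisSqDist t y = ‖EuclideanSpace.single 0 t - y‖ ^ 2 := by
  rw [norm_sub_sq_real, EuclideanSpace.inner_single_left, PiLp.norm_single]
  simp [axisSqDist]
  ring

lemma axisSqDist_pos {t : ℝ} {y : EuclideanSpace ℝ (Fin (m + 2))} (h : ‖y‖ ≠ |t|) :
    0 < axisSqDist t y := by
  rw [axisSqDist_eq]
  have : EuclideanSpace.single 0 t - y ≠ 0 := by
    rw [sub_ne_zero]
    rintro rfl
    simp at h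
  positivity

lemma continuous_axisSqDist :
    Continuous (Function.uncurry (axisSqDist (m := m))) := by
  unfold axisSqDist Function.uncurry
  fun_prop

/-- The potential of `μ` with kernel `|x - y| ^ (-2 p)` along the first coordinate axis. -/
noncomputable def axisPotential (p : ℝ) (μ : Measure (EuclideanSpace ℝ (Fin (m + 2)))) (t : ℝ) : ℝ :=
  ∫ y, axisSqDist t y ^ (-p) ∂μ

/-- The first derivative of `axisPotential p μ`. -/
noncomputable def axisPotentialDeriv (p : ℝ) (μ : Measure (EuclideanSpace ℝ (Fin (m + 2))))
    (t : ℝ) : ℝ :=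
  ∫ y, -p * (2 * t - 2 * y 0) * axisSqDist t y ^ (-p - 1) ∂μ

/-- The second derivative of `axisPotential p μ`. -/
noncomputable def axisPotentialDeriv₂ (p : ℝ) (μ : Measure (EuclideanSpace ℝ (Fin (m + 2))))
    (t : ℝ) : ℝ :=
  ∫ y, (p * (p + 1) * (2 * t - 2 * y 0) ^ 2 * axisSqDist t y ^ (-p - 2)
    - 2 * p * axisSqDist t y ^ (-p - 1)) ∂μ

lemma hasDerivAt_axisSqDist (t : ℝ) (y : EuclideanSpace ℝ (Fin (m + 2))) :
    HasDerivAt (fun t ↦ axisSqDist t y) (2 * t - 2 * y 0) t := by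
  unfold axisSqDist
  have h := ((hasDerivAt_pow 2 t).sub (((hasDerivAt_id t).const_mul 2).mul_const (y 0))).add_const
    (‖y‖ ^ 2)
  exact h.congr_deriv (by norm_num)

variable {μ : Measure (EuclideanSpace ℝ (Fin (m + 2)))} [IsFiniteMeasure μ]
  {A : Set (EuclideanSpace ℝ (Fin (m + 2)))} {I : Set ℝ}

lemma continuousOn_axisSqDist_rpow (q : ℝ) (hIA : ∀ t ∈ I, ∀ y ∈ A, 0 < axisSqDist t y) :
    ContinuousOn (Function.uncurry fun t y ↦ axisSqDist t y ^ q) (I ×ˢ A) :=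
  continuous_axisSqDist.continuousOn.rpow_const fun z hz ↦ Or.inl (hIA z.1 hz.1 z.2 hz.2).ne'

lemma hasDerivAt_axisPotential (p : ℝ) (hA : IsCompact A) (hμ : μ Aᶜ = 0) (hI : IsOpen I)
    (hIA : ∀ t ∈ I, ∀ y ∈ A, 0 < axisSqDist t y) {t : ℝ} (ht : t ∈ I) :
    HasDerivAt (axisPotential p μ) (axisPotentialDeriv p μ t) t := by
  refine hasDerivAt_integral_of_continuousOn (F := fun t y ↦ axisSqDist t y ^ (-p))
    (F' := fun t y ↦ -p * (2 * t - 2 * y 0) * axisSqDist t y ^ (-p - 1)) hA hμ hI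
    (continuousOn_axisSqDist_rpow _ hIA) ?_ ?_ ht
  · refine ContinuousOn.mul (Continuous.continuousOn ?_) (continuousOn_axisSqDist_rpow _ hIA)
    fun_prop
  · intro t ht y hy
    convert (hasDerivAt_axisSqDist t y).rpow_const (p := -p) (Or.inl (hIA t ht y hy).ne') using 1
    ring

lemma hasDerivAt_axisPotentialDeriv (p : ℝ) (hA : IsCompact A) (hμ : μ Aᶜ = 0) (hI : IsOpen I)
    (hIA : ∀ t ∈ I, ∀ y ∈ A, 0 < axisSqDist t y) {t : ℝ} (ht : t ∈ I) :
    HasDerivAt (axisPotentialDeriv p μ) (axisPotentialDeriv₂ p μ t) t := by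
  refine hasDerivAt_integral_of_continuousOn
    (F := fun t y ↦ -p * (2 * t - 2 * y 0) * axisSqDist t y ^ (-p - 1))
    (F' := fun t y ↦ p * (p + 1) * (2 * t - 2 * y 0) ^ 2 * axisSqDist t y ^ (-p - 2)
      - 2 * p * axisSqDist t y ^ (-p - 1)) hA hμ hI ?_ ?_ ?_ ht
  · refine ContinuousOn.mul (Continuous.continuousOn ?_) (continuousOn_axisSqDist_rpow _ hIA)
    fun_prop
  · refine ContinuousOn.sub
      (ContinuousOn.mul (Continuous.continuousOn ?_) (continuousOn_axisSqDist_rpow _ hIA))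
      (ContinuousOn.mul (Continuous.continuousOn ?_) (continuousOn_axisSqDist_rpow _ hIA))
    · fun_prop
    · fun_prop
  · intro t ht y hy
    have h1 := (hasDerivAt_axisSqDist t y).rpow_const (p := -p - 1) (Or.inl (hIA t ht y hy).ne')
    have h2 : HasDerivAt (fun t ↦ -p * (2 * t - 2 * y 0)) (-p * 2) t := by
      have := (((hasDerivAt_id t).const_mul 2).sub_const (2 * y 0)).const_mul (-p)
      simpa using this
    refine (h2.mul h1).congr_deriv ?_
    rw [show -p - 1 - 1 = -p - 2 by ring]
    ring

lemma IsRotationInvariant.integral_norm_sub_eq {n : ℕ} {μ : Measure (EuclideanSpace ℝ (Fin n))}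
    (hμ : IsRotationInvariant μ) (k : ℝ → ℝ) {x y : EuclideanSpace ℝ (Fin n)} (h : ‖x‖ = ‖y‖) :
    ∫ z, k ‖x - z‖ ∂μ = ∫ z, k ‖y - z‖ ∂μ := by
  obtain ⟨R, rfl⟩ := exists_linearIsometryEquiv_eq h
  conv_rhs => rw [← hμ R]
  rw [(show MeasurableEmbedding R from R.toHomeomorph.measurableEmbedding).integral_map]
  simp [← map_sub]

/-- The squared distance of `y` to the point of norm `|t|` at angle `φ` in the plane of the first
and of the `i`-th coordinate axes. -/
noncomputable def planeSqDist (i : Fin (m + 2)) (t φ : ℝ) (y : EuclideanSpace ℝ (Fin (m + 2))) : ℝ :=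
  t ^ 2 - 2 * t * (Real.cos φ * y 0 + Real.sin φ * y i) + ‖y‖ ^ 2

lemma planeSqDist_eq {i : Fin (m + 2)} (hi : i ≠ 0) (t φ : ℝ)
    (y : EuclideanSpace ℝ (Fin (m + 2))) :
    planeSqDist i t φ y = ‖(EuclideanSpace.single 0 (t * Real.cos φ) +
      EuclideanSpace.single i (t * Real.sin φ)) - y‖ ^ 2 := by
  rw [norm_sub_sq_real, inner_add_left, norm_add_sq_real, EuclideanSpace.inner_single_left,
    EuclideanSpace.inner_single_left, EuclideanSpace.inner_single_left, PiLp.norm_single,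
    PiLp.norm_single]
  simp only [planeSqDist, Real.norm_eq_abs, sq_abs]
  simp [hi.symm]
  linear_combination (-t ^ 2) * Real.sin_sq_add_cos_sq φ

lemma norm_single_add_single {i : Fin (m + 2)} (hi : i ≠ 0) (t φ : ℝ) :
    ‖(EuclideanSpace.single 0 (t * Real.cos φ) + EuclideanSpace.single i (t * Real.sin φ) :
      EuclideanSpace ℝ (Fin (m + 2)))‖ = |t| := by
  have h := planeSqDist_eq hi t φ 0
  simp only [planeSqDist, sub_zero] at h
  rw [← Real.sqrt_sq_eq_abs, ← Real.sqrt_sq (norm_nonneg _), ← h]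
  simp

lemma planeSqDist_pos {i : Fin (m + 2)} (hi : i ≠ 0) {t : ℝ} (φ : ℝ)
    {y : EuclideanSpace ℝ (Fin (m + 2))} (h : ‖y‖ ≠ |t|) : 0 < planeSqDist i t φ y := by
  rw [planeSqDist_eq hi]
  refine pow_pos (norm_pos_iff.2 (sub_ne_zero.2 ?_)) 2
  rintro rfl
  exact h (norm_single_add_single hi t φ)

lemma hasDerivAt_planeSqDist (i : Fin (m + 2)) (t φ : ℝ) (y : EuclideanSpace ℝ (Fin (m + 2))) :
    HasDerivAt (fun φ ↦ planeSqDist i t φ y)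
      (-(2 * t * (-Real.sin φ * y 0 + Real.cos φ * y i))) φ := by
  unfold planeSqDist
  exact (((((Real.hasDerivAt_cos φ).mul_const (y 0)).add
    ((Real.hasDerivAt_sin φ).mul_const (y i))).const_mul (2 * t)).const_sub (t ^ 2)).add_const _

lemma continuousOn_planeSqDist_rpow {i : Fin (m + 2)} (hi : i ≠ 0) {t : ℝ} (q : ℝ)
    (htA : ∀ y ∈ A, ‖y‖ ≠ |t|) :
    ContinuousOn (Function.uncurry fun φ y ↦ planeSqDist i t φ y ^ q) (univ ×ˢ A) := by
  refine ContinuousOn.rpow_const (Continuous.continuousOn ?_)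
    fun z hz ↦ Or.inl (planeSqDist_pos hi z.1 (htA z.2 hz.2)).ne'
  unfold planeSqDist
  fun_prop

/-- The angular part of the Laplacian of a rotation invariant potential. -/
lemma IsRotationInvariant.integral_coord_sq (p : ℝ) (hinv : IsRotationInvariant μ)
    (hA : IsCompact A) (hμ : μ Aᶜ = 0) {t : ℝ} (htA : ∀ y ∈ A, ‖y‖ ≠ |t|)
    {i : Fin (m + 2)} (hi : i ≠ 0) :
    ∫ y, (p * (p + 1) * (2 * t * y i) ^ 2 * axisSqDist t y ^ (-p - 2)
      - p * (2 * t * y 0) * axisSqDist t y ^ (-p - 1)) ∂μ = 0 := by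
  -- `G1` and `G2` are the first and second φ-derivatives of `planeSqDist i t φ y ^ (-p)`.
  set G1 : ℝ → EuclideanSpace ℝ (Fin (m + 2)) → ℝ := fun φ y ↦
    -p * (-(2 * t * (-Real.sin φ * y 0 + Real.cos φ * y i))) * planeSqDist i t φ y ^ (-p - 1)
    with hG1
  set G2 : ℝ → EuclideanSpace ℝ (Fin (m + 2)) → ℝ := fun φ y ↦
    p * (p + 1) * (2 * t * (-Real.sin φ * y 0 + Real.cos φ * y i)) ^ 2 *
      planeSqDist i t φ y ^ (-p - 2) - p * (2 * t * (Real.cos φ * y 0 + Real.sin φ * y i)) *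
      planeSqDist i t φ y ^ (-p - 1) with hG2
  have hc1 : ContinuousOn (Function.uncurry G1) (univ ×ˢ A) := by
    refine ContinuousOn.mul (Continuous.continuousOn ?_) (continuousOn_planeSqDist_rpow hi _ htA)
    fun_prop
  have hc2 : ContinuousOn (Function.uncurry G2) (univ ×ˢ A) := by
    refine ContinuousOn.sub
      (ContinuousOn.mul (Continuous.continuousOn ?_) (continuousOn_planeSqDist_rpow hi _ htA))
      (ContinuousOn.mul (Continuous.continuousOn ?_) (continuousOn_planeSqDist_rpow hi _ htA))
    · fun_prop
    · fun_prop
  have hd1 : ∀ φ, HasDerivAt (fun φ ↦ ∫ y, planeSqDist i t φ y ^ (-p) ∂μ)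
      (∫ y, G1 φ y ∂μ) φ := by
    intro φ
    refine hasDerivAt_integral_of_continuousOn hA hμ isOpen_univ
      (continuousOn_planeSqDist_rpow hi _ htA) hc1 ?_ (mem_univ φ)
    intro φ _ y hy
    convert (hasDerivAt_planeSqDist i t φ y).rpow_const (p := -p)
      (Or.inl (planeSqDist_pos hi φ (htA y hy)).ne') using 1
    ring
  have hd2 : HasDerivAt (fun φ ↦ ∫ y, G1 φ y ∂μ) (∫ y, G2 0 y ∂μ) 0 := by
    refine hasDerivAt_integral_of_continuousOn hA hμ isOpen_univ hc1 hc2 ?_ (mem_univ 0)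
    intro φ _ y hy
    have h1 := (hasDerivAt_planeSqDist i t φ y).rpow_const (p := -p - 1)
      (Or.inl (planeSqDist_pos hi φ (htA y hy)).ne')
    have h2 : HasDerivAt (fun φ ↦ -p * (-(2 * t * (-Real.sin φ * y 0 + Real.cos φ * y i))))
        (-p * (-(2 * t * (-Real.cos φ * y 0 + -Real.sin φ * y i)))) φ :=
      (((((Real.hasDerivAt_sin φ).neg.mul_const (y 0)).add
      ((Real.hasDerivAt_cos φ).mul_const (y i))).const_mul (2 * t)).neg).const_mul (-p)
    refine (h2.mul h1).congr_deriv ?_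
    simp only [hG2]
    rw [show -p - 1 - 1 = -p - 2 by ring]
    ring
  -- Rotating the evaluation point leaves its norm unchanged, so the potential is constant along the
  -- circle. Its second derivative at φ = 0 is the integral in question.
  have hconst : (fun φ ↦ ∫ y, planeSqDist i t φ y ^ (-p) ∂μ) =
      fun _ ↦ ∫ y, planeSqDist i t 0 y ^ (-p) ∂μ := by
    funext φ
    simp only [planeSqDist_eq hi]
    refine hinv.integral_norm_sub_eq (fun r ↦ (r ^ 2) ^ (-p)) ?_
    rw [norm_single_add_single hi, norm_single_add_single hi]
  have hzero : (fun φ ↦ ∫ y, G1 φ y ∂μ) = fun _ ↦ 0 := by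
    funext φ
    have h := hd1 φ
    rw [hconst] at h
    exact h.unique (hasDerivAt_const φ _)
  rw [hzero] at hd2
  have h := hd2.unique (hasDerivAt_const 0 _)
  rw [← h]
  congr 1 with y
  simp [hG2, planeSqDist, axisSqDist]

end RadialPotential

/-! ### Radial Laplacian and lower bounds for the second derivative -/

section RadialConvexity

open Set Filter Topology Metric

variable {m : ℕ} {μ : Measure (EuclideanSpace ℝ (Fin (m + 2)))} [IsFiniteMeasure μ]
  {A : Set (EuclideanSpace ℝ (Fin (m + 2)))} {I : Set ℝ}

lemma integrable_mul_axisSqDist_rpow (q : ℝ) (hA : IsCompact A) (hμ : μ Aᶜ = 0) {t : ℝ}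
    (htA : ∀ y ∈ A, 0 < axisSqDist t y) {f : EuclideanSpace ℝ (Fin (m + 2)) → ℝ}
    (hf : Continuous f) : Integrable (fun y ↦ f y * axisSqDist t y ^ q) μ := by
  have hμA : μ.restrict A = μ := Measure.restrict_eq_self_of_ae_mem hμ
  rw [← hμA]
  refine ContinuousOn.integrableOn_compact hA (hf.continuousOn.mul ?_)
  refine ContinuousOn.rpow_const ?_ fun y hy ↦ Or.inl (htA y hy).ne'
  exact (continuous_axisSqDist.comp (by fun_prop : Continuous fun y ↦ (t, y))).continuousOn

lemma axisSqDist_pos_of_abs_ne {t : ℝ} (htA : ∀ y ∈ A, ‖y‖ ≠ |t|) :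
    ∀ y ∈ A, 0 < axisSqDist t y := fun y hy ↦ axisSqDist_pos (htA y hy)

lemma sum_coord_sq (y : EuclideanSpace ℝ (Fin (m + 2))) :
    ∑ i ∈ Finset.univ.erase (0 : Fin (m + 2)), y i ^ 2 = ‖y‖ ^ 2 - y 0 ^ 2 := by
  rw [EuclideanSpace.real_norm_sq_eq, ← Finset.add_sum_erase _ _ (Finset.mem_univ 0)]
  ring

lemma axisSqDist_mul_rpow {t p : ℝ} {y : EuclideanSpace ℝ (Fin (m + 2))}
    (h : 0 < axisSqDist t y) :
    axisSqDist t y ^ (-p - 1) = axisSqDist t y * axisSqDist t y ^ (-p - 2) := by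
  rw [show -p - 1 = 1 + (-p - 2) by ring, Real.rpow_add h, Real.rpow_one]

/-- The Laplacian of a rotation invariant Riesz potential, in radial form. -/
lemma axisPotential_laplacian (p : ℝ) (hinv : IsRotationInvariant μ)
    (hA : IsCompact A) (hμ : μ Aᶜ = 0) {t : ℝ} (ht : t ≠ 0) (htA : ∀ y ∈ A, ‖y‖ ≠ |t|) :
    t * axisPotentialDeriv₂ p μ t + (m + 1) * axisPotentialDeriv p μ t =
      2 * p * (2 * p - m) * t * axisPotential (p + 1) μ t := by
  have hpos := axisSqDist_pos_of_abs_ne htA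
  have hi : ∀ (q : ℝ) {f : EuclideanSpace ℝ (Fin (m + 2)) → ℝ}, Continuous f →
      Integrable (fun y ↦ f y * axisSqDist t y ^ q) μ :=
    fun q _ hf ↦ integrable_mul_axisSqDist_rpow q hA hμ hpos hf
  have h1 : ∑ i ∈ Finset.univ.erase (0 : Fin (m + 2)),
      ∫ y, (p * (p + 1) * (2 * t * y i) ^ 2 * axisSqDist t y ^ (-p - 2)
        - p * (2 * t * y 0) * axisSqDist t y ^ (-p - 1)) ∂μ = 0 :=
    Finset.sum_eq_zero fun i hi ↦ hinv.integral_coord_sq p hA hμ htA (Finset.ne_of_mem_erase hi)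
  rw [← integral_finsetSum _ fun i _ ↦ by
    exact (hi _ (by fun_prop)).sub (hi _ (by fun_prop))] at h1
  have h2 : ∀ y, ∑ i ∈ Finset.univ.erase (0 : Fin (m + 2)),
      (p * (p + 1) * (2 * t * y i) ^ 2 * axisSqDist t y ^ (-p - 2)
        - p * (2 * t * y 0) * axisSqDist t y ^ (-p - 1)) =
      p * (p + 1) * (4 * t ^ 2) * (‖y‖ ^ 2 - y 0 ^ 2) * axisSqDist t y ^ (-p - 2)
        - (m + 1) * (p * (2 * t * y 0)) * axisSqDist t y ^ (-p - 1) := by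
    intro y
    rw [Finset.sum_sub_distrib, Finset.sum_const, Finset.card_erase_of_mem (Finset.mem_univ _),
      Finset.card_univ, Fintype.card_fin, ← sum_coord_sq, Finset.mul_sum, Finset.sum_mul]
    congr 1
    · exact Finset.sum_congr rfl fun i _ ↦ by ring
    · simp
      ring
  simp_rw [h2] at h1
  have hF2 : Integrable (fun y ↦ p * (p + 1) * (2 * t - 2 * y 0) ^ 2 * axisSqDist t y ^ (-p - 2)
      - 2 * p * axisSqDist t y ^ (-p - 1)) μ :=
    (hi _ (by fun_prop)).sub (hi _ (by fun_prop))
  have hF1 : Integrable (fun y ↦ -p * (2 * t - 2 * y 0) * axisSqDist t y ^ (-p - 1)) μ :=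
    hi _ (by fun_prop)
  have hFA : Integrable (fun y ↦ p * (p + 1) * (4 * t ^ 2) * (‖y‖ ^ 2 - y 0 ^ 2) *
      axisSqDist t y ^ (-p - 2) - (m + 1) * (p * (2 * t * y 0)) * axisSqDist t y ^ (-p - 1)) μ :=
    (hi _ (by fun_prop)).sub (hi _ (by fun_prop))
  -- Adding the vanishing angular integrals completes the radial terms to the full Laplacian. The
  -- extra factor t matches the t² of those integrals, and once `axisSqDist t y ^ (-p - 2)` is
  -- factored out the identity is polynomial and holds pointwise.
  have h3 : t * (t * axisPotentialDeriv₂ p μ t + (m + 1) * axisPotentialDeriv p μ t) =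
      t * (2 * p * (2 * p - m) * t * axisPotential (p + 1) μ t) := by
    rw [← add_zero (t * (t * axisPotentialDeriv₂ p μ t + (m + 1) * axisPotentialDeriv p μ t)),
      ← h1, axisPotentialDeriv, axisPotentialDeriv₂, axisPotential, ← integral_const_mul,
      ← integral_const_mul, ← integral_add (hF2.const_mul _) (hF1.const_mul _),
      ← integral_const_mul, ← integral_add (by exact ((hF2.const_mul _).add (hF1.const_mul _)).const_mul _)
      hFA, ← integral_const_mul, ← integral_const_mul]
    have hAe : ∀ᵐ y ∂μ, y ∈ A := hμ
    refine integral_congr_ae (hAe.mono fun y hy ↦ ?_)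
    simp only [neg_add']
    rw [axisSqDist_mul_rpow (hpos y hy)]
    simp only [axisSqDist]
    ring
  exact mul_left_cancel₀ ht h3

lemma axisPotential_nonneg (p : ℝ) (μ : Measure (EuclideanSpace ℝ (Fin (m + 2)))) (t : ℝ) :
    0 ≤ axisPotential p μ t := by
  refine integral_nonneg fun y ↦ Real.rpow_nonneg ?_ _
  rw [axisSqDist_eq]
  positivity

lemma axisPotential_pos (p : ℝ) (hA : IsCompact A) (hμ : μ Aᶜ = 0) (h0 : μ ≠ 0) {t : ℝ}
    (htA : ∀ y ∈ A, ‖y‖ ≠ |t|) : 0 < axisPotential p μ t := by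
  have hpos := axisSqDist_pos_of_abs_ne htA
  have hAe : ∀ᵐ y ∂μ, y ∈ A := hμ
  have hi := integrable_mul_axisSqDist_rpow (-p) hA hμ hpos (continuous_const (y := (1 : ℝ)))
  simp only [one_mul] at hi
  refine (integral_pos_iff_support_of_nonneg_ae ?_ hi).2 ?_
  · exact hAe.mono fun y hy ↦ Real.rpow_nonneg (hpos y hy).le _
  · have h1 : A ⊆ Function.support fun y ↦ axisSqDist t y ^ (-p) := fun y hy ↦
      (Real.rpow_pos_of_pos (hpos y hy) _).ne'
    refine lt_of_lt_of_le (pos_iff_ne_zero.2 fun h ↦ h0 ?_) (measure_mono h1)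
    rw [← Measure.measure_univ_eq_zero, ← union_compl_self A]
    exact measure_union_null h hμ

/-- The set `{x | ‖x‖ ∈ S}` is compact for compact `S`. -/
lemma isCompact_norm_preimage {n : ℕ} {S : Set ℝ} (hS : IsCompact S) :
    IsCompact {x : EuclideanSpace ℝ (Fin n) | ‖x‖ ∈ S} := by
  obtain ⟨r, hr⟩ := hS.isBounded.subset_closedBall 0
  refine (isCompact_closedBall (0 : EuclideanSpace ℝ (Fin n)) r).of_isClosed_subset
    (hS.isClosed.preimage continuous_norm) fun x hx ↦ ?_
  have := hr hx
  simpa using this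

section Outer

variable {r R : ℝ}

lemma abs_notMem_of_lt {r R t : ℝ} (ht : t ∈ Ioo (-r) r) :
    ∀ y ∈ {x : EuclideanSpace ℝ (Fin (m + 2)) | ‖x‖ ∈ Icc r R}, ‖y‖ ≠ |t| := by
  intro y hy h
  have := abs_lt.2 ht
  rw [← h] at this
  exact absurd hy.1 (not_le.2 this)

/-- The potential of a measure outside of a ball increases along the radii of the ball. -/
lemma axisPotentialDeriv_nonneg_of_outer {p : ℝ} (hp : 0 < p) (hpm : (m : ℝ) < 2 * p)
    (hinv : IsRotationInvariant μ)
    (hμ : μ {x | ‖x‖ ∈ Icc r R}ᶜ = 0) {t : ℝ} (ht : t ∈ Ioo 0 r) :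
    0 ≤ axisPotentialDeriv p μ t := by
  have hA := isCompact_norm_preimage (n := m + 2) (isCompact_Icc (a := r) (b := R))
  have hIA : ∀ t ∈ Ioo (-r) r, ∀ y ∈ {x : EuclideanSpace ℝ (Fin (m + 2)) | ‖x‖ ∈ Icc r R},
      0 < axisSqDist t y := fun t ht ↦ axisSqDist_pos_of_abs_ne (abs_notMem_of_lt ht)
  -- Divergence form of the radial Laplacian: the flux t^(m+1) u' is nondecreasing and vanishes at t
  -- = 0. Working on (-r, r) makes the origin an interior point.
  have hd : ∀ t ∈ Ioo (-r) r, HasDerivAt (fun t ↦ t ^ (m + 1) * axisPotentialDeriv p μ t)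
      (t ^ m * (t * axisPotentialDeriv₂ p μ t + (m + 1) * axisPotentialDeriv p μ t)) t := by
    intro t ht
    refine ((hasDerivAt_pow (m + 1) t).mul
      (hasDerivAt_axisPotentialDeriv p hA hμ isOpen_Ioo hIA ht)).congr_deriv ?_
    push_cast
    ring
  have hsub : Icc 0 t ⊆ Ioo (-r) r := fun x hx ↦ ⟨by linarith [hx.1, ht.1, ht.2],
    by linarith [hx.2, ht.2]⟩
  have hmono : MonotoneOn (fun t ↦ t ^ (m + 1) * axisPotentialDeriv p μ t) (Icc 0 t) := by
    refine monotoneOn_of_deriv_nonneg (convex_Icc 0 t)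
      (fun x hx ↦ (hd x (hsub hx)).continuousAt.continuousWithinAt)
      (fun x hx ↦ (hd x (hsub (interior_subset hx))).differentiableAt.differentiableWithinAt) ?_
    intro x hx
    rw [interior_Icc] at hx
    have hx' := hsub (Ioo_subset_Icc_self hx)
    rw [(hd x hx').deriv, axisPotential_laplacian p hinv hA hμ hx.1.ne' (abs_notMem_of_lt hx')]
    have h1 := axisPotential_nonneg (p + 1) μ x
    have h2 := hx.1.le
    have h3 : 0 ≤ 2 * p - m := by linarith
    positivity
  have h := hmono (left_mem_Icc.2 ht.1.le) (right_mem_Icc.2 ht.1.le) ht.1.le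
  simp only [ne_eq, Nat.add_eq_zero_iff, one_ne_zero, and_false, not_false_eq_true, zero_pow,
    zero_mul] at h
  exact nonneg_of_mul_nonneg_right h (pow_pos ht.1 _)

/-- Write u for the potential with exponent p and v for that with p + 1, and C = 2p(2p - m). Since v
increases along the radius, integrating (t^(m+1) u')' = C t^(m+1) v gives u' ≤ C t v / (m + 2).
Inserted into t u'' + (m + 1) u' = C t v, this leaves the fraction 1 - (m + 1)/(m + 2) of C v. -/
lemma axisPotentialDeriv₂_ge_of_outer {p : ℝ} (hp : 0 < p) (hpm : (m : ℝ) < 2 * p)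
    (hinv : IsRotationInvariant μ)
    (hμ : μ {x | ‖x‖ ∈ Icc r R}ᶜ = 0) {t : ℝ} (ht : t ∈ Ioo 0 r) :
    2 * p * (2 * p - m) / (m + 2) * axisPotential (p + 1) μ t ≤ axisPotentialDeriv₂ p μ t := by
  have hA := isCompact_norm_preimage (n := m + 2) (isCompact_Icc (a := r) (b := R))
  have hIA : ∀ t ∈ Ioo (-r) r, ∀ y ∈ {x : EuclideanSpace ℝ (Fin (m + 2)) | ‖x‖ ∈ Icc r R},
      0 < axisSqDist t y := fun t ht ↦ axisSqDist_pos_of_abs_ne (abs_notMem_of_lt ht)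
  set C := 2 * p * (2 * p - m) with hC
  have hC0 : 0 < C := mul_pos (by linarith) (by linarith)
  have hd : ∀ t ∈ Ioo (-r) r, HasDerivAt (fun t ↦ C / (m + 2) * (t ^ (m + 2) *
      axisPotential (p + 1) μ t) - t ^ (m + 1) * axisPotentialDeriv p μ t)
      (C / (m + 2) * t ^ (m + 2) * axisPotentialDeriv (p + 1) μ t + t ^ m * (C * t *
      axisPotential (p + 1) μ t -
      (t * axisPotentialDeriv₂ p μ t + (m + 1) * axisPotentialDeriv p μ t))) t := by
    intro t ht
    refine ((((hasDerivAt_pow (m + 2) t).mul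
      (hasDerivAt_axisPotential (p + 1) hA hμ isOpen_Ioo hIA ht)).const_mul (C / (m + 2))).sub
      ((hasDerivAt_pow (m + 1) t).mul
      (hasDerivAt_axisPotentialDeriv p hA hμ isOpen_Ioo hIA ht))).congr_deriv ?_
    have : (m : ℝ) + 2 ≠ 0 := by positivity
    push_cast
    field_simp
    ring
  have hsub : Icc 0 t ⊆ Ioo (-r) r := fun x hx ↦ ⟨by linarith [hx.1, ht.1, ht.2],
    by linarith [hx.2, ht.2]⟩
  have hmono : MonotoneOn (fun t ↦ C / (m + 2) * (t ^ (m + 2) *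
      axisPotential (p + 1) μ t) - t ^ (m + 1) * axisPotentialDeriv p μ t) (Icc 0 t) := by
    refine monotoneOn_of_deriv_nonneg (convex_Icc 0 t)
      (fun x hx ↦ (hd x (hsub hx)).continuousAt.continuousWithinAt)
      (fun x hx ↦ (hd x (hsub (interior_subset hx))).differentiableAt.differentiableWithinAt) ?_
    intro x hx
    rw [interior_Icc] at hx
    have hx' := hsub (Ioo_subset_Icc_self hx)
    rw [(hd x hx').deriv, axisPotential_laplacian p hinv hA hμ hx.1.ne' (abs_notMem_of_lt hx'),
      sub_self, mul_zero, add_zero]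
    have h1 := axisPotentialDeriv_nonneg_of_outer (p := p + 1) (by linarith) (by linarith) hinv hμ
      (t := x) ⟨hx.1, hx'.2⟩
    have h2 := hx.1.le
    positivity
  have h := hmono (left_mem_Icc.2 ht.1.le) (right_mem_Icc.2 ht.1.le) ht.1.le
  simp only [ne_eq, Nat.add_eq_zero_iff, one_ne_zero, and_false, not_false_eq_true, zero_pow,
    zero_mul, OfNat.ofNat_ne_zero, mul_zero, sub_zero] at h
  have ht' : t ∈ Ioo (-r) r := hsub (right_mem_Icc.2 ht.1.le)
  have h2 := axisPotential_laplacian p hinv hA hμ ht.1.ne' (abs_notMem_of_lt ht')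
  have h3 : 0 ≤ C / (m + 2) * (t * axisPotential (p + 1) μ t) - axisPotentialDeriv p μ t := by
    refine nonneg_of_mul_nonneg_right (a := t ^ (m + 1)) ?_ (pow_pos ht.1 _)
    calc _ ≤ _ := h
      _ = _ := by ring
  have h4 : t * (C / (m + 2) * axisPotential (p + 1) μ t) ≤ t * axisPotentialDeriv₂ p μ t := by
    have h5 : t * axisPotentialDeriv₂ p μ t = (m + 2) * (C / (m + 2)) * t *
        axisPotential (p + 1) μ t - (m + 1) * axisPotentialDeriv p μ t := by
      rw [mul_div_cancel₀ _ (by positivity)]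
      linarith
    have h6 : 0 ≤ ((m : ℝ) + 1) * (C / (m + 2) * (t * axisPotential (p + 1) μ t) -
      axisPotentialDeriv p μ t) := mul_nonneg (by positivity) h3
    rw [h5]
    linarith
  exact le_of_mul_le_mul_left h4 ht.1

end Outer

section Inner

variable {r : ℝ}

lemma abs_notMem_of_gt {r t : ℝ} (hr : 0 ≤ r) (ht : r < t) :
    ∀ y ∈ {x : EuclideanSpace ℝ (Fin (m + 2)) | ‖x‖ ∈ Icc 0 r}, ‖y‖ ≠ |t| := by
  intro y hy h
  rw [abs_of_pos (hr.trans_lt ht)] at h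
  exact absurd hy.2 (not_le.2 (h ▸ ht))

lemma coord_le_norm (y : EuclideanSpace ℝ (Fin (m + 2))) : y 0 ≤ ‖y‖ :=
  (le_abs_self _).trans (PiLp.norm_apply_le y 0)

lemma axisPotentialDeriv_nonpos_of_inner {ν : Measure (EuclideanSpace ℝ (Fin (m + 2)))} {p : ℝ}
    (hp : 0 < p) (hν : ν {x | ‖x‖ ∈ Icc 0 r}ᶜ = 0) {t : ℝ} (ht : r < t) :
    axisPotentialDeriv p ν t ≤ 0 := by
  have hAe : ∀ᵐ y ∂ν, y ∈ {x : EuclideanSpace ℝ (Fin (m + 2)) | ‖x‖ ∈ Icc 0 r} := hν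
  refine integral_nonpos_of_ae (hAe.mono fun y hy ↦ ?_)
  have h1 : 0 ≤ axisSqDist t y ^ (-p - 1) := by
    refine Real.rpow_nonneg ?_ _
    rw [axisSqDist_eq]
    positivity
  have h2 : 0 ≤ 2 * t - 2 * y 0 := by linarith [coord_le_norm y, hy.2]
  have h3 : 0 ≤ p * (2 * t - 2 * y 0) * axisSqDist t y ^ (-p - 1) := by positivity
  simp only [Pi.zero_apply]
  linarith

/-- Beyond the mass the first derivative is nonpositive, so the radial Laplacian gives the bound
even without the division by m + 2. The weaker constant matches the one for outer mass. -/
lemma axisPotentialDeriv₂_ge_of_inner {p : ℝ} (hp : 0 < p) (hpm : (m : ℝ) < 2 * p) (hr : 0 ≤ r)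
    (hinv : IsRotationInvariant μ)
    (hμ : μ {x | ‖x‖ ∈ Icc 0 r}ᶜ = 0) {t : ℝ} (ht : r < t) :
    2 * p * (2 * p - m) / (m + 2) * axisPotential (p + 1) μ t ≤ axisPotentialDeriv₂ p μ t := by
  have hA := isCompact_norm_preimage (n := m + 2) (isCompact_Icc (a := 0) (b := r))
  have ht0 : 0 < t := hr.trans_lt ht
  have h1 := axisPotential_laplacian p hinv hA hμ ht0.ne' (abs_notMem_of_gt hr ht)
  have h2 := axisPotentialDeriv_nonpos_of_inner hp hμ ht
  have h3 := axisPotential_nonneg (p + 1) μ t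
  set C := 2 * p * (2 * p - m) with hC
  have hC0 : 0 < C := mul_pos (by linarith) (by linarith)
  have h4 : C / (m + 2) ≤ C := div_le_self hC0.le (by linarith [(Nat.cast_nonneg m : (0:ℝ) ≤ m)])
  refine (mul_le_mul_of_nonneg_right h4 h3).trans (le_of_mul_le_mul_left ?_ ht0)
  have h5 : ((m : ℝ) + 1) * axisPotentialDeriv p μ t ≤ 0 :=
    mul_nonpos_of_nonneg_of_nonpos (by positivity) h2
  linarith

end Inner

end RadialConvexity

/-! ### Strict convexity across a gap of the support -/

section GapConvexity

open Set Filter Topology Metric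

variable {m : ℕ} {μ : Measure (EuclideanSpace ℝ (Fin (m + 2)))}

lemma edist_single_rpow {s t : ℝ} {y : EuclideanSpace ℝ (Fin (m + 2))}
    (hy : y ≠ EuclideanSpace.single 0 t) :
    edist (EuclideanSpace.single 0 t) y ^ (-s) = ENNReal.ofReal (axisSqDist t y ^ (-(s / 2))) := by
  have hpos : 0 < ‖EuclideanSpace.single 0 t - y‖ := norm_pos_iff.2 (sub_ne_zero.2 hy.symm)
  rw [edist_dist, dist_eq_norm, ENNReal.ofReal_rpow_of_pos hpos, axisSqDist_eq,
    ← Real.rpow_natCast, ← Real.rpow_mul hpos.le]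
  congr 2
  push_cast
  ring

lemma rieszPotential_single_eq {s t : ℝ} (hne : ∀ᵐ y ∂μ, y ≠ EuclideanSpace.single 0 t)
    (hint : Integrable (fun y ↦ axisSqDist t y ^ (-(s / 2))) μ) :
    rieszPotential s μ (EuclideanSpace.single 0 t) =
      ENNReal.ofReal (axisPotential (s / 2) μ t) := by
  rw [axisPotential, ofReal_integral_eq_lintegral_ofReal hint]
  · exact lintegral_congr_ae (hne.mono fun y hy ↦ edist_single_rpow hy)
  · refine ae_of_all _ fun y ↦ Real.rpow_nonneg ?_ _
    rw [axisSqDist_eq]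
    positivity

lemma ae_ne_of_rieszPotential_ne_top {n : ℕ} {μ : Measure (EuclideanSpace ℝ (Fin n))} {s : ℝ}
    (hs : 0 < s) {x : EuclideanSpace ℝ (Fin n)} (h : rieszPotential s μ x ≠ ∞) :
    ∀ᵐ y ∂μ, y ≠ x := by
  refine (ae_lt_top (by fun_prop) h).mono fun y hy hyx ↦ ?_
  rw [hyx, edist_self, ENNReal.zero_rpow_of_neg (by linarith)] at hy
  exact lt_irrefl _ hy

lemma integrable_of_rieszPotential_ne_top {s t : ℝ} (hs : 0 < s)
    (h : rieszPotential s μ (EuclideanSpace.single 0 t) ≠ ∞) :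
    Integrable (fun y ↦ axisSqDist t y ^ (-(s / 2))) μ := by
  have hm : Continuous fun y : EuclideanSpace ℝ (Fin (m + 2)) ↦ axisSqDist t y :=
    continuous_axisSqDist.comp (by fun_prop : Continuous fun y ↦ (t, y))
  refine ⟨(hm.measurable.pow_const _).aestronglyMeasurable, ?_⟩
  rw [hasFiniteIntegral_iff_ofReal, lt_top_iff_ne_top]
  · convert h using 1
    exact (lintegral_congr_ae ((ae_ne_of_rieszPotential_ne_top hs h).mono fun y hy ↦
      edist_single_rpow hy)).symm
  · refine ae_of_all _ fun y ↦ Real.rpow_nonneg ?_ _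
    rw [axisSqDist_eq]
    positivity

lemma axisSqDist_pos_of_ne {t : ℝ} {y : EuclideanSpace ℝ (Fin (m + 2))}
    (hy : y ≠ EuclideanSpace.single 0 t) : 0 < axisSqDist t y := by
  rw [axisSqDist_eq]
  exact pow_pos (norm_pos_iff.2 (sub_ne_zero.2 hy.symm)) 2

/-- The hypothesis bounds |a - t| by the distance from y to the axis point at t, so the triangle
inequality at most doubles that distance. With a an end of a gap, the singular kernel at a then
dominates those inside the gap. -/
lemma axisSqDist_le_four_mul {a t : ℝ} {y : EuclideanSpace ℝ (Fin (m + 2))}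
    (h : |a - t| ≤ |(‖y‖ - |t|)|) : axisSqDist a y ≤ 4 * axisSqDist t y := by
  have h1 : ‖(EuclideanSpace.single 0 a : EuclideanSpace ℝ (Fin (m + 2))) -
      EuclideanSpace.single 0 t‖ = |a - t| := by
    rw [← dist_eq_norm, PiLp.dist_single_same, Real.dist_eq]
  have h2 : |(‖y‖ - |t|)| ≤ ‖(EuclideanSpace.single 0 t : EuclideanSpace ℝ (Fin (m + 2))) - y‖ := by
    rw [norm_sub_rev]
    refine le_trans (le_of_eq ?_) (abs_norm_sub_norm_le _ _)
    simp
  have h3 := norm_sub_le_norm_sub_add_norm_sub (EuclideanSpace.single 0 a)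
    (EuclideanSpace.single 0 t) y
  rw [axisSqDist_eq, axisSqDist_eq, show (4 : ℝ) = 2 ^ 2 by norm_num, ← mul_pow]
  gcongr
  linarith

lemma axisSqDist_rpow_le {a t p : ℝ} (hp : 0 < p) {y : EuclideanSpace ℝ (Fin (m + 2))}
    (hy : y ≠ EuclideanSpace.single 0 a) (h : |a - t| ≤ |(‖y‖ - |t|)|) :
    axisSqDist t y ^ (-p) ≤ 4 ^ p * axisSqDist a y ^ (-p) := by
  have h1 := axisSqDist_pos_of_ne hy
  have h2 := axisSqDist_le_four_mul h
  calc axisSqDist t y ^ (-p) ≤ (axisSqDist a y / 4) ^ (-p) :=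
        Real.rpow_le_rpow_of_nonpos (by positivity) (by linarith) (by linarith)
    _ = 4 ^ p * axisSqDist a y ^ (-p) := by
        rw [Real.div_rpow h1.le (by norm_num), Real.rpow_neg (by norm_num : (0 : ℝ) ≤ 4),
          div_inv_eq_mul, mul_comm]

variable {r₁ r₂ R : ℝ}

/-- The ends of the gap may lie on the support, so continuity there needs domination: inner mass is
controlled by the kernel at `r₁`, outer mass by the kernel at `r₂`, both integrable by assumption.
-/
lemma continuousOn_axisPotential {p : ℝ} (hp : 0 < p) (hr₁ : 0 ≤ r₁)
    (hμ : μ {x | ‖x‖ ∈ Icc 0 r₁ ∪ Icc r₂ R}ᶜ = 0)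
    (hne₁ : ∀ᵐ y ∂μ, y ≠ EuclideanSpace.single 0 r₁)
    (hne₂ : ∀ᵐ y ∂μ, y ≠ EuclideanSpace.single 0 r₂)
    (hint₁ : Integrable (fun y ↦ axisSqDist r₁ y ^ (-p)) μ)
    (hint₂ : Integrable (fun y ↦ axisSqDist r₂ y ^ (-p)) μ) :
    ContinuousOn (axisPotential p μ) (Icc r₁ r₂) := by
  have hAe : ∀ᵐ y ∂μ, y ∈ {x : EuclideanSpace ℝ (Fin (m + 2)) | ‖x‖ ∈ Icc 0 r₁ ∪ Icc r₂ R} := hμ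
  have hnn : ∀ t (y : EuclideanSpace ℝ (Fin (m + 2))), 0 ≤ axisSqDist t y ^ (-p) := fun t y ↦ by
    rw [axisSqDist_eq]
    positivity
  refine continuousOn_of_dominated (bound := fun y ↦ 4 ^ p * (axisSqDist r₁ y ^ (-p) +
    axisSqDist r₂ y ^ (-p))) ?_ ?_ ((hint₁.add hint₂).const_mul _) ?_
  · intro t _
    have hm : Continuous fun y : EuclideanSpace ℝ (Fin (m + 2)) ↦ axisSqDist t y :=
      continuous_axisSqDist.comp (by fun_prop : Continuous fun y ↦ (t, y))
    exact (hm.measurable.pow_const _).aestronglyMeasurable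
  · intro t ht
    have ht0 : |t| = t := abs_of_nonneg (hr₁.trans ht.1)
    filter_upwards [hAe, hne₁, hne₂] with y hy hy1 hy2
    rw [Real.norm_of_nonneg (hnn t y), mul_add]
    have h1 : 0 ≤ (4 : ℝ) ^ p * axisSqDist r₁ y ^ (-p) := mul_nonneg (by positivity) (hnn _ _)
    have h2 : 0 ≤ (4 : ℝ) ^ p * axisSqDist r₂ y ^ (-p) := mul_nonneg (by positivity) (hnn _ _)
    rcases hy with hy | hy
    · have := axisSqDist_rpow_le hp hy1 (t := t) (by
        rw [ht0, abs_sub_comm, abs_of_nonneg (by linarith [ht.1]), abs_sub_comm,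
          abs_of_nonneg (by linarith [hy.2, ht.1])]
        linarith [hy.2])
      linarith
    · have := axisSqDist_rpow_le hp hy2 (t := t) (by
        rw [ht0, abs_of_nonneg (by linarith [ht.2]),
          abs_of_nonneg (by linarith [hy.1, ht.2])]
        linarith [hy.1])
      linarith
  · filter_upwards [hAe, hne₁, hne₂] with y hy hy1 hy2
    refine ContinuousOn.rpow_const ?_ fun t ht ↦ Or.inl (axisSqDist_pos_of_ne ?_).ne'
    · exact (continuous_axisSqDist.comp (by fun_prop : Continuous fun t ↦ (t, y))).continuousOn
    · rintro rfl
      have hy' : |t| ∈ Icc 0 r₁ ∪ Icc r₂ R := by simpa using hy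
      rw [abs_of_nonneg (hr₁.trans ht.1)] at hy'
      rcases hy' with hy' | hy'
      · exact hy1 (by rw [le_antisymm hy'.2 ht.1])
      · exact hy2 (by rw [le_antisymm ht.2 hy'.1])

lemma ne_abs_of_mem_gap {t : ℝ} (hr₁ : 0 ≤ r₁) (ht : t ∈ Ioo r₁ r₂) :
    ∀ y ∈ {x : EuclideanSpace ℝ (Fin (m + 2)) | ‖x‖ ∈ Icc 0 r₁ ∪ Icc r₂ R}, ‖y‖ ≠ |t| := by
  intro y hy h
  rw [abs_of_pos (hr₁.trans_lt ht.1)] at h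
  rcases hy with hy | hy
  · exact absurd hy.2 (not_le.2 (h ▸ ht.1))
  · exact absurd hy.1 (not_le.2 (h ▸ ht.2))

lemma edist_lt_edist_of_norm_lt {r t : ℝ} {y : EuclideanSpace ℝ (Fin (m + 2))} (hrt : r < t)
    (hy : ‖y‖ ≤ r) :
    edist (EuclideanSpace.single 0 r) y < edist (EuclideanSpace.single 0 t) y := by
  rw [edist_dist, edist_dist, dist_eq_norm, dist_eq_norm]
  have h0 : 0 ≤ r := (norm_nonneg y).trans hy
  have h1 : axisSqDist r y < axisSqDist t y := by
    have h2 := coord_le_norm y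
    have h3 : 0 < (t - r) * (t + r - 2 * y 0) := mul_pos (by linarith) (by linarith)
    simp only [axisSqDist]
    linarith
  rw [axisSqDist_eq, axisSqDist_eq] at h1
  have h2 := lt_of_pow_lt_pow_left₀ 2 (norm_nonneg _) h1
  exact (ENNReal.ofReal_lt_ofReal_iff ((norm_nonneg _).trans_lt h2)).2 h2

lemma rieszPotential_lt_of_inner {s : ℝ} (hs : 0 < s) {r t : ℝ} (h0 : μ ≠ 0)
    (hμ : ∀ᵐ y ∂μ, ‖y‖ ≤ r)
    (hU : rieszPotential s μ (EuclideanSpace.single 0 r) ≠ ∞) (hrt : r < t) :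
    rieszPotential s μ (EuclideanSpace.single 0 t) <
      rieszPotential s μ (EuclideanSpace.single 0 r) := by
  have hlt : ∀ᵐ y ∂μ, edist (EuclideanSpace.single 0 t) y ^ (-s) <
      edist (EuclideanSpace.single 0 r) y ^ (-s) := by
    refine hμ.mono fun y hy ↦ ?_
    rw [ENNReal.rpow_neg, ENNReal.rpow_neg, ENNReal.inv_lt_inv]
    exact ENNReal.rpow_lt_rpow (edist_lt_edist_of_norm_lt hrt hy) hs
  refine lintegral_strict_mono h0 (by fun_prop) ?_ hlt
  exact ne_top_of_le_ne_top hU (lintegral_mono_ae (hlt.mono fun y hy ↦ hy.le))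

variable [IsFiniteMeasure μ]

/-- Split μ into its parts inside and outside the gap. The two lower bounds share their constant and
add up to a positive multiple of the potential with exponent p + 1. -/
lemma axisPotentialDeriv₂_pos_of_gap {p : ℝ} (hp : 0 < p) (hpm : (m : ℝ) < 2 * p)
    (hr₁ : 0 ≤ r₁) (hinv : IsRotationInvariant μ) (h0 : μ ≠ 0)
    (hμ : μ {x | ‖x‖ ∈ Icc 0 r₁ ∪ Icc r₂ R}ᶜ = 0) {t : ℝ} (ht : t ∈ Ioo r₁ r₂) :
    0 < axisPotentialDeriv₂ p μ t := by
  have hA := isCompact_norm_preimage (n := m + 2)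
    ((isCompact_Icc (a := 0) (b := r₁)).union (isCompact_Icc (a := r₂) (b := R)))
  have htA := ne_abs_of_mem_gap (m := m) (R := R) hr₁ ht
  have hpos := axisSqDist_pos_of_abs_ne htA
  have hi : ∀ (q : ℝ) {f : EuclideanSpace ℝ (Fin (m + 2)) → ℝ}, Continuous f →
      Integrable (fun y ↦ f y * axisSqDist t y ^ q) μ :=
    fun q _ hf ↦ integrable_mul_axisSqDist_rpow q hA hμ hpos hf
  have hmeas : ∀ {S : Set ℝ}, MeasurableSet S →
      MeasurableSet {x : EuclideanSpace ℝ (Fin (m + 2)) | ‖x‖ ∈ S} := fun hS ↦ measurable_norm hS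
  have hdisj : Disjoint {x : EuclideanSpace ℝ (Fin (m + 2)) | ‖x‖ ∈ Icc 0 r₁}
      {x : EuclideanSpace ℝ (Fin (m + 2)) | ‖x‖ ∈ Icc r₂ R} := by
    rw [Set.disjoint_left]
    intro x hx hx'
    linarith [hx.2, hx'.1, ht.1, ht.2]
  have hsum : μ.restrict {x | ‖x‖ ∈ Icc 0 r₁} + μ.restrict {x | ‖x‖ ∈ Icc r₂ R} = μ := by
    rw [← Measure.restrict_union hdisj (hmeas measurableSet_Icc)]
    exact Measure.restrict_eq_self_of_ae_mem hμ
  have h1 := axisPotentialDeriv₂_ge_of_inner (μ := μ.restrict {x | ‖x‖ ∈ Icc 0 r₁}) hp hpm hr₁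
    (hinv.map_eq_restrict measurableSet_Icc)
    (ae_restrict_mem (hmeas measurableSet_Icc)) ht.1
  have h2 := axisPotentialDeriv₂_ge_of_outer (μ := μ.restrict {x | ‖x‖ ∈ Icc r₂ R}) (R := R) hp hpm
    (hinv.map_eq_restrict measurableSet_Icc)
    (ae_restrict_mem (hmeas measurableSet_Icc)) ⟨hr₁.trans_lt ht.1, ht.2⟩
  have hF2 : Integrable (fun y ↦ p * (p + 1) * (2 * t - 2 * y 0) ^ 2 * axisSqDist t y ^ (-p - 2)
      - 2 * p * axisSqDist t y ^ (-p - 1)) μ :=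
    (hi _ (by fun_prop)).sub (hi _ (by fun_prop))
  have hF0 : Integrable (fun y ↦ axisSqDist t y ^ (-(p + 1))) μ := by
    simpa using hi (-(p + 1)) (continuous_const (y := (1 : ℝ)))
  have h3 : axisPotentialDeriv₂ p μ t = axisPotentialDeriv₂ p (μ.restrict {x | ‖x‖ ∈ Icc 0 r₁}) t +
      axisPotentialDeriv₂ p (μ.restrict {x | ‖x‖ ∈ Icc r₂ R}) t := by
    unfold axisPotentialDeriv₂
    rw [← integral_add_measure hF2.restrict hF2.restrict, hsum]
  have h4 : axisPotential (p + 1) μ t = axisPotential (p + 1) (μ.restrict {x | ‖x‖ ∈ Icc 0 r₁}) t +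
      axisPotential (p + 1) (μ.restrict {x | ‖x‖ ∈ Icc r₂ R}) t := by
    unfold axisPotential
    rw [← integral_add_measure hF0.restrict hF0.restrict, hsum]
  have h5 := axisPotential_pos (p + 1) hA hμ h0 htA
  have h6 : 0 < 2 * p * (2 * p - m) / (m + 2) := by
    have : 0 < 2 * p - m := by linarith
    positivity
  have h7 := mul_pos h6 h5
  rw [h4, mul_add] at h7
  linarith

/-- A rotation invariant Riesz potential is a strictly convex function of the radius across a gap
of the support. -/
lemma strictConvexOn_axisPotential {p : ℝ} (hp : 0 < p) (hpm : (m : ℝ) < 2 * p)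
    (hr₁ : 0 ≤ r₁) (hinv : IsRotationInvariant μ) (h0 : μ ≠ 0)
    (hμ : μ {x | ‖x‖ ∈ Icc 0 r₁ ∪ Icc r₂ R}ᶜ = 0)
    (hne₁ : ∀ᵐ y ∂μ, y ≠ EuclideanSpace.single 0 r₁)
    (hne₂ : ∀ᵐ y ∂μ, y ≠ EuclideanSpace.single 0 r₂)
    (hint₁ : Integrable (fun y ↦ axisSqDist r₁ y ^ (-p)) μ)
    (hint₂ : Integrable (fun y ↦ axisSqDist r₂ y ^ (-p)) μ) :
    StrictConvexOn ℝ (Icc r₁ r₂) (axisPotential p μ) := by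
  have hA := isCompact_norm_preimage (n := m + 2)
    ((isCompact_Icc (a := 0) (b := r₁)).union (isCompact_Icc (a := r₂) (b := R)))
  have hIA : ∀ t ∈ Ioo r₁ r₂, ∀ y ∈ {x : EuclideanSpace ℝ (Fin (m + 2)) |
      ‖x‖ ∈ Icc 0 r₁ ∪ Icc r₂ R}, 0 < axisSqDist t y :=
    fun t ht ↦ axisSqDist_pos_of_abs_ne (ne_abs_of_mem_gap hr₁ ht)
  refine strictConvexOn_of_deriv2_pos (convex_Icc _ _)
    (continuousOn_axisPotential hp hr₁ hμ hne₁ hne₂ hint₁ hint₂) fun t ht ↦ ?_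
  rw [interior_Icc] at ht
  have h1 : deriv (axisPotential p μ) =ᶠ[𝓝 t] axisPotentialDeriv p μ := by
    filter_upwards [isOpen_Ioo.mem_nhds ht] with x hx
    exact (hasDerivAt_axisPotential p hA hμ isOpen_Ioo hIA hx).deriv
  have h2 : deriv^[2] (axisPotential p μ) t = axisPotentialDeriv₂ p μ t := by
    simp only [Function.iterate_succ, Function.iterate_zero, Function.comp_apply, id_eq]
    rw [h1.deriv_eq]
    exact (hasDerivAt_axisPotentialDeriv p hA hμ isOpen_Ioo hIA ht).deriv
  rw [h2]
  exact axisPotentialDeriv₂_pos_of_gap hp hpm hr₁ hinv h0 hμ ht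

lemma integrable_of_mem_gap {p t : ℝ} (hr₁ : 0 ≤ r₁)
    (hμ : μ {x | ‖x‖ ∈ Icc 0 r₁ ∪ Icc r₂ R}ᶜ = 0) (ht : t ∈ Ioo r₁ r₂) :
    Integrable (fun y ↦ axisSqDist t y ^ (-p)) μ := by
  have hA := isCompact_norm_preimage (n := m + 2)
    ((isCompact_Icc (a := 0) (b := r₁)).union (isCompact_Icc (a := r₂) (b := R)))
  simpa using integrable_mul_axisSqDist_rpow (-p) hA hμ
    (axisSqDist_pos_of_abs_ne (ne_abs_of_mem_gap hr₁ ht)) (continuous_const (y := (1 : ℝ)))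

lemma rieszPotential_lt_of_gap {s : ℝ} (hs : 0 < s) (hsm : (m : ℝ) < s)
    (hr₁ : 0 ≤ r₁) (hr : r₁ < r₂) (hinv : IsRotationInvariant μ) (h0 : μ ≠ 0)
    (hμ : μ {x | ‖x‖ ∈ Icc 0 r₁ ∪ Icc r₂ R}ᶜ = 0)
    (hU₁ : rieszPotential s μ (EuclideanSpace.single 0 r₁) ≠ ∞)
    (hU₂ : rieszPotential s μ (EuclideanSpace.single 0 r₂) ≠ ∞) {a b : ℝ≥0}
    (ha : 0 < a) (hb : 0 < b) (hab : a + b = 1) :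
    rieszPotential s μ (EuclideanSpace.single 0 (a * r₁ + b * r₂)) <
      a * rieszPotential s μ (EuclideanSpace.single 0 r₁) +
      b * rieszPotential s μ (EuclideanSpace.single 0 r₂) := by
  have hab' : (a : ℝ) + b = 1 := by exact_mod_cast hab
  have hi₁ := integrable_of_rieszPotential_ne_top hs hU₁
  have hi₂ := integrable_of_rieszPotential_ne_top hs hU₂
  have hne₁ := ae_ne_of_rieszPotential_ne_top hs hU₁
  have hne₂ := ae_ne_of_rieszPotential_ne_top hs hU₂
  have ha' : (0 : ℝ) < a := ha
  have hb' : (0 : ℝ) < b := hb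
  have ht : (a : ℝ) * r₁ + b * r₂ ∈ Ioo r₁ r₂ := by
    have h1 : (a : ℝ) = 1 - b := by linarith
    constructor
    · rw [h1]
      nlinarith
    · have h2 : (b : ℝ) = 1 - a := by linarith
      rw [h2]
      nlinarith
  have hAe : ∀ᵐ y ∂μ, y ∈ {x : EuclideanSpace ℝ (Fin (m + 2)) |
      ‖x‖ ∈ Icc 0 r₁ ∪ Icc r₂ R} := hμ
  have hne : ∀ᵐ y ∂μ, y ≠ EuclideanSpace.single 0 ((a : ℝ) * r₁ + b * r₂) := by
    refine hAe.mono fun y hy h ↦ ne_abs_of_mem_gap hr₁ ht y hy ?_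
    simp [h]
  have hconv := (strictConvexOn_axisPotential (p := s / 2) (by linarith) (by linarith) hr₁ hinv h0
    hμ hne₁ hne₂ hi₁ hi₂).2 (left_mem_Icc.2 hr.le) (right_mem_Icc.2 hr.le) hr.ne ha' hb' hab'
  rw [rieszPotential_single_eq hne (integrable_of_mem_gap hr₁ hμ ht),
    rieszPotential_single_eq hne₁ hi₁, rieszPotential_single_eq hne₂ hi₂,
    ← ENNReal.ofReal_coe_nnreal, ← ENNReal.ofReal_coe_nnreal, ← ENNReal.ofReal_mul ha'.le,
    ← ENNReal.ofReal_mul hb'.le, ← ENNReal.ofReal_add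
      (mul_nonneg ha'.le (axisPotential_nonneg _ _ _))
      (mul_nonneg hb'.le (axisPotential_nonneg _ _ _))]
  exact (ENNReal.ofReal_lt_ofReal_iff_of_nonneg (axisPotential_nonneg _ _ _)).2 hconv

/-- On [0, r] the potential u is monotone and strictly convex, so u(t) < (1 - t/r) u(0) + (t/r) u(r)
≤ u(r). -/
lemma rieszPotential_lt_of_outer {s : ℝ} (hs : 0 < s) (hsm : (m : ℝ) < s)
    {r t : ℝ} (hinv : IsRotationInvariant μ) (h0 : μ ≠ 0)
    (hμ : μ {x | ‖x‖ ∈ Icc r R}ᶜ = 0)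
    (hU : rieszPotential s μ (EuclideanSpace.single 0 r) ≠ ∞) (ht : t ∈ Ioo 0 r) :
    rieszPotential s μ (EuclideanSpace.single 0 t) <
      rieszPotential s μ (EuclideanSpace.single 0 r) := by
  have hr : 0 < r := ht.1.trans ht.2
  have hi₂ := integrable_of_rieszPotential_ne_top hs hU
  have hne₂ := ae_ne_of_rieszPotential_ne_top hs hU
  have hA := isCompact_norm_preimage (n := m + 2) (isCompact_Icc (a := r) (b := R))
  -- The ball free of mass counts as a gap with the degenerate inner part {0}.
  have hμ' : μ {x | ‖x‖ ∈ Icc 0 0 ∪ Icc r R}ᶜ = 0 :=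
    measure_mono_null (compl_subset_compl.2 fun x hx ↦ Or.inr hx) hμ
  have hAe : ∀ᵐ y ∂μ, y ∈ {x : EuclideanSpace ℝ (Fin (m + 2)) | ‖x‖ ∈ Icc r R} := hμ
  have hIA : ∀ t ∈ Ioo (-r) r, ∀ y ∈ {x : EuclideanSpace ℝ (Fin (m + 2)) | ‖x‖ ∈ Icc r R},
      0 < axisSqDist t y := fun t ht ↦ axisSqDist_pos_of_abs_ne (abs_notMem_of_lt ht)
  have hi : ∀ x ∈ Ioo (-r) r, Integrable (fun y ↦ axisSqDist x y ^ (-(s / 2))) μ := fun x hx ↦ by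
    simpa using integrable_mul_axisSqDist_rpow (-(s / 2)) hA hμ (hIA x hx)
      (continuous_const (y := (1 : ℝ)))
  have hne : ∀ x ∈ Ioo (-r) r, ∀ᵐ y ∂μ, y ≠ EuclideanSpace.single 0 x := fun x hx ↦
    hAe.mono fun y hy h ↦ abs_notMem_of_lt hx y hy (by simp [h])
  have h0r : (0 : ℝ) ∈ Ioo (-r) r := ⟨by linarith, hr⟩
  have htr : t ∈ Ioo (-r) r := ⟨by linarith [ht.1], ht.2⟩
  have hmono : MonotoneOn (axisPotential (s / 2) μ) (Icc 0 r) := by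
    have hd : ∀ x ∈ Ioo 0 r, HasDerivAt (axisPotential (s / 2) μ)
        (axisPotentialDeriv (s / 2) μ x) x := fun x hx ↦
      hasDerivAt_axisPotential _ hA hμ isOpen_Ioo hIA ⟨by linarith [hx.1], hx.2⟩
    refine monotoneOn_of_deriv_nonneg (convex_Icc 0 r)
      (continuousOn_axisPotential (by linarith) le_rfl hμ' (hne 0 h0r) hne₂ (hi 0 h0r) hi₂) ?_ ?_
    · rw [interior_Icc]
      exact fun x hx ↦ (hd x hx).differentiableAt.differentiableWithinAt
    · rw [interior_Icc]
      intro x hx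
      rw [(hd x hx).deriv]
      exact axisPotentialDeriv_nonneg_of_outer (by linarith) (by linarith) hinv hμ hx
  have hconv := strictConvexOn_axisPotential (p := s / 2) (by linarith) (by linarith) le_rfl hinv h0
    hμ' (hne 0 h0r) hne₂ (hi 0 h0r) hi₂
  have h1 := hconv.2 (left_mem_Icc.2 hr.le) (right_mem_Icc.2 hr.le) hr.ne
    (show 0 < 1 - t / r by rw [sub_pos, div_lt_one hr]; exact ht.2)
    (div_pos ht.1 hr) (by ring)
  have h2 := hmono (left_mem_Icc.2 hr.le) (right_mem_Icc.2 hr.le) hr.le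
  simp only [smul_eq_mul, mul_zero, zero_add, div_mul_cancel₀ _ hr.ne'] at h1
  have h3 : 0 ≤ 1 - t / r := by rw [sub_nonneg, div_le_one hr]; exact ht.2.le
  have h4 := mul_le_mul_of_nonneg_left h2 h3
  rw [rieszPotential_single_eq (hne t htr) (hi t htr), rieszPotential_single_eq hne₂ hi₂]
  refine (ENNReal.ofReal_lt_ofReal_iff_of_nonneg (axisPotential_nonneg _ _ _)).2 ?_
  linarith

end GapConvexity

/-! ### The cusp of the potential of a sphere -/

section Sphere

open Set Filter Topology Metric

lemma volume_shell_le {n : ℕ} (hn : 0 < n) {r δ : ℝ} (hδ : 0 < δ) (hδr : δ < r) :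
    volume {z : EuclideanSpace ℝ (Fin n) | ‖z‖ ∈ Ioo (r - δ) (r + δ)} ≤
      ENNReal.ofReal (2 * δ * n * (2 * r) ^ (n - 1)) *
        volume (ball (0 : EuclideanSpace ℝ (Fin n)) 1) := by
  have : Nonempty (Fin n) := ⟨⟨0, hn⟩⟩
  have h1 : {z : EuclideanSpace ℝ (Fin n) | ‖z‖ ∈ Ioo (r - δ) (r + δ)} =
      ball 0 (r + δ) \ closedBall 0 (r - δ) := by
    ext z
    simp [and_comm]
  rw [h1, measure_sdiff (closedBall_subset_ball (by linarith))
    measurableSet_closedBall.nullMeasurableSet measure_closedBall_lt_top.ne,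
    Measure.addHaar_ball _ _ (by linarith), Measure.addHaar_closedBall _ _ (by linarith),
    ← ENNReal.sub_mul fun _ _ ↦ measure_ball_lt_top.ne,
    ← ENNReal.ofReal_sub _ (pow_nonneg (by linarith) _)]
  gcongr
  rw [finrank_euclideanSpace, Fintype.card_fin]
  refine (le_abs_self _).trans ((abs_pow_sub_pow_le _ _ _).trans ?_)
  rw [show r + δ - (r - δ) = 2 * δ by ring, abs_of_pos (by positivity)]
  gcongr
  rw [abs_of_pos (by linarith), abs_of_pos (by linarith)]
  exact max_le (by linarith) (by linarith)

variable {m : ℕ} {μ : Measure (EuclideanSpace ℝ (Fin (m + 2)))} [IsProbabilityMeasure μ]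

lemma IsRotationInvariant.measure_closedBall_eq {n : ℕ} {μ : Measure (EuclideanSpace ℝ (Fin n))}
    (hinv : IsRotationInvariant μ) {x y : EuclideanSpace ℝ (Fin n)} (h : ‖x‖ = ‖y‖) (δ : ℝ) :
    μ (closedBall x δ) = μ (closedBall y δ) := by
  obtain ⟨R, rfl⟩ := exists_linearIsometryEquiv_eq h
  conv_rhs => rw [← hinv R]
  rw [Measure.map_apply R.continuous.measurable measurableSet_closedBall]
  simp

/-- A rotation invariant probability measure on a sphere has at least the mass of surface measure
on small balls. -/
lemma volume_ball_le_measure_mul_volume_shell {r δ : ℝ} (hδ : 0 < δ) (hδr : δ < r)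
    (hinv : IsRotationInvariant μ) (hμ : ∀ᵐ y ∂μ, ‖y‖ = r) :
    volume (ball (0 : EuclideanSpace ℝ (Fin (m + 2))) δ) ≤
      μ (closedBall (EuclideanSpace.single 0 r) (3 * δ)) *
        volume {z : EuclideanSpace ℝ (Fin (m + 2)) | ‖z‖ ∈ Ioo (r - δ) (r + δ)} := by
  set S := {z : EuclideanSpace ℝ (Fin (m + 2)) | ‖z‖ ∈ Ioo (r - δ) (r + δ)} with hS
  have hSm : MeasurableSet S := measurable_norm measurableSet_Ioo
  have hr : 0 < r := hδ.trans hδr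
  -- Double counting of the pairs (z, y) at distance at most 2δ, with z in the shell under Lebesgue
  -- measure and y under μ.
  set D := {p : EuclideanSpace ℝ (Fin (m + 2)) × EuclideanSpace ℝ (Fin (m + 2)) |
    dist p.1 p.2 ≤ 2 * δ} with hD
  have hDm : MeasurableSet D := measurableSet_le (by fun_prop) measurable_const
  have h1 : (volume.restrict S).prod μ D = ∫⁻ z in S, μ (closedBall z (2 * δ)) := by
    rw [Measure.prod_apply hDm]
    refine lintegral_congr fun z ↦ ?_
    congr 1
    ext y
    simp [hD, dist_comm]
  have h2 : (volume.restrict S).prod μ D =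
      ∫⁻ y, (volume.restrict S) (closedBall y (2 * δ)) ∂μ := by
    rw [Measure.prod_apply_symm hDm]
    rfl
  have h3 : volume (ball (0 : EuclideanSpace ℝ (Fin (m + 2))) δ) ≤
      ∫⁻ y, (volume.restrict S) (closedBall y (2 * δ)) ∂μ := by
    have : ∀ᵐ y ∂μ, volume (ball (0 : EuclideanSpace ℝ (Fin (m + 2))) δ) ≤
        (volume.restrict S) (closedBall y (2 * δ)) := by
      refine hμ.mono fun y hy ↦ ?_
      rw [Measure.restrict_apply measurableSet_closedBall,
        ← Measure.addHaar_ball_center volume y δ]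
      refine measure_mono fun z hz ↦ ⟨?_, ?_⟩
      · exact ball_subset_closedBall (ball_subset_ball (by linarith) hz)
      · rw [mem_ball, dist_eq_norm] at hz
        have := (abs_norm_sub_norm_le z y).trans_lt hz
        rw [hy, abs_lt] at this
        exact ⟨by linarith, by linarith⟩
    refine le_trans ?_ (lintegral_mono_ae this)
    simp
  -- Radial projection to the sphere moves z by less than δ, which enlarges 2δ to 3δ. Rotation
  -- invariance then makes the centre irrelevant.
  have h4 : ∫⁻ z in S, μ (closedBall z (2 * δ)) ≤
      ∫⁻ _ in S, μ (closedBall (EuclideanSpace.single 0 r) (3 * δ)) := by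
    refine setLIntegral_mono' hSm fun z hz ↦ ?_
    have hz0 : 0 < ‖z‖ := by linarith [hz.1]
    have hx : ‖(r / ‖z‖) • z‖ = ‖(EuclideanSpace.single 0 r : EuclideanSpace ℝ (Fin (m + 2)))‖ := by
      rw [norm_smul, norm_div, norm_norm, div_mul_cancel₀ _ hz0.ne']
      simp
    rw [← hinv.measure_closedBall_eq hx]
    refine measure_mono (closedBall_subset_closedBall' ?_)
    have h5 : dist z ((r / ‖z‖) • z) = |‖z‖ - r| := by
      rw [dist_eq_norm]
      nth_rewrite 1 [← one_smul ℝ z]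
      rw [← sub_smul, norm_smul, Real.norm_eq_abs, ← abs_of_pos hz0, ← abs_mul, abs_of_pos hz0,
        sub_mul, div_mul_cancel₀ _ hz0.ne', one_mul]
    have h6 : |‖z‖ - r| < δ := abs_lt.2 ⟨by linarith [hz.1], by linarith [hz.2]⟩
    rw [h5]
    linarith
  rw [setLIntegral_const] at h4
  exact h3.trans (h2 ▸ h1 ▸ h4)

/-- A ball has volume of order δ^(m+2) and the shell at most of order δ; the quotient gives the
exponent m + 1. -/
lemma exists_pow_le_measure_closedBall {r : ℝ} (hr : 0 < r)
    (hinv : IsRotationInvariant μ) (hμ : ∀ᵐ y ∂μ, ‖y‖ = r) :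
    ∃ c > 0, ∀ δ, 0 < δ → δ < r → c * δ ^ (m + 1) ≤
      μ.real (closedBall (EuclideanSpace.single 0 r) δ) := by
  set K : ℝ := 2 * (m + 2) * (2 * r) ^ (m + 1) with hK
  have hK0 : 0 < K := by positivity
  refine ⟨1 / (3 ^ (m + 1) * K), by positivity, fun δ hδ hδr ↦ ?_⟩
  have h1 := volume_ball_le_measure_mul_volume_shell (μ := μ) (r := r) (δ := δ / 3) (by positivity)
    (by linarith) hinv hμ
  have h2 := volume_shell_le (n := m + 2) (by omega) (r := r) (δ := δ / 3) (by positivity)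
    (by linarith)
  have h3 := h1.trans (mul_le_mul_right h2 _)
  rw [Measure.addHaar_ball _ _ (by positivity), ← mul_assoc,
    ENNReal.mul_le_mul_iff_left (measure_ball_pos _ _ one_pos).ne' measure_ball_lt_top.ne,
    show 3 * (δ / 3) = δ by ring, finrank_euclideanSpace, Fintype.card_fin,
    ← ofReal_measureReal, ← ENNReal.ofReal_mul measureReal_nonneg,
    ENNReal.ofReal_le_ofReal_iff (by positivity)] at h3
  have h4 : (δ / 3) ^ (m + 2) = (δ / 3) * (δ ^ (m + 1) / 3 ^ (m + 1)) := by
    rw [pow_succ', div_pow]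
  have h5 : 2 * (δ / 3) * ((m + 2 : ℕ) : ℝ) * (2 * r) ^ (m + 2 - 1) = (δ / 3) * K := by
    rw [hK, show m + 2 - 1 = m + 1 by omega]
    push_cast
    ring
  rw [h4, h5, mul_left_comm, mul_le_mul_iff_right₀ (by positivity)] at h3
  rw [div_le_iff₀ (by positivity)] at h3
  rw [div_mul_eq_mul_div, one_mul, div_le_iff₀ (by positivity)]
  linarith

/-- This identity drives the cusp: apart from the smooth factor r/r₀, leaving the sphere adds (r -
r₀)² to every squared distance. -/
lemma axisSqDist_eq_of_norm_eq {r r₀ : ℝ} (hr₀ : r₀ ≠ 0) {y : EuclideanSpace ℝ (Fin (m + 2))}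
    (hy : ‖y‖ = r₀) : axisSqDist r y = r / r₀ * axisSqDist r₀ y + (r - r₀) ^ 2 := by
  simp only [axisSqDist, hy]
  field_simp
  ring

/-- The potential of the uniform distribution of a sphere has a cusp at the sphere. -/
lemma axisPotential_le_of_sphere {p r r₀ : ℝ} (hp : 0 < p) (hr₀ : 0 < r₀) (hr : 0 < r)
    (hr2 : r ≤ 2 * r₀) (hrne : r ≠ r₀) (hμ : ∀ᵐ y ∂μ, ‖y‖ = r₀)
    (hne : ∀ᵐ y ∂μ, y ≠ EuclideanSpace.single 0 r₀)
    (hint : Integrable (fun y ↦ axisSqDist r₀ y ^ (-p)) μ) :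
    Integrable (fun y ↦ axisSqDist r y ^ (-p)) μ ∧
    axisPotential p μ r ≤ (r / r₀) ^ (-p) * axisPotential p μ r₀ -
      2 ^ (-p) * (1 - (3 / 2) ^ (-p)) * ((r - r₀) ^ 2) ^ (-p) *
        μ.real (closedBall (EuclideanSpace.single 0 r₀) |r - r₀|) := by
  set κ := r / r₀ with hκ
  have hκ0 : 0 < κ := by positivity
  have hκ2 : κ ≤ 2 := by rwa [hκ, div_le_iff₀ hr₀]
  set B := closedBall (EuclideanSpace.single 0 r₀ : EuclideanSpace ℝ (Fin (m + 2))) |r - r₀| with hB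
  have hd : 0 < (r - r₀) ^ 2 := by
    have := sub_ne_zero.2 hrne
    positivity
  have hc0 : (3 / 2 : ℝ) ^ (-p) ≤ 1 :=
    Real.rpow_le_one_of_one_le_of_nonpos (by norm_num) (by linarith)
  have hpt : ∀ᵐ y ∂μ, axisSqDist r y ^ (-p) ≤ κ ^ (-p) * axisSqDist r₀ y ^ (-p) -
      B.indicator (fun _ ↦ 2 ^ (-p) * (1 - (3 / 2) ^ (-p)) * ((r - r₀) ^ 2) ^ (-p)) y := by
    filter_upwards [hμ, hne] with y hy hyne
    have hg := axisSqDist_pos_of_ne hyne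
    have hgr := axisSqDist_eq_of_norm_eq (r := r) hr₀.ne' hy
    rw [← hκ] at hgr
    by_cases hyB : y ∈ B
    · rw [indicator_of_mem hyB]
      have hle : axisSqDist r₀ y ≤ (r - r₀) ^ 2 := by
        rw [axisSqDist_eq, ← sq_abs (r - r₀), norm_sub_rev, ← dist_eq_norm]
        gcongr
        exact hyB
      -- Inside `B` the added (r - r₀)² is at least `axisSqDist r₀ y`, hence at least κ/2 times it
      -- because κ ≤ 2. This is the origin of 3/2.
      have h1 : κ * (3 / 2) * axisSqDist r₀ y ≤ axisSqDist r y := by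
        rw [hgr]
        nlinarith
      have h2 : axisSqDist r y ^ (-p) ≤
          κ ^ (-p) * (3 / 2) ^ (-p) * axisSqDist r₀ y ^ (-p) := by
        rw [← Real.mul_rpow hκ0.le (by norm_num), ← Real.mul_rpow (by positivity) hg.le]
        exact Real.rpow_le_rpow_of_nonpos (by positivity) h1 (by linarith)
      have h3 : ((r - r₀) ^ 2) ^ (-p) ≤ axisSqDist r₀ y ^ (-p) :=
        Real.rpow_le_rpow_of_nonpos hg hle (by linarith)
      have h4 : (2 : ℝ) ^ (-p) ≤ κ ^ (-p) := Real.rpow_le_rpow_of_nonpos hκ0 hκ2 (by linarith)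
      have h5 : 2 ^ (-p) * (1 - (3 / 2) ^ (-p)) * ((r - r₀) ^ 2) ^ (-p) ≤
          κ ^ (-p) * (1 - (3 / 2) ^ (-p)) * axisSqDist r₀ y ^ (-p) := by
        have : 0 ≤ 1 - (3 / 2 : ℝ) ^ (-p) := by linarith
        gcongr
      linarith
    · rw [indicator_of_notMem hyB, sub_zero, ← Real.mul_rpow hκ0.le hg.le]
      exact Real.rpow_le_rpow_of_nonpos (by positivity) (by rw [hgr]; linarith) (by linarith)
  have hBint : Integrable (B.indicator fun _ : EuclideanSpace ℝ (Fin (m + 2)) ↦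
      (2 : ℝ) ^ (-p) * (1 - (3 / 2) ^ (-p)) * ((r - r₀) ^ 2) ^ (-p)) μ :=
    (integrable_const _).indicator measurableSet_closedBall
  have hm : Continuous fun y : EuclideanSpace ℝ (Fin (m + 2)) ↦ axisSqDist r y :=
    continuous_axisSqDist.comp (by fun_prop : Continuous fun y ↦ (r, y))
  have hint' : Integrable (fun y ↦ axisSqDist r y ^ (-p)) μ := by
    refine ((hint.const_mul (κ ^ (-p))).sub hBint).mono'
      (hm.measurable.pow_const _).aestronglyMeasurable (hpt.mono fun y hy ↦ ?_)
    rw [Real.norm_of_nonneg (Real.rpow_nonneg (by rw [axisSqDist_eq]; positivity) _)]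
    exact hy
  refine ⟨hint', ?_⟩
  have h := integral_mono_ae hint' ((hint.const_mul (κ ^ (-p))).sub hBint) hpt
  refine h.trans (le_of_eq ?_)
  simp only [Pi.sub_apply]
  rw [integral_sub (hint.const_mul (κ ^ (-p))) hBint, integral_const_mul,
    integral_indicator_const _ measurableSet_closedBall, smul_eq_mul, mul_comm (μ.real B)]
  rfl

/-- With δ = |r - r₀|, the factor (r/r₀)^(-p) costs O(δ), while the mass of the ball of radius δ
yields a drop of order δ^(m+1-2p). As 2p > m, that exponent is below 1 and the drop beats any linear
term. -/
lemma eventually_axisPotential_lt {p r₀ : ℝ} (hp : 0 < p) (hpm : (m : ℝ) < 2 * p) (hr₀ : 0 < r₀)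
    (hinv : IsRotationInvariant μ) (hμ : ∀ᵐ y ∂μ, ‖y‖ = r₀)
    (hne : ∀ᵐ y ∂μ, y ≠ EuclideanSpace.single 0 r₀)
    (hint : Integrable (fun y ↦ axisSqDist r₀ y ^ (-p)) μ) (L : ℝ) :
    ∀ᶠ r in 𝓝[≠] r₀, axisPotential p μ r < axisPotential p μ r₀ - L * |r - r₀| := by
  obtain ⟨c, hc, hball⟩ := exists_pow_le_measure_closedBall hr₀ hinv hμ
  have hO : (fun r ↦ (r / r₀) ^ (-p) - 1) =O[𝓝 r₀] fun r ↦ r - r₀ := by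
    have hd : HasDerivAt (fun r ↦ (r / r₀) ^ (-p)) (1 / r₀ * (-p) * (r₀ / r₀) ^ (-p - 1)) r₀ :=
      ((hasDerivAt_id r₀).div_const r₀).rpow_const (Or.inl (by simp [hr₀.ne']))
    have := hd.isBigO_sub
    simpa [div_self hr₀.ne'] using this
  obtain ⟨C, hC⟩ := hO.bound
  set c₁ : ℝ := 2 ^ (-p) * (1 - (3 / 2) ^ (-p)) with hc₁
  have hc₁0 : 0 < c₁ := by
    have : (3 / 2 : ℝ) ^ (-p) < 1 := Real.rpow_lt_one_of_one_lt_of_neg (by norm_num) (by linarith)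
    have h2 : 0 < 1 - (3 / 2 : ℝ) ^ (-p) := by linarith
    positivity
  set u₀ := axisPotential p μ r₀ with hu₀
  have hu₀0 : 0 ≤ u₀ := axisPotential_nonneg _ _ _
  have hlim : Tendsto (fun r ↦ (C * u₀ + L) * |r - r₀| ^ (2 * p - m)) (𝓝 r₀) (𝓝 0) := by
    have h1 : ContinuousAt (fun r : ℝ ↦ (C * u₀ + L) * |r - r₀| ^ (2 * p - m)) r₀ := by
      refine ContinuousAt.mul continuousAt_const (ContinuousAt.rpow_const (by fun_prop) ?_)
      right
      linarith
    have h2 := h1.tendsto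
    rw [sub_self, abs_zero, Real.zero_rpow (by linarith), mul_zero] at h2
    exact h2
  have hev := hlim.eventually (gt_mem_nhds (mul_pos hc₁0 hc))
  filter_upwards [self_mem_nhdsWithin, nhdsWithin_le_nhds hC, nhdsWithin_le_nhds hev,
    nhdsWithin_le_nhds (Ioo_mem_nhds (by linarith : r₀ / 2 < r₀) (by linarith : r₀ < 2 * r₀)),
    nhdsWithin_le_nhds (ball_mem_nhds r₀ hr₀)] with r hrne hCr hr hrI hrb
  have hδ0 : 0 < |r - r₀| := abs_pos.2 (sub_ne_zero.2 hrne)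
  set δ := |r - r₀| with hδ
  have h1 := (axisPotential_le_of_sphere hp hr₀ (by linarith [hrI.1]) hrI.2.le hrne hμ hne hint).2
  have h2 := hball δ hδ0 (by rw [mem_ball, Real.dist_eq] at hrb; exact hrb)
  have h3 : ((r - r₀) ^ 2) ^ (-p) = δ ^ (-(2 * p)) := by
    rw [← sq_abs, ← Real.rpow_natCast, ← Real.rpow_mul hδ0.le]
    congr 1
    push_cast
    ring
  have h4 : (r / r₀) ^ (-p) ≤ 1 + C * δ := by
    rw [Real.norm_eq_abs, Real.norm_eq_abs] at hCr
    linarith [le_abs_self ((r / r₀) ^ (-p) - 1)]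
  rw [← hc₁, h3] at h1
  have h5 : c₁ * δ ^ (-(2 * p)) * (c * δ ^ (m + 1)) ≤ c₁ * δ ^ (-(2 * p)) *
      μ.real (closedBall (EuclideanSpace.single 0 r₀) δ) := by gcongr
  have h6 : c₁ * δ ^ (-(2 * p)) * (c * δ ^ (m + 1)) * δ ^ (2 * p - m) = c₁ * c * δ := by
    have : δ ^ (-(2 * p)) * δ ^ (m + 1) * δ ^ (2 * p - m) = δ := by
      rw [← Real.rpow_natCast, ← Real.rpow_add hδ0, ← Real.rpow_add hδ0]
      conv_rhs => rw [← Real.rpow_one δ]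
      congr 1
      push_cast
      ring
    calc _ = c₁ * c * (δ ^ (-(2 * p)) * δ ^ (m + 1) * δ ^ (2 * p - m)) := by ring
      _ = _ := by rw [this]
  have h7 : 0 < δ ^ (2 * p - m) := Real.rpow_pos_of_pos hδ0 _
  have h8 : (C * u₀ + L) * δ < c₁ * δ ^ (-(2 * p)) * (c * δ ^ (m + 1)) := by
    refine lt_of_mul_lt_mul_right ?_ h7.le
    rw [h6]
    calc (C * u₀ + L) * δ * δ ^ (2 * p - m) = ((C * u₀ + L) * δ ^ (2 * p - m)) * δ := by ring
      _ < c₁ * c * δ := by gcongr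
  have h9 : (r / r₀) ^ (-p) * u₀ ≤ (1 + C * δ) * u₀ := by gcongr
  linarith

end Sphere

/-! ### The support for a convex radial field on a ball -/

section RadialField

open Set Filter Topology Metric

lemma ConvexOn.ennreal_le {q : ℝ → ℝ≥0∞} {K : Set ℝ} (hq : ConvexOn ℝ≥0 K q) {x y : ℝ}
    (hx : x ∈ K) (hy : y ∈ K) {a b : ℝ≥0} (hab : a + b = 1) :
    q (a * x + b * y) ≤ a * q x + b * q y := by
  simpa [NNReal.smul_def, ENNReal.smul_def] using hq.2 hx hy zero_le zero_le hab

lemma exists_nnreal_combo {r₁ r₂ r : ℝ} (hr : r ∈ Ioo r₁ r₂) :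
    ∃ a b : ℝ≥0, 0 < a ∧ 0 < b ∧ a + b = 1 ∧ r = a * r₁ + b * r₂ := by
  have h1 : 0 < r₂ - r := sub_pos.2 hr.2
  have h2 : 0 < r - r₁ := sub_pos.2 hr.1
  have h3 : 0 < r₂ - r₁ := by linarith
  refine ⟨⟨(r₂ - r) / (r₂ - r₁), by positivity⟩, ⟨(r - r₁) / (r₂ - r₁), by positivity⟩,
    div_pos h1 h3, div_pos h2 h3, ?_, ?_⟩
  · apply NNReal.eq
    change (r₂ - r) / (r₂ - r₁) + (r - r₁) / (r₂ - r₁) = 1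
    field_simp
    ring
  · change r = (r₂ - r) / (r₂ - r₁) * r₁ + (r - r₁) / (r₂ - r₁) * r₂
    field_simp
    ring

variable {m : ℕ}

lemma isOpen_shell (n : ℕ) (t₁ t₂ : ℝ) :
    IsOpen {x : EuclideanSpace ℝ (Fin n) | ‖x‖ ∈ Ioo t₁ t₂} :=
  isOpen_Ioo.preimage continuous_norm

lemma volume_shell_pos {t₁ t₂ : ℝ} (h0 : 0 ≤ t₁) (h : t₁ < t₂) :
    0 < volume {x : EuclideanSpace ℝ (Fin (m + 2)) | ‖x‖ ∈ Ioo t₁ t₂} := by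
  refine (isOpen_shell _ _ _).measure_pos _ ⟨EuclideanSpace.single 0 ((t₁ + t₂) / 2), ?_⟩
  have : ‖(EuclideanSpace.single 0 ((t₁ + t₂) / 2) : EuclideanSpace ℝ (Fin (m + 2)))‖ =
      (t₁ + t₂) / 2 := by
    rw [PiLp.norm_single, Real.norm_of_nonneg (by linarith)]
  rw [mem_ofPred_eq, this]
  exact ⟨by linarith, by linarith⟩

lemma shell_subset_closedBall {n : ℕ} {t₁ t₂ : ℝ} (h : t₂ ≤ 1) :
    {x : EuclideanSpace ℝ (Fin n) | ‖x‖ ∈ Ioo t₁ t₂} ⊆ closedBall 0 1 := fun x hx ↦ by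
  rw [mem_closedBall_zero_iff]
  exact hx.2.le.trans h

variable {s : ℝ} {Q : EuclideanSpace ℝ (Fin (m + 2)) → ℝ≥0∞} {q : ℝ → ℝ≥0∞}

/-- Normalised Lebesgue measure on the shell between the two radii is a competitor: s < m + 2 makes
its energy finite, and convexity bounds the field on the shell by `q ρ₁ + q ρ₂`. -/
lemma minWeightedEnergy_ne_top (hsn : s < m + 2) (hrot : ∀ x, ‖x‖ ≤ 1 → Q x = q ‖x‖)
    (hconv : ConvexOn ℝ≥0 (Icc (0 : ℝ) 1) q) {ρ₁ ρ₂ : ℝ} (hρ₁ : 0 ≤ ρ₁) (hρ : ρ₁ < ρ₂)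
    (hρ₂ : ρ₂ ≤ 1) (hq₁ : q ρ₁ ≠ ∞) (hq₂ : q ρ₂ ≠ ∞) :
    minWeightedEnergy s (closedBall 0 1) Q ≠ ∞ := by
  set A := {x : EuclideanSpace ℝ (Fin (m + 2)) | ‖x‖ ∈ Ioo ρ₁ ρ₂} with hA
  have hAm : MeasurableSet A := (isOpen_shell _ _ _).measurableSet
  have hA1 : A ⊆ closedBall 0 1 := shell_subset_closedBall hρ₂
  have hA0 : volume A ≠ 0 := (volume_shell_pos hρ₁ hρ).ne'
  have hAt : volume A ≠ ∞ := ((measure_mono hA1).trans_lt measure_closedBall_lt_top).ne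
  have : IsFiniteMeasure (volume.restrict A) := ⟨by simpa using lt_top_iff_ne_top.2 hAt⟩
  set ν := (volume A)⁻¹ • volume.restrict A with hν
  have hinv : (volume A)⁻¹ ≠ ∞ := by simpa using hA0
  have hνm : ν ∈ unitMeasures (closedBall 0 1) := by
    refine ⟨⟨by simp [hν, ENNReal.inv_mul_cancel hA0 hAt]⟩, ?_⟩
    have : A ∩ (closedBall (0 : EuclideanSpace ℝ (Fin (m + 2))) 1)ᶜ = ∅ :=
      disjoint_iff_inter_eq_empty.1 (disjoint_compl_right_iff_subset.2 hA1)
    rw [hν, Measure.smul_apply, Measure.restrict_apply' hAm, inter_comm, this]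
    simp
  refine ne_top_of_le_ne_top ?_ (iInf₂_le ν hνm)
  refine ENNReal.add_ne_top.2 ⟨?_, ENNReal.mul_ne_top (by simp) ?_⟩
  · rw [hν, rieszEnergy_smul]
    exact ENNReal.mul_ne_top hinv (ENNReal.mul_ne_top hinv
      (rieszEnergy_restrict_volume_ne_top (by omega) (by push_cast; exact hsn) hA1))
  · rw [hν, lintegral_smul_measure, smul_eq_mul]
    refine ENNReal.mul_ne_top hinv ?_
    have hle : ∀ x ∈ A, Q x ≤ q ρ₁ + q ρ₂ := by
      intro x hx
      obtain ⟨a, b, -, -, hab, hr⟩ := exists_nnreal_combo hx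
      rw [hrot x (mem_closedBall_zero_iff.1 (hA1 hx)), hr]
      refine (hconv.ennreal_le ⟨hρ₁, by linarith⟩ ⟨by linarith, hρ₂⟩ hab).trans ?_
      have ha : (a : ℝ≥0∞) ≤ 1 := by
        exact_mod_cast hab ▸ le_self_add
      have hb : (b : ℝ≥0∞) ≤ 1 := by
        exact_mod_cast hab ▸ le_add_self
      exact add_le_add (mul_le_of_le_one_left' ha) (mul_le_of_le_one_left' hb)
    refine ne_top_of_le_ne_top ?_ (setLIntegral_mono' hAm hle)
    rw [setLIntegral_const]
    exact ENNReal.mul_ne_top (ENNReal.add_ne_top.2 ⟨hq₁, hq₂⟩) hAt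

variable {μ : Measure (EuclideanSpace ℝ (Fin (m + 2)))}

/-- Lebesgue measure on the shell is nonzero with finite energy, so
`IsExtremalMeasure.measure_eq_zero_of_lt` excludes it. All the support arguments end in this
contradiction. -/
lemma IsExtremalMeasure.not_forall_shell_lt (hs : 0 < s) (hsn : s < m + 2)
    (hrot : ∀ x, ‖x‖ ≤ 1 → Q x = q ‖x‖) (hfin : minWeightedEnergy s (closedBall 0 1) Q ≠ ∞)
    (hμ : IsExtremalMeasure s (closedBall 0 1) Q μ) (hinv : IsRotationInvariant μ) {t₁ t₂ : ℝ}
    (h0 : 0 ≤ t₁) (h12 : t₁ < t₂) (h1 : t₂ ≤ 1)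
    (hlt : ∀ t ∈ Ioo t₁ t₂, rieszPotential s μ (EuclideanSpace.single 0 t) + q t <
      rieszEnergy s μ + ∫⁻ x, Q x ∂μ) : False := by
  set A := {x : EuclideanSpace ℝ (Fin (m + 2)) | ‖x‖ ∈ Ioo t₁ t₂} with hA
  have hAm : MeasurableSet A := (isOpen_shell _ _ _).measurableSet
  have hA1 : A ⊆ closedBall 0 1 := shell_subset_closedBall h1
  have hAt : volume A ≠ ∞ := ((measure_mono hA1).trans_lt measure_closedBall_lt_top).ne
  have : IsFiniteMeasure (volume.restrict A) := ⟨by simpa using lt_top_iff_ne_top.2 hAt⟩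
  have h := hμ.measure_eq_zero_of_lt (ν := volume.restrict A) hs hfin ?_
    (rieszEnergy_restrict_volume_ne_top (by omega) (by push_cast; exact hsn) hA1) ?_
  · rw [Measure.restrict_eq_zero] at h
    exact (volume_shell_pos h0 h12).ne' h
  · rw [Measure.restrict_apply' hAm, inter_comm,
      disjoint_iff_inter_eq_empty.1 (disjoint_compl_right_iff_subset.2 hA1)]
    simp
  · refine (ae_restrict_mem hAm).mono fun x hx ↦ ?_
    rw [hrot x (mem_closedBall_zero_iff.1 (hA1 hx)), hinv.rieszPotential_eq s
      (y := EuclideanSpace.single 0 ‖x‖) (by simp)]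
    exact hlt _ hx

/-- By convexity q stays below its chord from a to ρ, so it grows at most linearly. The cusp, used
with the slope of that chord as `L`, wins. -/
lemma rieszPotential_add_lt_of_sphere [IsProbabilityMeasure μ] (hs : 0 < s) (hsm : (m : ℝ) < s)
    (hinv : IsRotationInvariant μ) (hconv : ConvexOn ℝ≥0 (Icc (0 : ℝ) 1) q) {a ρ : ℝ}
    (ha0 : 0 < a) (ha1 : a ≤ 1) (hμ : ∀ᵐ y ∂μ, ‖y‖ = a) (hρ : ρ ∈ Icc (0 : ℝ) 1) (hρa : ρ ≠ a)
    (hqa : q a ≠ ∞) (hqρ : q ρ ≠ ∞)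
    (hU : rieszPotential s μ (EuclideanSpace.single 0 a) ≠ ∞) :
    ∀ᶠ r in 𝓝[≠] a, (∃ θ : ℝ, 0 ≤ θ ∧ θ ≤ 1 ∧ r = (1 - θ) * a + θ * ρ) →
      rieszPotential s μ (EuclideanSpace.single 0 r) + q r <
        rieszPotential s μ (EuclideanSpace.single 0 a) + q a := by
  have hi := integrable_of_rieszPotential_ne_top hs hU
  have hne := ae_ne_of_rieszPotential_ne_top hs hU
  have hd : 0 < |ρ - a| := abs_pos.2 (sub_ne_zero.2 hρa)
  filter_upwards [self_mem_nhdsWithin, eventually_axisPotential_lt (p := s / 2) (by linarith)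
    (by linarith) ha0 hinv hμ hne hi (((q ρ).toReal - (q a).toReal) / |ρ - a|),
    nhdsWithin_le_nhds (Ioo_mem_nhds ha0 (by linarith : a < 2 * a))] with r hra hr hrI
  rintro ⟨θ, hθ0, hθ1, hrθ⟩
  have hne' : ∀ᵐ y ∂μ, y ≠ EuclideanSpace.single 0 r := by
    refine hμ.mono fun y hy h ↦ hra ?_
    rwa [h, PiLp.norm_single, Real.norm_of_nonneg hrI.1.le] at hy
  have hir := (axisPotential_le_of_sphere (p := s / 2) (by linarith) ha0 hrI.1 hrI.2.le hra hμ hne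
    hi).1
  rw [rieszPotential_single_eq hne hi, rieszPotential_single_eq hne' hir]
  have hqr : q r ≤ ENNReal.ofReal ((1 - θ) * (q a).toReal + θ * (q ρ).toReal) := by
    have h1 := hconv.ennreal_le (a := ⟨1 - θ, by linarith⟩) (b := ⟨θ, hθ0⟩) ⟨ha0.le, ha1⟩ hρ
      (NNReal.eq (by change 1 - θ + θ = 1; ring))
    change q ((1 - θ) * a + θ * ρ) ≤ _ at h1
    rw [hrθ]
    refine h1.trans (le_of_eq ?_)
    have e1 : 0 ≤ (1 - θ) * (q a).toReal := mul_nonneg (by linarith) ENNReal.toReal_nonneg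
    rw [ENNReal.ofReal_add e1 (mul_nonneg hθ0 ENNReal.toReal_nonneg),
      ENNReal.ofReal_mul (by linarith), ENNReal.ofReal_mul hθ0, ENNReal.ofReal_toReal hqa,
      ENNReal.ofReal_toReal hqρ, ENNReal.ofReal_eq_coe_nnreal (show 0 ≤ 1 - θ by linarith),
      ENNReal.ofReal_eq_coe_nnreal hθ0]
    rfl
  have hv0 : 0 ≤ (1 - θ) * (q a).toReal + θ * (q ρ).toReal :=
    add_nonneg (mul_nonneg (by linarith) ENNReal.toReal_nonneg)
      (mul_nonneg hθ0 ENNReal.toReal_nonneg)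
  have hδ : |r - a| = θ * |ρ - a| := by
    rw [hrθ, ← abs_of_nonneg hθ0, ← abs_mul, abs_of_nonneg hθ0]
    congr 1
    ring
  have hr' : axisPotential (s / 2) μ r + ((1 - θ) * (q a).toReal + θ * (q ρ).toReal) <
      axisPotential (s / 2) μ a + (q a).toReal := by
    have e : ((q ρ).toReal - (q a).toReal) / |ρ - a| * |r - a| =
        θ * ((q ρ).toReal - (q a).toReal) := by
      rw [hδ]
      field_simp
    rw [e] at hr
    linarith
  calc ENNReal.ofReal (axisPotential (s / 2) μ r) + q r
      ≤ ENNReal.ofReal (axisPotential (s / 2) μ r +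
          ((1 - θ) * (q a).toReal + θ * (q ρ).toReal)) := by
        rw [ENNReal.ofReal_add (axisPotential_nonneg _ _ _) hv0]
        gcongr
    _ < ENNReal.ofReal (axisPotential (s / 2) μ a + (q a).toReal) :=
        (ENNReal.ofReal_lt_ofReal_iff_of_nonneg
          (add_nonneg (axisPotential_nonneg _ _ _) hv0)).2 hr'
    _ = ENNReal.ofReal (axisPotential (s / 2) μ a) + q a := by
        rw [ENNReal.ofReal_add (axisPotential_nonneg _ _ _) ENNReal.toReal_nonneg,
          ENNReal.ofReal_toReal hqa]

/-- The extremal measure of a convex radial field does not live on a sphere. -/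
lemma IsExtremalMeasure.not_ae_norm_eq (hs : 0 < s) (hsm : (m : ℝ) < s) (hsn : s < m + 2)
    (hrot : ∀ x, ‖x‖ ≤ 1 → Q x = q ‖x‖) (hconv : ConvexOn ℝ≥0 (Icc (0 : ℝ) 1) q)
    (hfin : minWeightedEnergy s (closedBall 0 1) Q ≠ ∞)
    (hμ : IsExtremalMeasure s (closedBall 0 1) Q μ) (hinv : IsRotationInvariant μ) {a ρ : ℝ}
    (ha0 : 0 < a) (ha1 : a ≤ 1) (hρ : ρ ∈ Icc (0 : ℝ) 1) (hρa : ρ ≠ a) (hqρ : q ρ ≠ ∞)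
    (hW : rieszPotential s μ (EuclideanSpace.single 0 a) + q a ≤
      rieszEnergy s μ + ∫⁻ x, Q x ∂μ) : ¬ ∀ᵐ y ∂μ, ‖y‖ = a := by
  intro hae
  have := hμ.1.1
  obtain ⟨hμ1, hμ2⟩ := hμ.energies_ne_top hfin
  obtain ⟨hU, hqa⟩ := ENNReal.add_ne_top.1
    (ne_top_of_le_ne_top (ENNReal.add_ne_top.2 ⟨hμ1, hμ2⟩) hW)
  have hev := rieszPotential_add_lt_of_sphere hs hsm hinv hconv ha0 ha1 hae hρ hρa hqa hqρ hU
  rw [eventually_nhdsWithin_iff, Metric.eventually_nhds_iff] at hev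
  obtain ⟨ε, hε, hev⟩ := hev
  -- The shell lies on the side of a that contains ρ, since q may be infinite on the other side.
  rcases lt_or_gt_of_ne hρa with hlt | hgt
  · refine hμ.not_forall_shell_lt hs hsn hrot hfin hinv (t₁ := max ρ (a - ε)) (t₂ := a)
      (hρ.1.trans (le_max_left _ _)) (max_lt hlt (by linarith)) ha1 fun t ht ↦ ?_
    have h1 := (max_lt_iff.1 ht.1)
    have h0 : 0 < a - ρ := sub_pos.2 hlt
    refine (hev ?_ ht.2.ne ⟨(a - t) / (a - ρ), div_nonneg (by linarith [ht.2]) h0.le, ?_, ?_⟩).trans_le hW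
    · rw [Real.dist_eq, abs_lt]
      exact ⟨by linarith, by linarith [ht.2]⟩
    · rw [div_le_one h0]
      linarith
    · field_simp
      ring
  · refine hμ.not_forall_shell_lt hs hsn hrot hfin hinv (t₁ := a) (t₂ := min ρ (a + ε))
      ha0.le (lt_min hgt (by linarith)) ((min_le_left _ _).trans hρ.2) fun t ht ↦ ?_
    have h1 := (lt_min_iff.1 ht.2)
    have h0 : 0 < ρ - a := sub_pos.2 hgt
    refine (hev ?_ ht.1.ne' ⟨(t - a) / (ρ - a), div_nonneg (by linarith [ht.1]) h0.le, ?_, ?_⟩).trans_le hW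
    · rw [Real.dist_eq, abs_lt]
      exact ⟨by linarith [ht.1], by linarith⟩
    · rw [div_le_one h0]
      linarith
    · field_simp
      ring

/-- The support of the extremal measure of a convex radial field on a ball is a spherical shell. -/
theorem IsExtremalMeasure.support_eq_shell (hs : 0 < s) (hsm : (m : ℝ) < s) (hsn : s < m + 2)
    (hQ : LowerSemicontinuous Q) (hrot : ∀ x, ‖x‖ ≤ 1 → Q x = q ‖x‖)
    (hconv : ConvexOn ℝ≥0 (Icc (0 : ℝ) 1) q) {ρ₁ ρ₂ : ℝ} (hρ₁ : 0 ≤ ρ₁) (hρ : ρ₁ < ρ₂)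
    (hρ₂ : ρ₂ ≤ 1) (hq₁ : q ρ₁ ≠ ∞) (hq₂ : q ρ₂ ≠ ∞)
    (hμ : IsExtremalMeasure s (closedBall 0 1) Q μ) (hinv : IsRotationInvariant μ) :
    ∃ a b : ℝ, 0 ≤ a ∧ a < b ∧ b ≤ 1 ∧ μ.support = {x | ‖x‖ ∈ Icc a b} ∧
      (MonotoneOn q (Icc (0 : ℝ) 1) → a = 0) ∧ (AntitoneOn q (Icc (0 : ℝ) 1) → b = 1) := by
  have hfin := minWeightedEnergy_ne_top hsn hrot hconv hρ₁ hρ hρ₂ hq₁ hq₂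
  have := hμ.1.1
  obtain ⟨hμ1, hμ2⟩ := hμ.energies_ne_top hfin
  have hF := ENNReal.add_ne_top.2 ⟨hμ1, hμ2⟩
  have hμ0 : μ ≠ 0 := IsProbabilityMeasure.ne_zero μ
  set S : Set ℝ := {r | 0 ≤ r ∧ EuclideanSpace.single 0 r ∈ μ.support} with hS
  have hsupp : ∀ x, x ∈ μ.support ↔ ‖x‖ ∈ S := by
    intro x
    have h : ‖x‖ = ‖(EuclideanSpace.single 0 ‖x‖ : EuclideanSpace ℝ (Fin (m + 2)))‖ := by simp
    exact ⟨fun hx ↦ ⟨norm_nonneg x, hinv.mem_support_of_norm_eq h hx⟩,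
      fun hx ↦ hinv.mem_support_of_norm_eq h.symm hx.2⟩
  have hball : μ.support ⊆ closedBall 0 1 :=
    Measure.support_subset_of_isClosed isClosed_closedBall hμ.1.2
  have hS1 : S ⊆ Icc 0 1 := by
    intro r hr
    have := mem_closedBall_zero_iff.1 (hball hr.2)
    rw [PiLp.norm_single, Real.norm_of_nonneg hr.1] at this
    exact ⟨hr.1, this⟩
  have hScl : IsClosed S := by
    refine isClosed_Ici.inter (Measure.isClosed_support.preimage ?_)
    exact (Isometry.of_dist_eq fun b₁ b₂ ↦
      PiLp.dist_single_same 2 (fun _ : Fin (m + 2) ↦ ℝ) 0 b₁ b₂).continuous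
  have hSc : IsCompact S := isCompact_Icc.of_isClosed_subset hScl hS1
  have hSne : S.Nonempty := by
    obtain ⟨x, hx⟩ := Measure.nonempty_support hμ0
    exact ⟨‖x‖, (hsupp x).1 hx⟩
  have hSae : ∀ᵐ y ∂μ, ‖y‖ ∈ S := by
    have h : ∀ᵐ y ∂μ, y ∈ μ.support := Measure.support_mem_ae
    exact h.mono fun y hy ↦ (hsupp y).1 hy
  have hW : ∀ r ∈ S, rieszPotential s μ (EuclideanSpace.single 0 r) + q r ≤
      rieszEnergy s μ + ∫⁻ x, Q x ∂μ := by
    intro r hr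
    have h := hμ.potential_le_of_mem_support hs hQ hfin hr.2
    have hn : ‖(EuclideanSpace.single 0 r : EuclideanSpace ℝ (Fin (m + 2)))‖ = r := by
      rw [PiLp.norm_single, Real.norm_of_nonneg hr.1]
    rwa [hrot _ (by rw [hn]; exact (hS1 hr).2), hn] at h
  have hUq : ∀ r ∈ S, rieszPotential s μ (EuclideanSpace.single 0 r) ≠ ∞ ∧ q r ≠ ∞ :=
    fun r hr ↦ ENNReal.add_ne_top.1 (ne_top_of_le_ne_top hF (hW r hr))
  set a := sInf S with ha
  set b := sSup S with hb
  have haS : a ∈ S := hSc.sInf_mem hSne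
  have hbS : b ∈ S := hSc.sSup_mem hSne
  have haM : ∀ r ∈ S, a ≤ r := fun r hr ↦ csInf_le hSc.bddBelow hr
  have hbM : ∀ r ∈ S, r ≤ b := fun r hr ↦ le_csSup hSc.bddAbove hr
  have hab : a < b := by
    refine lt_of_le_of_ne (haM b hbS) fun hab ↦ ?_
    have hae : ∀ᵐ y ∂μ, ‖y‖ = a :=
      hSae.mono fun y hy ↦ le_antisymm (hab ▸ hbM _ hy) (haM _ hy)
    -- At a = 0 all the mass would sit at the origin, where the finite potential forbids an atom.
    -- For a > 0, at least one of ρ₁, ρ₂ differs from a and serves as the second radius.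
    rcases haS.1.eq_or_lt with h0 | h0
    · obtain ⟨y, hy, hy'⟩ := (hae.and (ae_ne_of_rieszPotential_ne_top hs (hUq a haS).1)).exists
      rw [← h0, norm_eq_zero] at hy
      exact hy' (by rw [hy, ← h0]; exact (norm_eq_zero.1 (by simp)).symm)
    · rcases eq_or_ne ρ₁ a with h1 | h1
      · exact hμ.not_ae_norm_eq hs hsm hsn hrot hconv hfin hinv h0 (hS1 haS).2
          ⟨by linarith, hρ₂⟩ (by linarith : a < ρ₂).ne' hq₂ (hW a haS) hae
      · exact hμ.not_ae_norm_eq hs hsm hsn hrot hconv hfin hinv h0 (hS1 haS).2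
          ⟨hρ₁, by linarith⟩ h1 hq₁ (hW a haS) hae
  have hIcc : ∀ t ∈ Ioo a b, t ∈ S := by
    intro t ht
    by_contra htS
    have hc1 : IsCompact (S ∩ Iic t) := hSc.inter_right isClosed_Iic
    have hc2 : IsCompact (S ∩ Ici t) := hSc.inter_right isClosed_Ici
    have h1 := hc1.sSup_mem ⟨a, haS, ht.1.le⟩
    have h2 := hc2.sInf_mem ⟨b, hbS, ht.2.le⟩
    -- The ends of the gap around t belong to the closed set `S`, so U + q ≤ F holds at both.
    set r₁ := sSup (S ∩ Iic t) with hr₁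
    set r₂ := sInf (S ∩ Ici t) with hr₂
    have h1t : r₁ < t := lt_of_le_of_ne h1.2 fun h ↦ htS (h ▸ h1.1)
    have h2t : t < r₂ := lt_of_le_of_ne h2.2 fun h ↦ htS (h ▸ h2.1)
    have hμS : μ {x | ‖x‖ ∈ Icc 0 r₁ ∪ Icc r₂ 1}ᶜ = 0 := by
      have h : ∀ᵐ y ∂μ, ‖y‖ ∈ Icc 0 r₁ ∪ Icc r₂ 1 := by
        refine hSae.mono fun y hy ↦ ?_
        rcases le_total ‖y‖ t with h | h
        · exact Or.inl ⟨norm_nonneg y, le_csSup hc1.bddAbove ⟨hy, h⟩⟩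
        · exact Or.inr ⟨csInf_le hc2.bddBelow ⟨hy, h⟩, (hS1 hy).2⟩
      exact h
    refine hμ.not_forall_shell_lt hs hsn hrot hfin hinv h1.1.1 (h1t.trans h2t) (hS1 h2.1).2
      fun r hr ↦ ?_
    obtain ⟨α, β, hα, hβ, hαβ, rfl⟩ := exists_nnreal_combo hr
    have e1 := rieszPotential_lt_of_gap hs hsm h1.1.1 (h1t.trans h2t) hinv hμ0 hμS
      (hUq r₁ h1.1).1 (hUq r₂ h2.1).1 hα hβ hαβ
    have e2 := hconv.ennreal_le (hS1 h1.1) (hS1 h2.1) hαβ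
    -- In [0, ∞] a strict inequality survives addition only if the added field value is finite.
    have e3 : q (α * r₁ + β * r₂) ≠ ∞ := ne_top_of_le_ne_top
      (ENNReal.add_ne_top.2 ⟨ENNReal.mul_ne_top ENNReal.coe_ne_top (hUq r₁ h1.1).2,
        ENNReal.mul_ne_top ENNReal.coe_ne_top (hUq r₂ h2.1).2⟩) e2
    refine (ENNReal.add_lt_add_of_lt_of_le e3 e1 e2).trans_le ?_
    have hαβ' : (α : ℝ≥0∞) + β = 1 := by exact_mod_cast hαβ
    calc _ = α * (rieszPotential s μ (EuclideanSpace.single 0 r₁) + q r₁) +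
          β * (rieszPotential s μ (EuclideanSpace.single 0 r₂) + q r₂) := by ring
      _ ≤ α * (rieszEnergy s μ + ∫⁻ x, Q x ∂μ) + β * (rieszEnergy s μ + ∫⁻ x, Q x ∂μ) := by
          exact add_le_add (mul_le_mul' le_rfl (hW r₁ h1.1)) (mul_le_mul' le_rfl (hW r₂ h2.1))
      _ = rieszEnergy s μ + ∫⁻ x, Q x ∂μ := by rw [← add_mul, hαβ', one_mul]
  refine ⟨a, b, haS.1, hab, (hS1 hbS).2, ?_, ?_, ?_⟩
  · ext x
    rw [hsupp]
    refine ⟨fun hx ↦ ⟨haM _ hx, hbM _ hx⟩, fun hx ↦ ?_⟩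
    rcases hx.1.eq_or_lt with h | h
    · exact h ▸ haS
    · rcases hx.2.eq_or_lt with h' | h'
      · exact h' ▸ hbS
      · exact hIcc _ ⟨h, h'⟩
  · intro hmono
    by_contra hne
    have ha0 : 0 < a := lt_of_le_of_ne haS.1 (Ne.symm hne)
    have hμS : μ {x | ‖x‖ ∈ Icc a 1}ᶜ = 0 := by
      have h : ∀ᵐ y ∂μ, ‖y‖ ∈ Icc a 1 := hSae.mono fun y hy ↦ ⟨haM _ hy, (hS1 hy).2⟩
      exact h
    refine hμ.not_forall_shell_lt hs hsn hrot hfin hinv le_rfl ha0 (hS1 haS).2 fun t ht ↦ ?_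
    have e1 := rieszPotential_lt_of_outer hs hsm hinv hμ0 hμS (hUq a haS).1 ht
    have e2 : q t ≤ q a := hmono ⟨ht.1.le, ht.2.le.trans (hS1 haS).2⟩ (hS1 haS) ht.2.le
    exact (ENNReal.add_lt_add_of_lt_of_le (ne_top_of_le_ne_top (hUq a haS).2 e2) e1 e2).trans_le
      (hW a haS)
  · intro hanti
    by_contra hne
    have hb1 : b < 1 := lt_of_le_of_ne (hS1 hbS).2 hne
    refine hμ.not_forall_shell_lt hs hsn hrot hfin hinv hbS.1 hb1 le_rfl fun t ht ↦ ?_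
    have e1 := rieszPotential_lt_of_inner hs hμ0 (hSae.mono fun y hy ↦ hbM _ hy) (hUq b hbS).1 ht.1
    have e2 : q t ≤ q b := hanti (hS1 hbS) ⟨hbS.1.trans ht.1.le, ht.2.le⟩ ht.1.le
    exact (ENNReal.add_lt_add_of_lt_of_le (ne_top_of_le_ne_top (hUq b hbS).2 e2) e1 e2).trans_le
      (hW b hbS)

end RadialField

/-! ### Transfer between the ball and the disk in the hyperplane -/

section Hyperplane

open Set Filter Topology Metric

variable {m : ℕ} {s : ℝ}

/-- The embedding of `ℝⁿ` into `ℝⁿ⁺¹` as the hyperplane on which the first coordinate vanishes. -/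
noncomputable def hyperplaneEmbedding (n : ℕ) :
    EuclideanSpace ℝ (Fin n) →ₗᵢ[ℝ] EuclideanSpace ℝ (Fin (n + 1)) where
  toFun x := WithLp.toLp 2 (Fin.cons 0 x)
  map_add' x y := by
    ext i
    refine Fin.cases ?_ (fun j ↦ ?_) i <;> simp
  map_smul' c x := by
    ext i
    refine Fin.cases ?_ (fun j ↦ ?_) i <;> simp
  norm_map' x := by
    simp [EuclideanSpace.norm_eq, Fin.sum_univ_succ]

lemma hyperplaneEmbedding_apply_zero {n : ℕ} (x : EuclideanSpace ℝ (Fin n)) :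
    hyperplaneEmbedding n x 0 = 0 := rfl

lemma mem_range_hyperplaneEmbedding {n : ℕ} {x : EuclideanSpace ℝ (Fin (n + 1))} (hx : x 0 = 0) :
    x ∈ range (hyperplaneEmbedding n) := by
  refine ⟨WithLp.toLp 2 (Fin.tail x), ?_⟩
  ext i
  refine Fin.cases ?_ (fun j ↦ ?_) i
  · exact hx.symm
  · rfl

lemma hyperring_eq_image {n : ℕ} (a b : ℝ) :
    hyperring (n + 1) a b = hyperplaneEmbedding n '' {x | ‖x‖ ∈ Icc a b} := by
  ext x
  constructor
  · rintro ⟨h0, h⟩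
    obtain ⟨y, rfl⟩ := mem_range_hyperplaneEmbedding (h0 0 rfl)
    rw [LinearIsometry.norm_map] at h
    exact ⟨y, h, rfl⟩
  · rintro ⟨y, hy, rfl⟩
    refine ⟨fun i hi ↦ ?_, by rw [LinearIsometry.norm_map]; exact hy⟩
    rw [show i = 0 from Fin.ext hi, hyperplaneEmbedding_apply_zero]

lemma hyperring_zero (d : ℕ) (b : ℝ) : hyperring d 0 b = hyperdisk d b := by
  ext x
  exact ⟨fun h ↦ ⟨h.1, h.2.2⟩, fun h ↦ ⟨h.1, norm_nonneg x, h.2⟩⟩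

lemma hyperdisk_eq_image {n : ℕ} (b : ℝ) :
    hyperdisk (n + 1) b = hyperplaneEmbedding n '' closedBall 0 b := by
  rw [← hyperring_zero, hyperring_eq_image]
  congr 1
  ext x
  rw [mem_closedBall_zero_iff]
  exact ⟨fun h ↦ h.2, fun h ↦ ⟨norm_nonneg x, h⟩⟩

lemma hyperplaneEmbedding_mem_hyperdisk {n : ℕ} {b : ℝ} {x : EuclideanSpace ℝ (Fin n)} :
    hyperplaneEmbedding n x ∈ hyperdisk (n + 1) b ↔ x ∈ closedBall 0 b := by
  rw [hyperdisk_eq_image, (hyperplaneEmbedding n).injective.mem_set_image]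

lemma isClosedEmbedding_hyperplaneEmbedding (n : ℕ) :
    IsClosedEmbedding (hyperplaneEmbedding n) :=
  (hyperplaneEmbedding n).isometry.isClosedEmbedding

lemma measurableEmbedding_hyperplaneEmbedding (n : ℕ) :
    MeasurableEmbedding (hyperplaneEmbedding n) :=
  (isClosedEmbedding_hyperplaneEmbedding n).measurableEmbedding

lemma rieszEnergy_map_hyperplaneEmbedding {n : ℕ} (μ : Measure (EuclideanSpace ℝ (Fin n))) :
    rieszEnergy s (μ.map (hyperplaneEmbedding n)) = rieszEnergy s μ := by
  unfold rieszEnergy rieszPotential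
  rw [(measurableEmbedding_hyperplaneEmbedding n).lintegral_map]
  refine lintegral_congr fun x ↦ ?_
  rw [(measurableEmbedding_hyperplaneEmbedding n).lintegral_map]
  simp_rw [(hyperplaneEmbedding n).isometry.edist_eq]

lemma support_map_hyperplaneEmbedding {n : ℕ} (μ : Measure (EuclideanSpace ℝ (Fin n))) :
    (μ.map (hyperplaneEmbedding n)).support = hyperplaneEmbedding n '' μ.support := by
  have hι := measurableEmbedding_hyperplaneEmbedding n
  have hc := isClosedEmbedding_hyperplaneEmbedding n
  refine subset_antisymm ?_ ?_
  · refine Measure.support_subset_of_isClosed (hc.isClosedMap _ Measure.isClosed_support) ?_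
    rw [mem_ae_iff, hι.map_apply, preimage_compl, preimage_image_eq _ hι.injective]
    exact Measure.support_mem_ae
  · rintro _ ⟨x, hx, rfl⟩
    rw [Measure.mem_support_iff_forall] at hx ⊢
    intro U hU
    rw [hι.map_apply]
    exact hx _ (hc.continuous.continuousAt.preimage_mem_nhds hU)

open Classical in
/-- The function on `ℝⁿ` that restricts, on the unit ball, the field `Q` on the unit disk of the
hyperplane `x₁ = 0` of `ℝⁿ⁺¹`, and that is infinite elsewhere. -/
noncomputable def planarField {n : ℕ} (Q : EuclideanSpace ℝ (Fin (n + 1)) → ℝ≥0∞)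
    (x : EuclideanSpace ℝ (Fin n)) : ℝ≥0∞ :=
  if x ∈ closedBall 0 1 then Q (hyperplaneEmbedding n x) else ∞

lemma planarField_of_mem {n : ℕ} {Q : EuclideanSpace ℝ (Fin (n + 1)) → ℝ≥0∞}
    {x : EuclideanSpace ℝ (Fin n)} (hx : x ∈ closedBall 0 1) :
    planarField Q x = Q (hyperplaneEmbedding n x) := if_pos hx

lemma planarField_of_notMem {n : ℕ} {Q : EuclideanSpace ℝ (Fin (n + 1)) → ℝ≥0∞}
    {x : EuclideanSpace ℝ (Fin n)} (hx : x ∉ closedBall 0 1) : planarField Q x = ∞ := if_neg hx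

/-- The ball is closed and ∞ is the largest value, so the extension by ∞ cannot break lower
semicontinuity. -/
lemma LowerSemicontinuousOn.planarField_lowerSemicontinuous {n : ℕ} {Q : EuclideanSpace ℝ (Fin (n + 1)) → ℝ≥0∞}
    (hQ : LowerSemicontinuousOn Q (hyperdisk (n + 1) 1)) : LowerSemicontinuous (planarField Q) := by
  intro x c hc
  by_cases hx : x ∈ closedBall 0 1
  · rw [planarField_of_mem hx] at hc
    have h1 := hQ _ (hyperplaneEmbedding_mem_hyperdisk.2 hx) c hc
    have h2 : Tendsto (hyperplaneEmbedding n) (𝓝[closedBall 0 1] x)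
        (𝓝[hyperdisk (n + 1) 1] (hyperplaneEmbedding n x)) :=
      (hyperplaneEmbedding n).continuous.continuousWithinAt.tendsto_nhdsWithin
        fun y hy ↦ hyperplaneEmbedding_mem_hyperdisk.2 hy
    have h3 := eventually_nhdsWithin_iff.1 (h2.eventually h1)
    refine h3.mono fun y hy ↦ ?_
    change c < planarField Q y
    by_cases hyb : y ∈ closedBall 0 1
    · rw [planarField_of_mem hyb]
      exact hy hyb
    · rw [planarField_of_notMem hyb]
      exact lt_top_of_lt hc
  · rw [planarField_of_notMem hx] at hc
    filter_upwards [isClosed_closedBall.isOpen_compl.mem_nhds hx] with y hy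
    rw [planarField_of_notMem hy]
    exact hc

lemma weightedEnergy_map_hyperplaneEmbedding {n : ℕ} (Q : EuclideanSpace ℝ (Fin (n + 1)) → ℝ≥0∞)
    {μ : Measure (EuclideanSpace ℝ (Fin n))} (hμ : μ (closedBall 0 1)ᶜ = 0) :
    weightedEnergy s Q (μ.map (hyperplaneEmbedding n)) = weightedEnergy s (planarField Q) μ := by
  unfold weightedEnergy
  rw [rieszEnergy_map_hyperplaneEmbedding,
    (measurableEmbedding_hyperplaneEmbedding n).lintegral_map]
  congr 2
  have h : ∀ᵐ x ∂μ, x ∈ closedBall 0 1 := hμ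
  exact lintegral_congr_ae (h.mono fun x hx ↦ (planarField_of_mem hx).symm)

lemma map_hyperplaneEmbedding_mem_unitMeasures {n : ℕ} {b : ℝ}
    {μ : Measure (EuclideanSpace ℝ (Fin n))} :
    μ.map (hyperplaneEmbedding n) ∈ unitMeasures (hyperdisk (n + 1) b) ↔
      μ ∈ unitMeasures (closedBall 0 b) := by
  have hι := measurableEmbedding_hyperplaneEmbedding n
  have h : hyperplaneEmbedding n ⁻¹' (hyperdisk (n + 1) b)ᶜ = (closedBall 0 b)ᶜ := by
    ext x
    exact not_congr hyperplaneEmbedding_mem_hyperdisk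
  unfold unitMeasures
  rw [mem_ofPred_eq, mem_ofPred_eq, hι.map_apply, h, isProbabilityMeasure_iff,
    isProbabilityMeasure_iff, hι.map_apply, preimage_univ]

lemma exists_map_hyperplaneEmbedding_eq {n : ℕ} {b : ℝ}
    {μ : Measure (EuclideanSpace ℝ (Fin (n + 1)))} (hμ : μ ∈ unitMeasures (hyperdisk (n + 1) b)) :
    ∃ ν ∈ unitMeasures (closedBall 0 b), ν.map (hyperplaneEmbedding n) = μ := by
  have h : (μ.comap (hyperplaneEmbedding n)).map (hyperplaneEmbedding n) = μ := by
    rw [(measurableEmbedding_hyperplaneEmbedding n).map_comap]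
    refine Measure.restrict_eq_self_of_ae_mem ?_
    have h : ∀ᵐ x ∂μ, x ∈ hyperdisk (n + 1) b := hμ.2
    exact h.mono fun x hx ↦ mem_range_hyperplaneEmbedding (hx.1 0 rfl)
  exact ⟨_, map_hyperplaneEmbedding_mem_unitMeasures.1 (h.symm ▸ hμ), h⟩

lemma minWeightedEnergy_planarField {n : ℕ} (Q : EuclideanSpace ℝ (Fin (n + 1)) → ℝ≥0∞) :
    minWeightedEnergy s (hyperdisk (n + 1) 1) Q =
      minWeightedEnergy s (closedBall 0 1) (planarField Q) := by
  refine le_antisymm (le_iInf₂ fun ν hν ↦ ?_) (le_iInf₂ fun μ hμ ↦ ?_)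
  · rw [← weightedEnergy_map_hyperplaneEmbedding Q hν.2]
    exact iInf₂_le _ (map_hyperplaneEmbedding_mem_unitMeasures.2 hν)
  · obtain ⟨ν, hν, rfl⟩ := exists_map_hyperplaneEmbedding_eq hμ
    rw [weightedEnergy_map_hyperplaneEmbedding Q hν.2]
    exact iInf₂_le _ hν

lemma isExtremalMeasure_map_hyperplaneEmbedding {n : ℕ}
    {Q : EuclideanSpace ℝ (Fin (n + 1)) → ℝ≥0∞} {μ : Measure (EuclideanSpace ℝ (Fin n))} :
    IsExtremalMeasure s (hyperdisk (n + 1) 1) Q (μ.map (hyperplaneEmbedding n)) ↔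
      IsExtremalMeasure s (closedBall 0 1) (planarField Q) μ := by
  unfold IsExtremalMeasure
  rw [map_hyperplaneEmbedding_mem_unitMeasures, minWeightedEnergy_planarField]
  exact and_congr_right fun h ↦ by rw [weightedEnergy_map_hyperplaneEmbedding Q h.2]

/-- An isometry preserves Hausdorff measure, and in dimension n + 1 the Hausdorff measure is a Haar
measure, for which spheres are null. -/
lemma hausdorffMeasure_image_sphere {n : ℕ} (r : ℝ) :
    Measure.hausdorffMeasure ((n + 2 : ℕ) - 1 : ℝ)
      (hyperplaneEmbedding (n + 1) '' sphere 0 r) = 0 := by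
  have e : (((n + 2 : ℕ) : ℝ) - 1) = ((n + 1 : ℕ) : ℝ) := by push_cast; ring
  rw [e, (hyperplaneEmbedding (n + 1)).isometry.hausdorffMeasure_image (Or.inl (by positivity))]
  exact Measure.addHaar_sphere _ _ _

/-- Were q finite at no two radii, the set where Q is finite would lie in a single sphere and have
no area. -/
lemma IsExternalField.exists_radii {n : ℕ} {Q : EuclideanSpace ℝ (Fin (n + 2)) → ℝ≥0∞}
    (hQ : IsExternalField (hyperdisk (n + 2) 1) Q) {q : ℝ → ℝ≥0∞}
    (hrot : ∀ x ∈ hyperdisk (n + 2) 1, Q x = q ‖x‖) :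
    ∃ ρ₁ ρ₂ : ℝ, 0 ≤ ρ₁ ∧ ρ₁ < ρ₂ ∧ ρ₂ ≤ 1 ∧ q ρ₁ ≠ ∞ ∧ q ρ₂ ≠ ∞ := by
  by_contra! H
  refine hQ.finite_pos.ne' ?_
  rcases eq_empty_or_nonempty {x ∈ hyperdisk (n + 2) 1 | Q x < ∞} with h | ⟨y, hy, hyQ⟩
  · rw [h, measure_empty]
  refine measure_mono_null ?_ (hausdorffMeasure_image_sphere (n := n) ‖y‖)
  rintro x ⟨hx, hxQ⟩
  obtain ⟨z, rfl⟩ := mem_range_hyperplaneEmbedding (hx.1 0 rfl)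
  refine ⟨z, ?_, rfl⟩
  rw [mem_sphere_zero_iff_norm, ← (hyperplaneEmbedding (n + 1)).norm_map z]
  rw [hrot _ hx] at hxQ
  rw [hrot _ hy] at hyQ
  rcases lt_trichotomy ‖hyperplaneEmbedding (n + 1) z‖ ‖y‖ with h | h | h
  · exact absurd (H _ _ (norm_nonneg _) h hy.2 hxQ.ne) hyQ.ne
  · exact h
  · exact absurd (H _ _ (norm_nonneg _) h hx.2 hyQ.ne) hxQ.ne

end Hyperplane

theorem theorem1 (d : ℕ) (hd : 3 ≤ d) (lam s : ℝ) (hlam0 : 0 < lam) (hlam1 : lam < 1)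
    (hs : s = ((d : ℝ) - 3) + 2 * lam)
    (Q : EuclideanSpace ℝ (Fin d) → ℝ≥0∞) (hQ : IsExternalField (hyperdisk d 1) Q)
    (q : ℝ → ℝ≥0∞) (hrot : ∀ x ∈ hyperdisk d 1, Q x = q ‖x‖)
    (hconv : ConvexOn ℝ≥0 (Set.Icc (0 : ℝ) 1) q) :
    (∃! μ : Measure (EuclideanSpace ℝ (Fin d)), IsExtremalMeasure s (hyperdisk d 1) Q μ) ∧
    ∀ μ : Measure (EuclideanSpace ℝ (Fin d)), IsExtremalMeasure s (hyperdisk d 1) Q μ →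
      ∃ a b : ℝ, 0 ≤ a ∧ a < b ∧ b ≤ 1 ∧ μ.support = hyperring d a b ∧
        (MonotoneOn q (Set.Icc (0 : ℝ) 1) → a = 0 ∧ μ.support = hyperdisk d b) ∧
        (AntitoneOn q (Set.Icc (0 : ℝ) 1) → b = 1) := by
  -- The ball then has dimension m + 2, and 0 < λ < 1 becomes m < s < m + 2.
  obtain ⟨m, rfl⟩ : ∃ m, d = m + 3 := ⟨d - 3, by omega⟩
  have hsm : s = m + 2 * lam := by rw [hs]; push_cast; ring
  have hm : (0 : ℝ) ≤ m := m.cast_nonneg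
  have hs0 : 0 < s := by linarith
  have hs1 : (m : ℝ) < s := by linarith
  have hs2 : s < m + 2 := by linarith
  obtain ⟨ρ₁, ρ₂, h0, h12, h1, hq₁, hq₂⟩ := hQ.exists_radii hrot
  have hlsc := hQ.lowerSemicontinuousOn.planarField_lowerSemicontinuous
  have hrot' : ∀ x : EuclideanSpace ℝ (Fin (m + 2)), ‖x‖ ≤ 1 → planarField Q x = q ‖x‖ := by
    intro x hx
    have hx' := mem_closedBall_zero_iff.2 hx
    rw [planarField_of_mem hx', hrot _ (hyperplaneEmbedding_mem_hyperdisk.2 hx'),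
      LinearIsometry.norm_map]
  have hinvQ : ∀ (R : EuclideanSpace ℝ (Fin (m + 2)) ≃ₗᵢ[ℝ] EuclideanSpace ℝ (Fin (m + 2)))
      (x : EuclideanSpace ℝ (Fin (m + 2))), planarField Q (R x) = planarField Q x := by
    intro R x
    by_cases hx : ‖x‖ ≤ 1
    · rw [hrot' x hx, hrot' (R x) (by rwa [R.norm_map]), R.norm_map]
    · rw [planarField_of_notMem (mt mem_closedBall_zero_iff.1 hx), planarField_of_notMem]
      rwa [mem_closedBall_zero_iff, R.norm_map]
  have hfin : minWeightedEnergy s (Metric.closedBall 0 1) (planarField Q) ≠ ∞ :=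
    minWeightedEnergy_ne_top hs2 hrot' hconv h0 h12 h1 hq₁ hq₂
  have huniq : ∀ μ ν, IsExtremalMeasure s (hyperdisk (m + 3) 1) Q μ →
      IsExtremalMeasure s (hyperdisk (m + 3) 1) Q ν → μ = ν := by
    intro μ ν hμ hν
    obtain ⟨μ, -, rfl⟩ := exists_map_hyperplaneEmbedding_eq hμ.1
    obtain ⟨ν, -, rfl⟩ := exists_map_hyperplaneEmbedding_eq hν.1
    rw [IsExtremalMeasure.unique hs0 hfin (isExtremalMeasure_map_hyperplaneEmbedding.1 hμ)
      (isExtremalMeasure_map_hyperplaneEmbedding.1 hν)]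
  obtain ⟨ν, hν⟩ := exists_isExtremalMeasure s (isCompact_closedBall
    (0 : EuclideanSpace ℝ (Fin (m + 2))) 1) ⟨0, Metric.mem_closedBall_self zero_le_one⟩ hlsc
  have hinv := hν.isRotationInvariant hs0 hlsc.measurable hinvQ hfin
  have hν' := isExtremalMeasure_map_hyperplaneEmbedding.2 hν
  refine ⟨⟨_, hν', fun μ hμ ↦ huniq _ _ hμ hν'⟩, fun μ hμ ↦ ?_⟩
  obtain ⟨a, b, ha, hab, hb, hsupp, hmono, hanti⟩ :=
    hν.support_eq_shell hs0 hs1 hs2 hlsc hrot' hconv h0 h12 h1 hq₁ hq₂ hinv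
  have hμsupp : μ.support = hyperring (m + 3) a b := by
    rw [huniq _ _ hμ hν', support_map_hyperplaneEmbedding, hsupp, hyperring_eq_image]
  refine ⟨a, b, ha, hab, hb, hμsupp, fun h ↦ ?_, hanti⟩
  obtain rfl := hmono h
  exact ⟨rfl, by rw [hμsupp, hyperring_zero]⟩
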